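/- **Setting.** Let $A$ and $B$ consist of $n$ and $m$ qubits. For a bit string $x$ let $|x|$ be its number of ones, let $\Pi_a=\sum_{|x|=a}|x\rangle\langle x|$ (on $A$ or on $B$), and for an integer $-m\le i\le n$ put $P_i=\sum_{a-b=i}\Pi_a\otimes\Pi_b$. Let $\sigma^\Gamma$ be the partial transpose of $\sigma$ with respect to $B$, and $$D_2^{(i)}(\sigma)=\bigl(\mathrm{tr}\,P_i\sigma^\Gamma P_i\bigr)^2-\mathrm{tr}\bigl[(P_i\sigma^\Gamma P_i)^2\bigr].$$ Let $\rho_1,\dots,\rho_N$ be states of $AB$, possibly different from each other, each commuting with the total number operator $\mathcal N_A+\mathcal N_B=\sum_{x,y}(|x|+|y|)\,|x,y\rangle\langle x,y|$, and let $\rho_{\mathrm{avg}}=\frac1N\sum_k\rho_k$. Each $\rho_k$ is measured once, independently of the others: draw, independently for all qubits $q$, a uniformly random element $U_q$ of the single-qubit Clifford group (the finite group generated by the Hadamard and phase gates), apply $\bigotimes_q U_q$, measure in the computational basis, and on outcome $\hat b$ form the snapshot $\hat\rho_k=\bigotimes_q\bigl(3U_q^\dagger|\hat b_q\rangle\langle\hat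 b_q|U_q-\mathbb I\bigr)$. With $W_A$, $W_B$ the operators that swap the two copies of $A$, respectively of $B$, put $$Q=P_i\otimes P_i-\tfrac12W_A(P_i\otimes\mathbb I)W_B-\tfrac12W_B(P_i\otimes\mathbb I)W_A,\qquad \widehat D_2^{(i)}=\frac1{N(N-1)}\sum_{j\ne k}\mathrm{tr}\bigl(Q\,\hat\rho_j\otimes\hat\rho_k\bigr).$$ Define $$C_1=\max_{1\le k\le N}4\Bigl((\mathrm{tr}\,P_i\rho_k)^2+\tfrac{\mathrm{tr}(\rho_k^\Gamma P_i\rho_k^\Gamma)-2(\mathrm{tr}\,P_i\rho_k)^2}{\mathrm{tr}\,P_i}\Bigr),\qquad C_2=1+\frac{3\,\mathrm{tr}P_i-4+8/(\mathrm{tr}(P_i)\,2^{2(n+m)})}{2^{n+m}},$$ and, for $\epsilon,\delta\in(0,1)$ and real $c_1,c_2$, $$B(c_1,c_2)=\frac{2^{n+m}\,\mathrm{tr}(P_i)}{\epsilon^2\delta}\cdot\frac12\Bigl(c_1+\sqrt{c_1^2+c_2\,\tfrac{\epsilon^2\delta\,2^{n+m}}{\mathrm{tr}(P_i)}}\Bigr)+1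 .$$ **Theorem.** Let $\epsilon,\delta\in(0,1)$ and $-m\le i\le n$. Write $(\ast)$ for the assertion that $\bigl|\widehat D_2^{(i)}-D_2^{(i)}(\rho_{\mathrm{avg}})\bigr|\le\epsilon$ holds with probability at least $1-\delta$. 1. If $n+m\ge4$ and $N\ge B(C_1,C_2)$, then $(\ast)$ holds. 2. For all $n,m\ge 0$: if $N\ge B(C_1,4C_2)$, then $(\ast)$ holds. 3. If $n+m\ge4$ and the sector is non-trivial ($-m<i<n$), then $C_1\le4\bigl(1-1/\mathrm{tr}(P_i)\bigr)$ and $C_2\le2$; moreover, if $N\ge B(4,2)$, then $(\ast)$ holds. -/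

import Mathlib

open Matrix
open scoped Kronecker ComplexOrder

noncomputable section

/-! ### Bipartite qubit systems and the symmetry sectors -/

/-- Bit strings of length `n`: labels of the computational basis of `n` qubits. -/
abbrev Bits (n : ℕ) : Type := Fin n → Fin 2

/-- Basis labels of `AB`, where `A` has `n` qubits and `B` has `m` qubits. -/
abbrev ABIndex (n m : ℕ) : Type := Bits n × Bits m

/-- Operators on the Hilbert space of `AB`. -/
abbrev ABOp (n m : ℕ) : Type := Matrix (ABIndex n m) (ABIndex n m) ℂ

/-- Operators on two copies of `AB`. -/
abbrev ABABOp (n m : ℕ) : Type :=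
  Matrix (ABIndex n m × ABIndex n m) (ABIndex n m × ABIndex n m) ℂ

/-- A quantum state of `AB`: a positive semidefinite matrix of unit trace. -/
structure QState (n m : ℕ) where
  mat : ABOp n m
  posSemidef : mat.PosSemidef
  trace_eq_one : mat.trace = 1

/-- The number of excitations of a bit string. -/
def excitations {n : ℕ} (x : Bits n) : ℕ := ∑ k, (x k : ℕ)

/-- `Π_a`, the sum of `|x⟩⟨x|` over all bit strings `x` with `a` excitations. -/
def excitationProj (n a : ℕ) : Matrix (Bits n) (Bits n) ℂ :=
  Matrix.diagonal fun x => if excitations x = a then 1 else 0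

/-- `P_i = ∑_{a - b = i} Π_a ⊗ Π_b`. -/
def sectorProj (n m : ℕ) (i : ℤ) : ABOp n m :=
  ∑ p ∈ (Finset.range (n + 1) ×ˢ Finset.range (m + 1)).filter
    (fun p => (p.1 : ℤ) - (p.2 : ℤ) = i), excitationProj n p.1 ⊗ₖ excitationProj m p.2

/-- The dimension `tr P_i` of the sector, as a real number. -/
def sectorDim (n m : ℕ) (i : ℤ) : ℝ := (sectorProj n m i).trace.re

/-- The total number operator `𝒩_A + 𝒩_B`. -/
def numberOp (n m : ℕ) : ABOp n m :=
  Matrix.diagonal fun x => ((excitations x.1 + excitations x.2 : ℕ) : ℂ)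

/-- The partial transpose `σ^Γ` with respect to `B`. -/
def partialTranspose {n m : ℕ} (σ : ABOp n m) : ABOp n m :=
  Matrix.of fun x y => σ (x.1, y.2) (y.1, x.2)

/-- `D₂⁽ⁱ⁾(σ) = (tr P_i σ^Γ P_i)² - tr (P_i σ^Γ P_i)²`. -/
def D2 {n m : ℕ} (i : ℤ) (σ : ABOp n m) : ℂ :=
  (sectorProj n m i * partialTranspose σ * sectorProj n m i).trace ^ 2
    - ((sectorProj n m i * partialTranspose σ * sectorProj n m i) ^ 2).trace

/-- The operator exchanging the two copies of `A`. -/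
def swapA (n m : ℕ) : ABABOp n m :=
  Matrix.of fun x y => if x = ((y.2.1, y.1.2), (y.1.1, y.2.2)) then 1 else 0

/-- The operator exchanging the two copies of `B`. -/
def swapB (n m : ℕ) : ABABOp n m :=
  Matrix.of fun x y => if x = ((y.1.1, y.2.2), (y.2.1, y.1.2)) then 1 else 0

/-- The symmetric two-copy observable `Q` with `D₂⁽ⁱ⁾(σ) = tr (Q σ ⊗ σ)` on symmetric states. -/
def D2Observable (n m : ℕ) (i : ℤ) : ABABOp n m :=
  sectorProj n m i ⊗ₖ sectorProj n m i
    - (1 / 2 : ℂ) • (swapA n m * (sectorProj n m i ⊗ₖ (1 : ABOp n m)) * swapB n m)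
    - (1 / 2 : ℂ) • (swapB n m * (sectorProj n m i ⊗ₖ (1 : ABOp n m)) * swapA n m)

/-! ### The single-qubit Clifford group -/

/-- The Hadamard gate. -/
def hadamardMat : Matrix (Fin 2) (Fin 2) ℂ :=
  ((Real.sqrt 2 : ℝ) : ℂ)⁻¹ • !![1, 1; 1, -1]

/-- The phase gate. -/
def phaseMat : Matrix (Fin 2) (Fin 2) ℂ := !![1, 0; 0, Complex.I]

theorem sqrt_two_mul_self : ((Real.sqrt 2 : ℝ) : ℂ) * ((Real.sqrt 2 : ℝ) : ℂ) = 2 := by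
  rw [← Complex.ofReal_mul, Real.mul_self_sqrt (by norm_num)]; norm_num

theorem sqrt_two_ne_zero : ((Real.sqrt 2 : ℝ) : ℂ) ≠ 0 := by
  intro h
  have := sqrt_two_mul_self
  rw [h] at this
  norm_num at this

theorem inv_sqrt_two_mul_self :
    ((Real.sqrt 2 : ℝ) : ℂ)⁻¹ * ((Real.sqrt 2 : ℝ) : ℂ)⁻¹ = 1 / 2 := by
  rw [← mul_inv, sqrt_two_mul_self]; norm_num

theorem hadamardMat_mem : hadamardMat ∈ Matrix.unitaryGroup (Fin 2) ℂ := by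
  rw [Matrix.mem_unitaryGroup_iff]
  have h := inv_sqrt_two_mul_self
  ext i j
  fin_cases i <;> fin_cases j <;>
    simp [hadamardMat, Matrix.mul_apply, Fin.sum_univ_two, Matrix.star_apply] <;>
    linear_combination 2 * h

theorem phaseMat_mem : phaseMat ∈ Matrix.unitaryGroup (Fin 2) ℂ := by
  rw [Matrix.mem_unitaryGroup_iff]
  ext i j
  fin_cases i <;> fin_cases j <;>
    simp [phaseMat, Matrix.mul_apply, Fin.sum_univ_two, Matrix.star_apply]

/-- The single-qubit Clifford group: the group generated by the Hadamard and phase gates. -/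
def Cl2 : Subgroup (Matrix.unitaryGroup (Fin 2) ℂ) :=
  Subgroup.closure {⟨hadamardMat, hadamardMat_mem⟩, ⟨phaseMat, phaseMat_mem⟩}

/-- A finite set of matrices that contains the Clifford group. -/
def cliffordMats : Set (Matrix (Fin 2) (Fin 2) ℂ) :=
  {M | ∃ z u v : ℂ, z ^ 8 = 1 ∧ u ^ 4 = 1 ∧ v ^ 4 = 1 ∧
    (M = z • !![1, 0; 0, u] ∨ M = z • !![0, 1; u, 0] ∨
      M = (z * ((Real.sqrt 2 : ℝ) : ℂ)⁻¹) • !![1, u; v, -(u * v)])}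

theorem cliffordMats_finite : cliffordMats.Finite := by
  have hroot : ∀ k : ℕ, 0 < k → {z : ℂ | z ^ k = 1}.Finite := by
    intro k hk
    refine (Polynomial.nthRootsFinset k (1 : ℂ)).finite_toSet.subset ?_
    intro z hz
    exact (Polynomial.mem_nthRootsFinset hk 1).2 hz
  have hf := (hroot 8 (by norm_num)).prod ((hroot 4 (by norm_num)).prod (hroot 4 (by norm_num)))
  refine (((hf.image fun p => p.1 • !![1, 0; 0, p.2.1]).union
    (hf.image fun p => p.1 • !![0, 1; p.2.1, 0])).union
    (hf.image fun p => (p.1 * ((Real.sqrt 2 : ℝ) : ℂ)⁻¹) •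
      !![1, p.2.1; p.2.2, -(p.2.1 * p.2.2)])).subset ?_
  rintro M ⟨z, u, v, hz, hu, hv, h | h | h⟩
  · exact Or.inl (Or.inl ⟨(z, u, v), ⟨hz, hu, hv⟩, h.symm⟩)
  · exact Or.inl (Or.inr ⟨(z, u, v), ⟨hz, hu, hv⟩, h.symm⟩)
  · exact Or.inr ⟨(z, u, v), ⟨hz, hu, hv⟩, h.symm⟩

theorem phaseMat_mul_mem {M : Matrix (Fin 2) (Fin 2) ℂ} (hM : M ∈ cliffordMats) :
    phaseMat * M ∈ cliffordMats := by
  obtain ⟨z, u, v, hz, hu, hv, h⟩ := hM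
  have hI : Complex.I ^ 4 = 1 := Complex.I_pow_four
  rcases h with rfl | rfl | rfl
  · refine ⟨z, Complex.I * u, v, hz, by rw [mul_pow, hI, hu, one_mul], hv, Or.inl ?_⟩
    ext i j
    fin_cases i <;> fin_cases j <;> simp [phaseMat, Matrix.mul_apply, Fin.sum_univ_two]
    ring
  · refine ⟨z, Complex.I * u, v, hz, by rw [mul_pow, hI, hu, one_mul], hv, Or.inr (Or.inl ?_)⟩
    ext i j
    fin_cases i <;> fin_cases j <;> simp [phaseMat, Matrix.mul_apply, Fin.sum_univ_two]
    ring
  · refine ⟨z, u, Complex.I * v, hz, hu, by rw [mul_pow, hI, hv, one_mul], Or.inr (Or.inr ?_)⟩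
    ext i j
    fin_cases i <;> fin_cases j <;> simp [phaseMat, Matrix.mul_apply, Fin.sum_univ_two] <;> ring

theorem hadamardMat_mul_mem {M : Matrix (Fin 2) (Fin 2) ℂ} (hM : M ∈ cliffordMats) :
    hadamardMat * M ∈ cliffordMats := by
  obtain ⟨z, u, v, hz, hu, hv, h⟩ := hM
  have hs := inv_sqrt_two_mul_self
  set s : ℂ := ((Real.sqrt 2 : ℝ) : ℂ)⁻¹ with hsdef
  have hs8 : s ^ 8 = 1 / 16 := by
    have : s ^ 8 = (s * s) ^ 4 := by ring
    rw [this, hs]; norm_num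
  have hzu : (z * u) ^ 8 = 1 := by
    have : (z * u) ^ 8 = z ^ 8 * (u ^ 4) ^ 2 := by ring
    rw [this, hz, hu]; norm_num
  have hu3 : (u ^ 3) ^ 4 = 1 := by
    have : (u ^ 3) ^ 4 = (u ^ 4) ^ 3 := by ring
    rw [this, hu]; norm_num
  rcases h with rfl | rfl | rfl
  · refine ⟨z, u, 1, hz, hu, by norm_num, Or.inr (Or.inr ?_)⟩
    ext i j
    fin_cases i <;> fin_cases j <;>
      simp [hadamardMat, Matrix.mul_apply, Fin.sum_univ_two, ← hsdef] <;> ring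
  · refine ⟨z * u, u ^ 3, -1, hzu, hu3, by norm_num, Or.inr (Or.inr ?_)⟩
    ext i j
    fin_cases i <;> fin_cases j <;>
      simp [hadamardMat, Matrix.mul_apply, Fin.sum_univ_two, ← hsdef] <;>
      first | ring1 | linear_combination (-(s * z)) * hu
  · have hfac : (v ^ 2 + 1) * ((v - 1) * (v + 1)) = 0 := by linear_combination hv
    rcases mul_eq_zero.1 hfac with h1 | h1
    · refine ⟨z * s * (1 + v), -(u * v), -v, ?_, ?_, ?_, Or.inr (Or.inr ?_)⟩
      · have h4 : (1 + v) ^ 8 = 16 := by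
          have : (1 + v) ^ 2 = 2 * v := by linear_combination h1
          calc (1 + v) ^ 8 = ((1 + v) ^ 2) ^ 4 := by ring
            _ = 16 * v ^ 4 := by rw [this]; ring
            _ = 16 := by rw [hv]; norm_num
        rw [mul_pow, mul_pow, hz, hs8, h4]; norm_num
      · have : (-(u * v)) ^ 4 = u ^ 4 * v ^ 4 := by ring
        rw [this, hu, hv]; norm_num
      · have : (-v) ^ 4 = v ^ 4 := by ring
        rw [this, hv]
      · ext i j
        fin_cases i <;> fin_cases j <;>
          simp [hadamardMat, Matrix.mul_apply, Fin.sum_univ_two, ← hsdef]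
        · ring
        · linear_combination (s * s * z * u) * h1
        · linear_combination (s * s * z) * h1
        · linear_combination (s * s * z * u * (1 + v)) * h1
    · rcases mul_eq_zero.1 h1 with h2 | h2
      · have hv1 : v = 1 := by linear_combination h2
        subst hv1
        refine ⟨z, u, 1, hz, hu, by norm_num, Or.inl ?_⟩
        ext i j
        fin_cases i <;> fin_cases j <;>
          simp [hadamardMat, Matrix.mul_apply, Fin.sum_univ_two, ← hsdef]
        · linear_combination (2 * z) * hs
        · linear_combination (2 * z * u) * hs
      · have hv1 : v = -1 := by linear_combination h2
        subst hv1
        refine ⟨z * u, u ^ 3, 1, hzu, hu3, by norm_num, Or.inr (Or.inl ?_)⟩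
        ext i j
        fin_cases i <;> fin_cases j <;>
          simp [hadamardMat, Matrix.mul_apply, Fin.sum_univ_two, ← hsdef]
        · linear_combination (2 * z * u) * hs
        · linear_combination (2 * z) * hs - z * hu

instance : Finite Cl2 := by
  classical
  let F : Set (Matrix.unitaryGroup (Fin 2) ℂ) := {g | (g : Matrix (Fin 2) (Fin 2) ℂ) ∈ cliffordMats}
  have hF : F.Finite := cliffordMats_finite.preimage Subtype.val_injective.injOn
  have hstab : ∀ g : Matrix.unitaryGroup (Fin 2) ℂ, (∀ x ∈ F, g * x ∈ F) →
      ∀ x ∈ F, g⁻¹ * x ∈ F := by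
    intro g hg x hx
    have himg : (fun y => g * y) '' F = F :=
      Set.eq_of_subset_of_ncard_le (by rintro _ ⟨y, hy, rfl⟩; exact hg y hy)
        (by rw [Set.ncard_image_of_injective _ (mul_right_injective g)]) hF
    rw [← himg] at hx
    obtain ⟨y, hy, rfl⟩ := hx
    simpa using hy
  have hmem : ∀ g ∈ Cl2, ∀ x ∈ F, g * x ∈ F := by
    intro g hg
    induction hg using Subgroup.closure_induction with
    | mem g hg =>
      rcases hg with rfl | rfl
      · exact fun x hx => hadamardMat_mul_mem hx
      · exact fun x hx => phaseMat_mul_mem hx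
    | one => simp
    | mul a b _ _ ha hb => intro x hx; rw [mul_assoc]; exact ha _ (hb x hx)
    | inv a _ ha => exact hstab a ha
  have h1 : (1 : Matrix.unitaryGroup (Fin 2) ℂ) ∈ F :=
    ⟨1, 1, 1, by norm_num, by norm_num, by norm_num, Or.inl (by
      ext i j; fin_cases i <;> fin_cases j <;> simp)⟩
  exact (hF.subset fun g hg => by simpa using hmem g hg 1 h1).to_subtype

instance : Fintype Cl2 := Fintype.ofFinite Cl2

/-! ### Randomized single-qubit measurements and classical shadows -/

/-- The qubits of `AB`. -/
abbrev Qubit (n m : ℕ) : Type := Fin n ⊕ Fin m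

/-- The bit of the string `(a, b)` that belongs to a given qubit. -/
def bitAt {n m : ℕ} (x : ABIndex n m) (q : Qubit n m) : Fin 2 := Sum.elim x.1 x.2 q

/-- The tensor product over all qubits of single-qubit operators. -/
def tensorOp {n m : ℕ} (X : Qubit n m → Matrix (Fin 2) (Fin 2) ℂ) : ABOp n m :=
  Matrix.of fun x y => ∏ q, X q (bitAt x q) (bitAt y q)

theorem tensorOp_mul {n m : ℕ} (X Y : Qubit n m → Matrix (Fin 2) (Fin 2) ℂ) :
    tensorOp X * tensorOp Y = tensorOp fun q => X q * Y q := by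
  ext x y
  have hprod : ∏ q, (X q * Y q) (bitAt x q) (bitAt y q)
      = ∑ f : Qubit n m → Fin 2, ∏ q, X q (bitAt x q) (f q) * Y q (f q) (bitAt y q) := by
    simp only [Matrix.mul_apply]
    rw [Finset.prod_univ_sum, Fintype.piFinset_univ]
  simp only [tensorOp, Matrix.mul_apply, Matrix.of_apply, ← Finset.prod_mul_distrib] at hprod ⊢
  rw [hprod]
  exact Fintype.sum_equiv (Equiv.sumArrowEquivProdArrow (Fin n) (Fin m) (Fin 2)).symm _ _
    fun w => rfl

theorem tensorOp_one {n m : ℕ} :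
    tensorOp (fun _ : Qubit n m => (1 : Matrix (Fin 2) (Fin 2) ℂ)) = 1 := by
  ext x y
  by_cases h : x = y
  · subst h; simp [tensorOp]
  · rw [Matrix.one_apply_ne h]
    have : ∃ q, bitAt x q ≠ bitAt y q := by
      by_contra hc
      push Not at hc
      apply h
      ext k
      · exact congrArg Fin.val (hc (Sum.inl k))
      · exact congrArg Fin.val (hc (Sum.inr k))
    obtain ⟨q, hq⟩ := this
    exact Finset.prod_eq_zero (Finset.mem_univ q) (Matrix.one_apply_ne hq)

theorem tensorOp_conjTranspose {n m : ℕ} (X : Qubit n m → Matrix (Fin 2) (Fin 2) ℂ) :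
    (tensorOp X)ᴴ = tensorOp fun q => (X q)ᴴ := by
  ext x y
  simp [tensorOp, Matrix.conjTranspose_apply]

/-- A measurement setting: one single-qubit Clifford rotation for each qubit. -/
abbrev Setting (n m : ℕ) : Type := Qubit n m → Cl2

/-- The matrix of the rotation chosen for the qubit `q`. -/
def Setting.mat {n m : ℕ} (U : Setting n m) (q : Qubit n m) : Matrix (Fin 2) (Fin 2) ℂ :=
  ((U q : Matrix.unitaryGroup (Fin 2) ℂ) : Matrix (Fin 2) (Fin 2) ℂ)

/-- The global rotation `U = ⨂_q U_q`. -/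
def Setting.rotation {n m : ℕ} (U : Setting n m) : ABOp n m := tensorOp U.mat

theorem Setting.conjTranspose_mul_rotation {n m : ℕ} (U : Setting n m) :
    U.rotationᴴ * U.rotation = 1 := by
  rw [Setting.rotation, tensorOp_conjTranspose, tensorOp_mul, ← tensorOp_one]
  congr 1
  funext q
  exact Matrix.mem_unitaryGroup_iff'.1 (U q : Matrix.unitaryGroup (Fin 2) ℂ).2

/-- The Born probability `⟨x| U ρ U† |x⟩`. -/
def bornProb {n m : ℕ} (ρ : QState n m) (U : Setting n m) (x : ABIndex n m) : ℝ :=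
  ((U.rotation * ρ.mat * U.rotationᴴ) x x).re

theorem bornProb_nonneg {n m : ℕ} (ρ : QState n m) (U : Setting n m) (x : ABIndex n m) :
    0 ≤ bornProb ρ U x :=
  (Complex.le_def.1 ((ρ.posSemidef.mul_mul_conjTranspose_same U.rotation).diag_nonneg (i := x))).1

theorem bornProb_sum {n m : ℕ} (ρ : QState n m) (U : Setting n m) :
    ∑ x, bornProb ρ U x = 1 := by
  have h : (U.rotation * ρ.mat * U.rotationᴴ).trace = 1 := by
    rw [Matrix.trace_mul_comm, ← Matrix.mul_assoc, U.conjTranspose_mul_rotation, Matrix.one_mul,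
      ρ.trace_eq_one]
  have h' := congrArg Complex.re h
  simpa [Matrix.trace, bornProb] using h'

/-- The distribution of the outcome of a computational basis measurement of `U ρ U†`. -/
def outcomePMF {n m : ℕ} (ρ : QState n m) (U : Setting n m) : PMF (ABIndex n m) :=
  PMF.ofFintype (fun x => ENNReal.ofReal (bornProb ρ U x)) (by
    rw [← ENNReal.ofReal_sum_of_nonneg fun x _ => bornProb_nonneg ρ U x, bornProb_sum,
      ENNReal.ofReal_one])

/-- The classical record of one randomized measurement. -/
structure Shot (n m : ℕ) where
  setting : Setting n m
  outcome : ABIndex n m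

instance (n m : ℕ) : MeasurableSpace (Shot n m) := ⊤

/-- One randomized measurement of `ρ`: draw independent uniformly random single-qubit Clifford
rotations, rotate the state, and measure in the computational basis. -/
def shotPMF {n m : ℕ} (ρ : QState n m) : PMF (Shot n m) :=
  (PMF.uniformOfFintype (Setting n m)).bind fun U =>
    (outcomePMF ρ U).map fun x => ⟨U, x⟩

/-- The joint law of the records when `ρ_1, …, ρ_N` are measured once each, independently. -/
def shadowLaw {n m N : ℕ} (ρ : Fin N → QState n m) : MeasureTheory.Measure (Fin N → Shot n m) :=
  MeasureTheory.Measure.pi fun k => (shotPMF (ρ k)).toMeasure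

/-- The snapshot `⨂_q (3 U_q† |b_q⟩⟨b_q| U_q - 1)`. -/
def Shot.snapshot {n m : ℕ} (s : Shot n m) : ABOp n m :=
  tensorOp fun q => (3 : ℂ) • ((s.setting.mat q)ᴴ *
    Matrix.single (bitAt s.outcome q) (bitAt s.outcome q) 1 * s.setting.mat q) - 1

/-- The U-statistics estimator `(1 / (N (N - 1))) ∑_{j ≠ k} tr (Q ρ̂_j ⊗ ρ̂_k)` of `D₂⁽ⁱ⁾`. -/
def D2Estimator {n m N : ℕ} (i : ℤ) (s : Fin N → Shot n m) : ℂ :=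
  (1 / ((N : ℂ) * ((N : ℂ) - 1))) * ∑ p ∈ (Finset.univ : Finset (Fin N)).offDiag,
    (D2Observable n m i * ((s p.1).snapshot ⊗ₖ (s p.2).snapshot)).trace

/-- The average state `ρ_avg = (1 / N) ∑_k ρ_k`. -/
def avgState {n m N : ℕ} (ρ : Fin N → QState n m) : ABOp n m :=
  (1 / (N : ℂ)) • ∑ k, (ρ k).mat

/-- The estimator is `ε`-accurate with probability at least `1 - δ`. -/
def AccurateD2 {n m N : ℕ} (i : ℤ) (ρ : Fin N → QState n m) (ε δ : ℝ) : Prop :=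
  ENNReal.ofReal (1 - δ) ≤ shadowLaw ρ {s | ‖D2Estimator i s - D2 i (avgState ρ)‖ ≤ ε}

/-! ### The constants and the sample bound -/

/-- `C₁ = max_k 4 ((tr P_i ρ_k)² + (tr (ρ_k^Γ P_i ρ_k^Γ) - 2 (tr P_i ρ_k)²) / tr P_i)`;
the traces are real numbers. -/
def constC1 {n m N : ℕ} (i : ℤ) (ρ : Fin N → QState n m) : ℝ :=
  ⨆ k, 4 * ((sectorProj n m i * (ρ k).mat).trace.re ^ 2
    + ((partialTranspose (ρ k).mat * sectorProj n m i * partialTranspose (ρ k).mat).trace.re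
        - 2 * (sectorProj n m i * (ρ k).mat).trace.re ^ 2) / sectorDim n m i)

/-- `C₂ = 1 + (3 tr P_i - 4 + 8 / (tr P_i 2^{2(n+m)})) / 2^{n+m}`. -/
def constC2 (n m : ℕ) (i : ℤ) : ℝ :=
  1 + (3 * sectorDim n m i - 4 + 8 / (sectorDim n m i * 2 ^ (2 * (n + m)))) / 2 ^ (n + m)

/-- `(2^{n+m} tr P_i / (ε² δ)) (1/2) (c₁ + √(c₁² + c₂ ε² δ 2^{n+m} / tr P_i)) + 1`. -/
def sampleBound (n m : ℕ) (i : ℤ) (ε δ c₁ c₂ : ℝ) : ℝ :=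
  2 ^ (n + m) * sectorDim n m i / (ε ^ 2 * δ) * (1 / 2) *
    (c₁ + Real.sqrt (c₁ ^ 2 + c₂ * (ε ^ 2 * δ * 2 ^ (n + m) / sectorDim n m i))) + 1

end

/-! The estimator is a U-statistic of independent snapshots, so Chebyshev's inequality reduces the
theorem to a bound on its mean square error (`sum_normSq_estimator_le`). Hoeffding's decomposition
(`sum_normSq_ustatistic_le`) splits this error orthogonally into a squared bias, a linear part and a
degenerate quadratic part.

Bias: number conservation makes `ρ^Γ` commute with `P_i`, so `D₂` is the quadratic form of `Q`
(`D2_eq_pairForm`). The estimator differs from it in mean only because the pairs `j = k` are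
missing, which costs at most `2 / (N - 1)`. Linear part: contracting `Q` with a state leaves a
one-copy operator whose squared Frobenius norm is `linearNorm`, and `C₁` is the maximum of `4 *
linearNorm / tr P_i`. Quadratic part: the second moment of `tr (Q ρ̂ ⊗ ρ̂')` is at most `pairBound`,
whatever the states.

Both moment bounds come from one device, `sum_sq_sum_prod_le`. A Clifford rotation measures along a
coordinate axis, so on each qubit the relevant products of snapshot entries expand in a few real
features (four for one copy, six for two) whose absolute values do not depend on the outcome.
Passing to absolute values removes the Born probabilities. Cauchy–Schwarz with product weights then
leaves an average over settings that factorizes over qubits, and the result is read off from small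
local Gram matrices.

With `M = N - 1`, `k = n + m`, `D = tr P_i` and `V = pairBound k D`, the error is at most `2^k D c₁
/ M + (2V + 4) / M²`. The bound `B - 1` is the positive root of the quadratic equation that sets
this expression, with `2V + 4` replaced by `8^k D c₂ / 4`, equal to `ε²δ`. What remains is the
numerical inequality `8V + 16 ≤ 8^k D c₂`, which holds for `c₂ = C₂` when `k ≥ 4` and for `c₂ = 4C₂`
always. -/

/-! ### Combinatorics of the symmetry sectors -/

/-- The basis states of the sector `a - b = i`. -/
def sectorSet (n m : ℕ) (i : ℤ) : Finset (ABIndex n m) :=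
  Finset.univ.filter fun x => (excitations x.1 : ℤ) - (excitations x.2 : ℤ) = i

theorem mem_sectorSet {n m : ℕ} {i : ℤ} {x : ABIndex n m} :
    x ∈ sectorSet n m i ↔ (excitations x.1 : ℤ) - (excitations x.2 : ℤ) = i := by
  simp [sectorSet]

theorem excitations_eq_card {n : ℕ} (x : Bits n) :
    excitations x = (Finset.univ.filter fun k => x k = 1).card := by
  rw [excitations, Finset.card_filter]
  refine Finset.sum_congr rfl fun k _ => ?_
  generalize x k = b
  fin_cases b <;> simp

theorem excitations_le {n : ℕ} (x : Bits n) : excitations x ≤ n := by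
  rw [excitations_eq_card]
  exact (Finset.card_le_univ _).trans (by simp)

theorem sectorProj_eq_diagonal (n m : ℕ) (i : ℤ) :
    sectorProj n m i = Matrix.diagonal fun x => if x ∈ sectorSet n m i then 1 else 0 := by
  ext x y
  rw [sectorProj, Matrix.sum_apply]
  simp only [kroneckerMap_apply, excitationProj, Matrix.diagonal_apply, mem_sectorSet]
  by_cases hxy : x = y
  · subst hxy
    simp only [if_true, mul_ite, mul_one, mul_zero]
    by_cases hS : (excitations x.1 : ℤ) - (excitations x.2 : ℤ) = i
    · rw [if_pos hS, Finset.sum_eq_single (excitations x.1, excitations x.2)]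
      · simp
      · rintro ⟨a, b⟩ _ hne
        by_cases h2 : excitations x.2 = b
        · have h1 : excitations x.1 ≠ a := fun h1 => hne (by rw [h1, h2])
          simp [h1]
        · simp [h2]
      · intro hn
        refine absurd ?_ hn
        simp [hS, excitations_le]
    · rw [if_neg hS]
      refine Finset.sum_eq_zero ?_
      rintro ⟨a, b⟩ hp
      by_contra hne
      have h12 : excitations x.2 = b ∧ excitations x.1 = a := by
        by_contra h
        apply hne
        by_cases h2 : excitations x.2 = b <;> simp_all
      refine hS ?_
      rw [h12.1, h12.2]
      exact (Finset.mem_filter.1 hp).2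
  · rw [if_neg hxy]
    refine Finset.sum_eq_zero fun p _ => ?_
    by_cases h1 : x.1 = y.1
    · have h2 : x.2 ≠ y.2 := fun h2 => hxy (Prod.ext h1 h2)
      simp [h2]
    · simp [h1]

theorem sectorDim_eq_card (n m : ℕ) (i : ℤ) : sectorDim n m i = (sectorSet n m i).card := by
  rw [sectorDim, sectorProj_eq_diagonal, Matrix.trace_diagonal]
  simp

/-- Flipping all bits of `B` turns the difference `a - b = i` into the sum `a + (m - b) = m + i`, so
the sector corresponds to the subsets of the `n + m` qubits with `m + i` elements. -/
theorem card_sectorSet {n m : ℕ} {i : ℤ} (hi : -(m : ℤ) ≤ i) :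
    (sectorSet n m i).card = (n + m).choose (m + i).toNat := by
  have hcard : (Finset.univ : Finset (Fin n ⊕ Fin m)).card = n + m := by simp
  rw [← hcard, ← Finset.card_powersetCard]
  have hrev : ∀ b : Fin 2, b.rev = 1 ↔ b = 0 := by decide
  have key : ∀ x : ABIndex n m,
      ((Finset.univ.filter fun q : Fin n ⊕ Fin m =>
        Sum.elim x.1 (fun k => (x.2 k).rev) q = 1).card : ℤ)
        = excitations x.1 + (m - excitations x.2) := by
    intro x
    have h2 : excitations x.2 + (Finset.univ.filter fun k => x.2 k = 0).card = m := by
      rw [excitations_eq_card]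
      have h := Finset.card_filter_add_card_filter_not (s := Finset.univ) (fun k => x.2 k = 1)
      rw [Finset.card_univ, Fintype.card_fin] at h
      convert h using 3
      ext k
      simp only [Finset.mem_filter, Finset.mem_univ, true_and]
      generalize x.2 k = b
      fin_cases b <;> simp
    have h3 : (Finset.univ.filter fun q : Fin n ⊕ Fin m =>
        Sum.elim x.1 (fun k => (x.2 k).rev) q = 1).card
        = excitations x.1 + (Finset.univ.filter fun k => x.2 k = 0).card := by
      rw [excitations_eq_card, Finset.card_filter, Finset.card_filter, Finset.card_filter,
        Fintype.sum_sum_type]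
      simp only [Sum.elim_inl, Sum.elim_inr, hrev]
      congr!
    rw [h3]
    push_cast
    omega
  refine Finset.card_nbij' (fun x => Finset.univ.filter fun q : Fin n ⊕ Fin m =>
      Sum.elim x.1 (fun k => (x.2 k).rev) q = 1)
    (fun T => (fun k => if Sum.inl k ∈ T then 1 else 0, fun k => if Sum.inr k ∈ T then 0 else 1))
    ?_ ?_ ?_ ?_
  · intro x hx
    have hx' := mem_sectorSet.1 hx
    have := key x
    refine Finset.mem_coe.2 (Finset.mem_powersetCard.2 ⟨Finset.subset_univ _, ?_⟩)
    simp only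
    omega
  · intro T hT
    have hT' : T.card = (m + i).toNat := (Finset.mem_powersetCard.1 hT).2
    have := key (fun k => if Sum.inl k ∈ T then 1 else 0, fun k => if Sum.inr k ∈ T then 0 else 1)
    have hT2 : (Finset.univ.filter fun q : Fin n ⊕ Fin m =>
        Sum.elim (fun k => if Sum.inl k ∈ T then (1 : Fin 2) else 0)
          (fun k => (if Sum.inr k ∈ T then (0 : Fin 2) else 1).rev) q = 1) = T := by
      ext q
      rcases q with k | k <;> simp [hrev]
    simp only at this
    rw [hT2] at this
    refine Finset.mem_coe.2 (mem_sectorSet.2 ?_)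
    simp only
    omega
  · intro x _
    have h2 : ∀ b : Fin 2, (if b = 1 then (1 : Fin 2) else 0) = b := by decide
    have h3 : ∀ b : Fin 2, (if b = 0 then (0 : Fin 2) else 1) = b := by decide
    ext k
    · simp [h2]
    · simp [hrev, h3]
  · intro T _
    ext q
    rcases q with k | k <;> simp [hrev]

theorem one_le_card_sectorSet {n m : ℕ} {i : ℤ} (hi : -(m : ℤ) ≤ i) (hi' : i ≤ n) :
    1 ≤ (sectorSet n m i).card := by
  rw [card_sectorSet hi]
  exact Nat.choose_pos (by omega)

theorem two_le_card_sectorSet {n m : ℕ} {i : ℤ} (hi : -(m : ℤ) < i) (hi' : i < n) :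
    2 ≤ (sectorSet n m i).card := by
  rw [card_sectorSet hi.le]
  obtain ⟨a, ha⟩ : ∃ a, n + m = a + 1 := ⟨n + m - 1, by omega⟩
  obtain ⟨b, hb⟩ : ∃ b, (m + i).toNat = b + 1 := ⟨(m + i).toNat - 1, by omega⟩
  rw [ha, hb, Nat.choose_succ_succ']
  have h1 : 0 < a.choose b := Nat.choose_pos (by omega)
  have h2 : 0 < a.choose (b + 1) := Nat.choose_pos (by omega)
  omega

theorem three_mul_choose_le_two_pow {k : ℕ} (hk : 6 ≤ k) : ∀ j, 3 * k.choose j ≤ 2 ^ k := by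
  induction k, hk using Nat.le_induction with
  | base =>
    intro j
    by_cases hj : j ≤ 6
    · interval_cases j <;> decide
    · rw [Nat.choose_eq_zero_of_lt (by omega)]; norm_num
  | succ k hk ih =>
    intro j
    rcases j with _ | j
    · have := ih 0
      simp only [Nat.choose_zero_right, pow_succ] at this ⊢
      omega
    · rw [Nat.choose_succ_succ', pow_succ]
      have := ih j
      have := ih (j + 1)
      omega

/-- From `k = 6` on the summand 3 is not needed: Pascal's rule at most doubles the left side at each
step. At `k = 4` the central coefficient 6 gives 18 > 16, which is why the slack is there. This is
the estimate behind `C₂ ≤ 2`. -/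
theorem three_mul_choose_le {k : ℕ} (hk : 4 ≤ k) (j : ℕ) : 3 * k.choose j ≤ 2 ^ k + 3 := by
  by_cases h6 : 6 ≤ k
  · exact (three_mul_choose_le_two_pow h6 j).trans (by omega)
  · by_cases hj : j ≤ 6
    · interval_cases k <;> interval_cases j <;> decide
    · rw [Nat.choose_eq_zero_of_lt (by omega)]; simp

/-! ### Bloch vectors of the measured axes -/

/-- The first row of a single-qubit Clifford rotation. -/
def cliffordRow (U : Cl2) (c : Fin 2) : ℂ :=
  ((U : Matrix.unitaryGroup (Fin 2) ℂ) : Matrix (Fin 2) (Fin 2) ℂ) 0 c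

/-- The `x`-component of three times the Bloch vector of the measured axis. -/
def blochX (U : Cl2) : ℝ := 6 * (star (cliffordRow U 0) * cliffordRow U 1).re

/-- The `y`-component of three times the Bloch vector of the measured axis. -/
def blochY (U : Cl2) : ℝ := -6 * (star (cliffordRow U 0) * cliffordRow U 1).im

/-- The `z`-component of three times the Bloch vector of the measured axis. -/
def blochZ (U : Cl2) : ℝ :=
  3 * (Complex.normSq (cliffordRow U 0) - Complex.normSq (cliffordRow U 1))

theorem normSq_cliffordRow (U : Cl2) :
    Complex.normSq (cliffordRow U 0) + Complex.normSq (cliffordRow U 1) = 1 := by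
  have h := Matrix.mem_unitaryGroup_iff.1 (U : Matrix.unitaryGroup (Fin 2) ℂ).2
  have h0 := congrFun (congrFun h 0) 0
  simp only [Matrix.mul_apply, Fin.sum_univ_two, Matrix.star_apply, Matrix.one_apply_eq,
    Complex.star_def, Complex.mul_conj] at h0
  exact_mod_cast h0

theorem bloch_normSq (U : Cl2) : blochX U ^ 2 + blochY U ^ 2 + blochZ U ^ 2 = 9 := by
  have h := normSq_cliffordRow U
  simp only [Complex.normSq_apply] at h
  simp only [blochX, blochY, blochZ, Complex.normSq_apply, Complex.star_def, Complex.mul_re,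
    Complex.mul_im, Complex.conj_re, Complex.conj_im]
  linear_combination (9 * (((cliffordRow U 0).re * (cliffordRow U 0).re
    + (cliffordRow U 0).im * (cliffordRow U 0).im + ((cliffordRow U 1).re * (cliffordRow U 1).re
    + (cliffordRow U 1).im * (cliffordRow U 1).im)) + 1)) * h

/-- The Hadamard gate as a Clifford element. -/
noncomputable def hadamardCl : Cl2 :=
  ⟨⟨hadamardMat, hadamardMat_mem⟩, Subgroup.subset_closure (by simp)⟩

/-- The phase gate as a Clifford element. -/
noncomputable def phaseCl : Cl2 := ⟨⟨phaseMat, phaseMat_mem⟩, Subgroup.subset_closure (by simp)⟩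

theorem cliffordRow_mul_hadamard (U : Cl2) :
    cliffordRow (U * hadamardCl) 0
        = ((Real.sqrt 2 : ℝ) : ℂ)⁻¹ * (cliffordRow U 0 + cliffordRow U 1) ∧
      cliffordRow (U * hadamardCl) 1
        = ((Real.sqrt 2 : ℝ) : ℂ)⁻¹ * (cliffordRow U 0 - cliffordRow U 1) := by
  constructor <;>
    simp [cliffordRow, hadamardCl, hadamardMat, Matrix.mul_apply, Fin.sum_univ_two] <;> ring

theorem cliffordRow_mul_phase (U : Cl2) :
    cliffordRow (U * phaseCl) 0 = cliffordRow U 0 ∧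
      cliffordRow (U * phaseCl) 1 = Complex.I * cliffordRow U 1 := by
  constructor <;>
    simp [cliffordRow, phaseCl, phaseMat, Matrix.mul_apply, Fin.sum_univ_two, mul_comm]

theorem bloch_mul_hadamard (U : Cl2) :
    blochX (U * hadamardCl) = blochZ U ∧ blochY (U * hadamardCl) = -blochY U ∧
      blochZ (U * hadamardCl) = blochX U := by
  obtain ⟨h0, h1⟩ := cliffordRow_mul_hadamard U
  have hs : (Real.sqrt 2)⁻¹ * (Real.sqrt 2)⁻¹ = 1 / 2 := by
    rw [← mul_inv, Real.mul_self_sqrt (by norm_num)]; norm_num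
  simp only [blochX, blochY, blochZ, h0, h1, ← Complex.ofReal_inv, Complex.normSq_apply,
    Complex.star_def, Complex.mul_re, Complex.mul_im, Complex.conj_re, Complex.conj_im,
    Complex.add_re, Complex.add_im, Complex.sub_re, Complex.sub_im, Complex.ofReal_re,
    Complex.ofReal_im]
  generalize (Real.sqrt 2)⁻¹ = s at *
  generalize (cliffordRow U 0).re = a
  generalize (cliffordRow U 0).im = b
  generalize (cliffordRow U 1).re = c
  generalize (cliffordRow U 1).im = d
  refine ⟨?_, ?_, ?_⟩
  · linear_combination (6 * (a ^ 2 + b ^ 2 - c ^ 2 - d ^ 2)) * hs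
  · linear_combination (12 * (a * d - b * c)) * hs
  · linear_combination (12 * (a * c + b * d)) * hs

theorem bloch_mul_phase (U : Cl2) :
    blochX (U * phaseCl) = blochY U ∧ blochY (U * phaseCl) = -blochX U ∧
      blochZ (U * phaseCl) = blochZ U := by
  obtain ⟨h0, h1⟩ := cliffordRow_mul_phase U
  simp only [blochX, blochY, blochZ, h0, h1, Complex.normSq_apply,
    Complex.star_def, Complex.mul_re, Complex.mul_im, Complex.conj_re, Complex.conj_im,
    Complex.I_re, Complex.I_im]
  refine ⟨by ring, by ring, by ring⟩

/-- The measured axis is one of the three coordinate axes. -/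
def AxisAligned (U : Cl2) : Prop :=
  blochX U * blochY U = 0 ∧ blochY U * blochZ U = 0 ∧ blochZ U * blochX U = 0

theorem axisAligned_mul_hadamard (V : Cl2) : AxisAligned (V * hadamardCl) ↔ AxisAligned V := by
  obtain ⟨e1, e2, e3⟩ := bloch_mul_hadamard V
  unfold AxisAligned
  rw [e1, e2, e3]
  constructor
  · rintro ⟨h1, h2, h3⟩
    refine ⟨by linear_combination -h2, by linear_combination -h1, by linear_combination h3⟩
  · rintro ⟨h1, h2, h3⟩
    refine ⟨by linear_combination -h2, by linear_combination -h1, by linear_combination h3⟩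

theorem axisAligned_mul_phase (V : Cl2) : AxisAligned (V * phaseCl) ↔ AxisAligned V := by
  obtain ⟨e1, e2, e3⟩ := bloch_mul_phase V
  unfold AxisAligned
  rw [e1, e2, e3]
  constructor
  · rintro ⟨h1, h2, h3⟩
    refine ⟨by linear_combination -h1, by linear_combination h3, by linear_combination -h2⟩
  · rintro ⟨h1, h2, h3⟩
    refine ⟨by linear_combination -h1, by linear_combination -h3, by linear_combination h2⟩

/-- The identity measures along `z`, and right multiplication by either generator permutes the
coordinate axes up to sign. -/
theorem axisAligned (U : Cl2) : AxisAligned U := by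
  obtain ⟨g, hg⟩ := U
  induction hg using Subgroup.closure_induction_right with
  | one => simp [AxisAligned, blochX, blochY, cliffordRow]
  | mul_right x hx y hy ih =>
    rcases hy with rfl | rfl
    · exact (axisAligned_mul_hadamard ⟨x, hx⟩).2 ih
    · exact (axisAligned_mul_phase ⟨x, hx⟩).2 ih
  | mul_inv_cancel x hx y hy ih =>
    -- For an inverse generator, the equivalence for the generator itself is applied to the element
    -- `V` with `V * c = x`.
    have key : ∀ (c : Cl2) (V : Cl2), (V : Matrix.unitaryGroup (Fin 2) ℂ) = 
        x * (c : Matrix.unitaryGroup (Fin 2) ℂ)⁻¹ →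
        V * c = ⟨x, hx⟩ := by
      intro c V hV
      apply Subtype.ext
      rw [Subgroup.coe_mul, hV]
      exact inv_mul_cancel_right x _
    rcases hy with rfl | rfl
    · rw [← axisAligned_mul_hadamard, key hadamardCl _ rfl]
      exact ih
    · rw [← axisAligned_mul_phase, key phaseCl _ rfl]
      exact ih

/-- Right multiplication by the two generators carries the `x` component to the `z` and `y`
components, so the three second moments agree. They add up to 9 for each group element. -/
theorem sum_blochX_sq : ∑ U : Cl2, blochX U ^ 2 = 3 * Fintype.card Cl2 := by
  have hxz : ∑ U : Cl2, blochX U ^ 2 = ∑ U : Cl2, blochZ U ^ 2 := by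
    rw [← Equiv.sum_comp (Equiv.mulRight hadamardCl) fun U => blochX U ^ 2]
    exact Finset.sum_congr rfl fun U _ => by
      rw [Equiv.coe_mulRight, (bloch_mul_hadamard U).1]
  have hxy : ∑ U : Cl2, blochX U ^ 2 = ∑ U : Cl2, blochY U ^ 2 := by
    rw [← Equiv.sum_comp (Equiv.mulRight phaseCl) fun U => blochX U ^ 2]
    exact Finset.sum_congr rfl fun U _ => by
      rw [Equiv.coe_mulRight, (bloch_mul_phase U).1]
  have h : ∑ U : Cl2, (blochX U ^ 2 + blochY U ^ 2 + blochZ U ^ 2) = 9 * Fintype.card Cl2 := by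
    rw [Finset.sum_congr rfl fun U _ => bloch_normSq U]
    simp [mul_comm]
  rw [Finset.sum_add_distrib, Finset.sum_add_distrib, ← hxz, ← hxy] at h
  linarith

theorem sum_blochY_sq : ∑ U : Cl2, blochY U ^ 2 = 3 * Fintype.card Cl2 := by
  rw [← sum_blochX_sq, ← Equiv.sum_comp (Equiv.mulRight phaseCl) fun U => blochX U ^ 2]
  exact Finset.sum_congr rfl fun U _ => by rw [Equiv.coe_mulRight, (bloch_mul_phase U).1]

theorem sum_blochZ_sq : ∑ U : Cl2, blochZ U ^ 2 = 3 * Fintype.card Cl2 := by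
  rw [← sum_blochX_sq, ← Equiv.sum_comp (Equiv.mulRight hadamardCl) fun U => blochX U ^ 2]
  exact Finset.sum_congr rfl fun U _ => by rw [Equiv.coe_mulRight, (bloch_mul_hadamard U).1]

/-! ### Single-qubit snapshots and the inversion of the measurement channel -/

/-- The sign of a measurement outcome. -/
def outcomeSign (b : Fin 2) : ℝ := if b = 0 then 1 else -1

theorem abs_outcomeSign (b : Fin 2) : |outcomeSign b| = 1 := by
  unfold outcomeSign; split_ifs <;> norm_num

/-- The projector `U† |b⟩⟨b| U` onto the state singled out by a single-qubit outcome. -/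
def outcomeProj (U : Cl2) (b : Fin 2) : Matrix (Fin 2) (Fin 2) ℂ :=
  (((U : Matrix.unitaryGroup (Fin 2) ℂ) : Matrix (Fin 2) (Fin 2) ℂ))ᴴ * Matrix.single b b 1 *
    ((U : Matrix.unitaryGroup (Fin 2) ℂ) : Matrix (Fin 2) (Fin 2) ℂ)

theorem outcomeProj_apply (U : Cl2) (b c d : Fin 2) :
    outcomeProj U b c d =
      star (((U : Matrix.unitaryGroup (Fin 2) ℂ) : Matrix (Fin 2) (Fin 2) ℂ) b c) *
        ((U : Matrix.unitaryGroup (Fin 2) ℂ) : Matrix (Fin 2) (Fin 2) ℂ) b d := by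
  fin_cases b <;> simp [outcomeProj, Matrix.mul_apply, Fin.sum_univ_two, Matrix.single_apply]

theorem outcomeProj_eq (U : Cl2) (b : Fin 2) :
    outcomeProj U b = (1 / 2 : ℂ) • 1 + ((outcomeSign b / 6 : ℝ) : ℂ) •
      !![(blochZ U : ℂ), blochX U - blochY U * Complex.I;
        blochX U + blochY U * Complex.I, -blochZ U] := by
  have h0 : outcomeProj U 0 = (1 / 2 : ℂ) • 1 + ((1 / 6 : ℝ) : ℂ) •
      !![(blochZ U : ℂ), blochX U - blochY U * Complex.I;
        blochX U + blochY U * Complex.I, -blochZ U] := by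
    have h := normSq_cliffordRow U
    simp only [Complex.normSq_apply] at h
    ext c d
    rw [outcomeProj_apply]
    change star (cliffordRow U c) * cliffordRow U d = _
    fin_cases c <;> fin_cases d <;> apply Complex.ext <;>
      simp [blochX, blochY, blochZ, Complex.normSq_apply] <;> linarith
  have hsum : outcomeProj U 0 + outcomeProj U 1 = 1 := by
    have h := Matrix.mem_unitaryGroup_iff'.1 (U : Matrix.unitaryGroup (Fin 2) ℂ).2
    rw [← h]
    ext c d
    simp [outcomeProj_apply, Matrix.mul_apply, Fin.sum_univ_two, Matrix.star_apply]
  fin_cases b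
  · rw [show outcomeSign ((fun i => i) ⟨0, Nat.zero_lt_two⟩ : Fin 2) = 1 by simp [outcomeSign]]
    exact h0
  · have h1 : outcomeProj U 1 = 1 - outcomeProj U 0 := by rw [← hsum]; abel
    change outcomeProj U 1 = _
    rw [h1, h0]
    ext c d
    fin_cases c <;> fin_cases d <;> simp [outcomeSign] <;> ring

/-- The single-qubit snapshot `3 U† |b⟩⟨b| U - 1`. -/
def localSnapshot (U : Cl2) (b : Fin 2) : Matrix (Fin 2) (Fin 2) ℂ :=
  (3 : ℂ) • outcomeProj U b - 1

theorem localSnapshot_eq (U : Cl2) (b : Fin 2) :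
    localSnapshot U b = (1 / 2 : ℂ) • (1 + (outcomeSign b : ℂ) •
      !![(blochZ U : ℂ), blochX U - blochY U * Complex.I;
        blochX U + blochY U * Complex.I, -blochZ U]) := by
  rw [localSnapshot, outcomeProj_eq]
  ext c d
  fin_cases c <;> fin_cases d <;> simp <;> ring

theorem Shot.snapshot_eq {n m : ℕ} (s : Shot n m) :
    s.snapshot = tensorOp fun q => localSnapshot (s.setting q) (bitAt s.outcome q) := rfl

/-- The `x`, `y` and `z` Pauli matrices. -/
def pauliMat : Fin 3 → Matrix (Fin 2) (Fin 2) ℂ :=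
  ![!![0, 1; 1, 0], !![0, -Complex.I; Complex.I, 0], !![1, 0; 0, -1]]

theorem pauliMat_combination (x y z : ℂ) :
    !![z, x - y * Complex.I; x + y * Complex.I, -z]
      = x • pauliMat 0 + y • pauliMat 1 + z • pauliMat 2 := by
  ext c d
  fin_cases c <;> fin_cases d <;> simp [pauliMat]; ring

/-- This is the local form of unbiasedness. Summing over outcomes kills the terms of odd order in
the sign, and axis alignment kills the mixed products of components. The second moments 3 then leave
half the sum of `P ⊗ P` over the identity and the Pauli matrices, which is the swap. -/
theorem sum_outcomeProj_mul_localSnapshot (y y' c d : Fin 2) :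
    ∑ U : Cl2, ∑ b, outcomeProj U b y' y * localSnapshot U b c d
      = if y = c ∧ y' = d then (Fintype.card Cl2 : ℂ) else 0 := by
  have hx : ∑ U : Cl2, (blochX U : ℂ) ^ 2 = 3 * Fintype.card Cl2 := by
    exact_mod_cast sum_blochX_sq
  have hy : ∑ U : Cl2, (blochY U : ℂ) ^ 2 = 3 * Fintype.card Cl2 := by
    exact_mod_cast sum_blochY_sq
  have hz : ∑ U : Cl2, (blochZ U : ℂ) ^ 2 = 3 * Fintype.card Cl2 := by
    exact_mod_cast sum_blochZ_sq
  have key : ∀ U : Cl2, ∑ b, outcomeProj U b y' y * localSnapshot U b c d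
      = 1 / 2 * ((1 : Matrix (Fin 2) (Fin 2) ℂ) y' y * (1 : Matrix (Fin 2) (Fin 2) ℂ) c d)
        + pauliMat 0 y' y * pauliMat 0 c d / 6 * (blochX U : ℂ) ^ 2
        + pauliMat 1 y' y * pauliMat 1 c d / 6 * (blochY U : ℂ) ^ 2
        + pauliMat 2 y' y * pauliMat 2 c d / 6 * (blochZ U : ℂ) ^ 2 := by
    intro U
    obtain ⟨h1, h2, h3⟩ := axisAligned U
    replace h1 : (blochX U : ℂ) * blochY U = 0 := by exact_mod_cast h1
    replace h2 : (blochY U : ℂ) * blochZ U = 0 := by exact_mod_cast h2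
    replace h3 : (blochZ U : ℂ) * blochX U = 0 := by exact_mod_cast h3
    simp only [outcomeProj_eq, localSnapshot_eq, pauliMat_combination, Matrix.add_apply,
      Matrix.smul_apply, smul_eq_mul, Fin.sum_univ_two]
    rw [show outcomeSign 0 = 1 from rfl, show outcomeSign 1 = -1 by simp [outcomeSign]]
    push_cast
    linear_combination
      ((pauliMat 0 y' y * pauliMat 1 c d + pauliMat 1 y' y * pauliMat 0 c d) / 6) * h1
      + ((pauliMat 1 y' y * pauliMat 2 c d + pauliMat 2 y' y * pauliMat 1 c d) / 6) * h2
      + ((pauliMat 2 y' y * pauliMat 0 c d + pauliMat 0 y' y * pauliMat 2 c d) / 6) * h3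
  rw [Finset.sum_congr rfl fun U _ => key U]
  simp only [Finset.sum_add_distrib, ← Finset.mul_sum, hx, hy, hz, Finset.sum_const,
    Finset.card_univ, nsmul_eq_mul]
  fin_cases y <;> fin_cases y' <;> fin_cases c <;> fin_cases d <;> simp [pauliMat] <;> ring

/-! ### Weighted Cauchy–Schwarz inequality for product features -/

section WeightedCauchySchwarz

variable {ι G J : Type*} [Fintype ι] [DecidableEq ι] [Fintype G] [Fintype J]

theorem prod_sum_eq_sum_prod {R : Type*} [CommSemiring R] (f : ι → J → R) :
    ∏ q, ∑ j, f q j = ∑ p : ι → J, ∏ q, f q (p q) := by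
  rw [Finset.prod_univ_sum, Fintype.piFinset_univ]

/-- Weighted Cauchy–Schwarz inequality for sums over product features, averaged over the settings:
the feature `j` takes the values `0` and `±√(M j)`, its weight is `w j`, and `C j` is the resulting
coefficient. -/
theorem sum_sq_sum_prod_le (φ : J → G → ℝ) (M w C : J → ℝ) (hM : ∀ j, 0 < M j) (hw : ∀ j, 0 < w j)
    (hφ : ∀ j g, φ j g ^ 4 = M j * φ j g ^ 2)
    (hC : ∀ j, ∑ g, (∑ l, w l * φ l g ^ 2 / M l) * (φ j g ^ 2 / w j) = Fintype.card G * C j)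
    (a : (ι → J) → ℝ) :
    ∑ g : ι → G, (∑ p, a p * ∏ q, |φ (p q) (g q)|) ^ 2
      ≤ Fintype.card (ι → G) * ∑ p, a p ^ 2 * ∏ q, C (p q) := by
  have hpt : ∀ g : ι → G, (∑ p, a p * ∏ q, |φ (p q) (g q)|) ^ 2
      ≤ ∑ p : ι → J, a p ^ 2 *
        ∏ q, ((∑ l, w l * φ l (g q) ^ 2 / M l) * (φ (p q) (g q) ^ 2 / w (p q))) := by
    intro g
    -- The two factors are the products of `w φ² / M` and `a²` times the products of `φ² / w`. Their
    -- product is exactly the square of the summand because `φ⁴ = M φ²`.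
    have h := Finset.sum_sq_le_sum_mul_sum_of_sq_le_mul (Finset.univ : Finset (ι → J))
      (r := fun p => a p * ∏ q, |φ (p q) (g q)|)
      (f := fun p => ∏ q, (w (p q) * φ (p q) (g q) ^ 2 / M (p q)))
      (g := fun p => a p ^ 2 * ∏ q, (φ (p q) (g q) ^ 2 / w (p q)))
      (fun p _ => Finset.prod_nonneg fun q _ =>
        div_nonneg (mul_nonneg (hw _).le (sq_nonneg _)) (hM _).le)
      (fun p _ => mul_nonneg (sq_nonneg _) (Finset.prod_nonneg fun q _ =>
        div_nonneg (sq_nonneg _) (hw _).le))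
      (fun p _ => le_of_eq <| by
        rw [mul_pow, ← Finset.prod_pow, mul_left_comm, ← Finset.prod_mul_distrib]
        congr 1
        refine Finset.prod_congr rfl fun q _ => ?_
        have h1 := (hM (p q)).ne'
        have h2 := (hw (p q)).ne'
        have h3 := hφ (p q) (g q)
        rw [sq_abs]
        field_simp
        linear_combination -h3)
    refine h.trans_eq ?_
    rw [← prod_sum_eq_sum_prod fun q l => w l * φ l (g q) ^ 2 / M l, Finset.mul_sum]
    refine Finset.sum_congr rfl fun p _ => ?_
    rw [Finset.prod_mul_distrib]
    ring
  refine (Finset.sum_le_sum fun g _ => hpt g).trans_eq ?_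
  rw [Finset.sum_comm, Finset.mul_sum]
  refine Finset.sum_congr rfl fun p _ => ?_
  -- Distinct qubits have independent settings, so the sum over all settings is a product of local
  -- sums, each given by `hC`.
  rw [← Finset.mul_sum, ← prod_sum_eq_sum_prod fun q g' =>
    (∑ l, w l * φ l g' ^ 2 / M l) * (φ (p q) g' ^ 2 / w (p q)),
    Finset.prod_congr rfl fun q _ => hC (p q), Finset.prod_mul_distrib, Finset.prod_const,
    Fintype.card_fun, Finset.card_univ]
  push_cast
  ring

/-- The squared weighted norm of a combination of product vectors, through their local Gram
matrices. -/
theorem sum_normSq_sum_prod {I : Type*} [Fintype I] (c : I → ℂ) (v : I → ι → J → ℂ) (C : J → ℝ) :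
    ((∑ p : ι → J, ‖∑ t, c t * ∏ q, v t q (p q)‖ ^ 2 * ∏ q, C (p q) : ℝ) : ℂ)
      = ∑ t, ∑ t', c t * star (c t') * ∏ q, ∑ j, C j * (v t q j * star (v t' q j)) := by
  push_cast
  simp only [prod_sum_eq_sum_prod]
  simp only [Finset.mul_sum]
  rw [Finset.sum_congr rfl fun t _ => Finset.sum_comm, Finset.sum_comm]
  refine Finset.sum_congr rfl fun p _ => ?_
  rw [← Complex.mul_conj', map_sum, Finset.sum_mul_sum, Finset.sum_mul]
  refine Finset.sum_congr rfl fun t _ => ?_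
  rw [Finset.sum_mul]
  refine Finset.sum_congr rfl fun t' _ => ?_
  simp only [map_mul, map_prod, Finset.prod_mul_distrib, Complex.star_def]
  ring

/-- A combination of products of local functions is bounded by its feature expansion. -/
theorem norm_sum_prod_le {I : Type*} [Fintype I] (c : I → ℂ) (v : I → ι → J → ℂ)
    (ψ : J → ι → ℂ) :
    ‖∑ t, c t * ∏ q, ∑ j, v t q j * ψ j q‖
      ≤ ∑ p : ι → J, ‖∑ t, c t * ∏ q, v t q (p q)‖ * ∏ q, ‖ψ (p q) q‖ := by
  have h : ∑ t, c t * ∏ q, ∑ j, v t q j * ψ j q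
      = ∑ p : ι → J, (∑ t, c t * ∏ q, v t q (p q)) * ∏ q, ψ (p q) q := by
    simp only [prod_sum_eq_sum_prod, Finset.mul_sum, Finset.sum_mul]
    rw [Finset.sum_comm]
    refine Finset.sum_congr rfl fun p _ => Finset.sum_congr rfl fun t _ => ?_
    rw [Finset.prod_mul_distrib]
    ring
  rw [h]
  refine (norm_sum_le _ _).trans_eq (Finset.sum_congr rfl fun p _ => ?_)
  rw [norm_mul, norm_prod]

end WeightedCauchySchwarz

/-! ### Second moments of linear and quadratic statistics of independent variables -/

section IndependentSums

variable {Ω : Type*} [Fintype Ω]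

theorem sum_prod_fin_succ {R : Type*} [CommSemiring R] {N : ℕ} (p : Fin (N + 1) → Ω → R)
    (F : (Fin (N + 1) → Ω) → R) :
    ∑ s, (∏ k, p k (s k)) * F s
      = ∑ s : Fin N → Ω, (∏ k, p k.succ (s k)) * ∑ x, p 0 x * F (Fin.cons x s) := by
  rw [← (Fin.consEquiv fun _ : Fin (N + 1) => Ω).sum_comp, Fintype.sum_prod_type_right]
  refine Finset.sum_congr rfl fun s _ => ?_
  rw [Finset.mul_sum]
  refine Finset.sum_congr rfl fun x _ => ?_
  change (∏ k, p k ((Fin.cons x s : Fin (N + 1) → Ω) k)) * F (Fin.cons x s) = _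
  simp only [Fin.prod_univ_succ, Fin.cons_zero, Fin.cons_succ]
  ring

theorem sum_prod_eq_one {N : ℕ} (p : Fin N → Ω → ℝ) (hp : ∀ k, ∑ x, p k x = 1) :
    ∑ s : Fin N → Ω, ∏ k, p k (s k) = 1 := by
  rw [← prod_sum_eq_sum_prod]
  simp [hp]

theorem sum_mul_normSq_add (p : Ω → ℝ) (hp : ∑ x, p x = 1) (c : ℂ) (t : Ω → ℂ)
    (ht : ∑ x, (p x : ℂ) * t x = 0) :
    ∑ x, p x * ‖c + t x‖ ^ 2 = ‖c‖ ^ 2 + ∑ x, p x * ‖t x‖ ^ 2 := by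
  have h : ∀ x, p x * ‖c + t x‖ ^ 2
      = p x * ‖c‖ ^ 2 + p x * ‖t x‖ ^ 2 + 2 * (star c * (p x * t x)).re := by
    intro x
    simp only [← Complex.normSq_eq_norm_sq, Complex.normSq_apply, Complex.add_re, Complex.add_im,
      Complex.mul_re, Complex.mul_im, Complex.star_def, Complex.conj_re, Complex.conj_im,
      Complex.ofReal_re, Complex.ofReal_im]
    ring
  rw [Finset.sum_congr rfl fun x _ => h x, Finset.sum_add_distrib, Finset.sum_add_distrib,
    ← Finset.sum_mul, hp, ← Finset.mul_sum, ← Complex.re_sum, ← Finset.mul_sum, ht]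
  simp

theorem sum_mul_normSq_le_of_centered (p : Ω → ℝ) (hp : ∑ x, p x = 1) (t : Ω → ℂ) :
    ∑ x, p x * ‖t x - ∑ y, (p y : ℂ) * t y‖ ^ 2 ≤ ∑ x, p x * ‖t x‖ ^ 2 := by
  have hp' : ∑ x, (p x : ℂ) = 1 := by exact_mod_cast hp
  have h := sum_mul_normSq_add p hp (∑ y, (p y : ℂ) * t y)
    (fun x => t x - ∑ y, (p y : ℂ) * t y) (by
      simp only [mul_sub, Finset.sum_sub_distrib, ← Finset.sum_mul, hp', one_mul, sub_self])
  simp only [add_sub_cancel] at h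
  rw [h]
  have := sq_nonneg ‖∑ y, (p y : ℂ) * t y‖
  linarith

theorem sum_normSq_independent {N : ℕ} (p : Fin N → Ω → ℝ) (hp : ∀ k, ∑ x, p k x = 1) (c : ℂ)
    (t : Fin N → Ω → ℂ) (ht : ∀ k, ∑ x, (p k x : ℂ) * t k x = 0) :
    ∑ s : Fin N → Ω, (∏ k, p k (s k)) * ‖c + ∑ k, t k (s k)‖ ^ 2
      = ‖c‖ ^ 2 + ∑ k, ∑ x, p k x * ‖t k x‖ ^ 2 := by
  induction N with
  | zero => simp
  | succ N ih =>
    have hstep : ∀ s : Fin N → Ω,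
        ∑ x, p 0 x * ‖c + ∑ k, t k ((Fin.cons x s : Fin (N + 1) → Ω) k)‖ ^ 2
          = ‖c + ∑ k, t k.succ (s k)‖ ^ 2 + ∑ x, p 0 x * ‖t 0 x‖ ^ 2 := by
      intro s
      rw [← sum_mul_normSq_add (p 0) (hp 0) _ (t 0) (ht 0)]
      refine Finset.sum_congr rfl fun x _ => ?_
      simp only [Fin.sum_univ_succ, Fin.cons_zero, Fin.cons_succ]
      congr 3
      ring
    rw [sum_prod_fin_succ, Finset.sum_congr rfl fun s _ => by rw [hstep s]]
    simp only [mul_add, Finset.sum_add_distrib, ← Finset.sum_mul]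
    rw [ih _ (fun k => hp k.succ) _ fun k => ht k.succ,
      sum_prod_eq_one _ fun k => hp k.succ, Fin.sum_univ_succ]
    ring

/-- The second moment of a degenerate quadratic statistic of independent variables. -/
theorem sum_normSq_quadratic {N : ℕ} (p : Fin N → Ω → ℝ) (hp : ∀ k, ∑ x, p k x = 1) (c : ℂ)
    (t : Fin N → Ω → ℂ) (ht : ∀ k, ∑ x, (p k x : ℂ) * t k x = 0)
    (h : Fin N → Fin N → Ω → Ω → ℂ) (hdiag : ∀ k x y, h k k x y = 0)
    (hsymm : ∀ j k x y, h j k x y = h k j y x)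
    (hh : ∀ j k y, ∑ x, (p j x : ℂ) * h j k x y = 0) :
    ∑ s : Fin N → Ω, (∏ k, p k (s k)) *
        ‖c + ∑ k, t k (s k) + ∑ j, ∑ k, h j k (s j) (s k)‖ ^ 2
      = ‖c‖ ^ 2 + ∑ k, ∑ x, p k x * ‖t k x‖ ^ 2
        + 2 * ∑ j, ∑ k, ∑ x, ∑ y, p j x * (p k y * ‖h j k x y‖ ^ 2) := by
  induction N with
  | zero => simp
  | succ N ih =>
    -- Split off the first variable. By symmetry each pair containing it occurs twice, whence the
    -- factor 2, and all terms that depend on it are centered in it. Hence they are orthogonal to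
    -- the rest.
    have hstep : ∀ s : Fin N → Ω,
        ∑ x, p 0 x * ‖c + ∑ k, t k ((Fin.cons x s : Fin (N + 1) → Ω) k)
            + ∑ j, ∑ k, h j k ((Fin.cons x s : Fin (N + 1) → Ω) j)
              ((Fin.cons x s : Fin (N + 1) → Ω) k)‖ ^ 2
          = ‖c + ∑ k, t k.succ (s k) + ∑ j : Fin N, ∑ k : Fin N, h j.succ k.succ (s j) (s k)‖ ^ 2
            + ∑ x, p 0 x * ‖t 0 x + ∑ k : Fin N, 2 * h 0 k.succ x (s k)‖ ^ 2 := by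
      intro s
      rw [← sum_mul_normSq_add (p 0) (hp 0) _
        (fun x => t 0 x + ∑ k : Fin N, 2 * h 0 k.succ x (s k))]
      · refine Finset.sum_congr rfl fun x _ => ?_
        simp only [Fin.sum_univ_succ, Fin.cons_zero, Fin.cons_succ, hdiag, Finset.sum_add_distrib,
          ← Finset.mul_sum]
        rw [Finset.sum_congr rfl fun k _ => hsymm (Fin.succ k) 0 (s k) x]
        congr 3
        ring
      · simp only [mul_add, Finset.sum_add_distrib, ht, zero_add, Finset.mul_sum]
        rw [Finset.sum_comm]
        refine Finset.sum_eq_zero fun k _ => ?_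
        have := hh 0 k.succ (s k)
        simp only [mul_left_comm _ (2 : ℂ), ← Finset.mul_sum, this, mul_zero]
    rw [sum_prod_fin_succ, Finset.sum_congr rfl fun s _ => by rw [hstep s]]
    simp only [mul_add, Finset.sum_add_distrib]
    rw [ih _ (fun k => hp k.succ) _ (fun k => ht k.succ) (fun j k => h j.succ k.succ)
      (fun k => hdiag k.succ) (fun j k => hsymm j.succ k.succ) fun j k => hh j.succ k.succ]
    -- For fixed `x` the remaining expression is a constant plus independent centered terms. The
    -- factor 4 is the square of the 2 above, so each ordered pair contributes 2.
    have hcross : ∑ s : Fin N → Ω, (∏ k, p k.succ (s k)) *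
          ∑ x, p 0 x * ‖t 0 x + ∑ k : Fin N, 2 * h 0 k.succ x (s k)‖ ^ 2
        = ∑ x, p 0 x * ‖t 0 x‖ ^ 2
          + 4 * ∑ k : Fin N, ∑ x, ∑ y, p 0 x * (p k.succ y * ‖h 0 k.succ x y‖ ^ 2) := by
      simp only [Finset.mul_sum]
      rw [Finset.sum_comm]
      have hx : ∀ x, ∑ s : Fin N → Ω, (∏ k, p k.succ (s k)) *
          (p 0 x * ‖t 0 x + ∑ k : Fin N, 2 * h 0 k.succ x (s k)‖ ^ 2)
          = p 0 x * ‖t 0 x‖ ^ 2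
            + ∑ k : Fin N, ∑ y, 4 * (p 0 x * (p k.succ y * ‖h 0 k.succ x y‖ ^ 2)) := by
        intro x
        have h0 := sum_normSq_independent (fun k : Fin N => p k.succ) (fun k => hp k.succ) (t 0 x)
          (fun k y => 2 * h 0 k.succ x y) (by
            intro k
            have h0 := hh k.succ 0 x
            simp only [hsymm k.succ 0] at h0
            simp only [mul_left_comm _ (2 : ℂ), ← Finset.mul_sum, h0, mul_zero])
        simp only [mul_left_comm _ (p 0 x), ← Finset.mul_sum] at h0 ⊢
        rw [h0, mul_add]
        congr 2
        rw [Finset.mul_sum]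
        refine Finset.sum_congr rfl fun k _ => ?_
        rw [Finset.mul_sum]
        refine Finset.sum_congr rfl fun y _ => ?_
        rw [norm_mul, mul_pow]
        norm_num
        ring
      rw [Finset.sum_congr rfl fun x _ => hx x, Finset.sum_add_distrib, Finset.sum_comm]
    rw [hcross]
    have hsymm' : ∀ k : Fin N, ∑ x, ∑ y, p k.succ x * (p 0 y * ‖h k.succ 0 x y‖ ^ 2)
        = ∑ x, ∑ y, p 0 x * (p k.succ y * ‖h 0 k.succ x y‖ ^ 2) := by
      intro k
      rw [Finset.sum_comm]
      refine Finset.sum_congr rfl fun x _ => Finset.sum_congr rfl fun y _ => ?_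
      rw [hsymm k.succ 0]
      ring
    simp only [Fin.sum_univ_succ (n := N), Finset.sum_add_distrib, hsymm', hdiag]
    simp
    ring

end IndependentSums

/-! ### Law of a shot and unbiasedness of the snapshot -/

section Shots

variable {n m : ℕ}

/-- A shot consists of a setting and an outcome. -/
def shotEquiv (n m : ℕ) : Setting n m × ABIndex n m ≃ Shot n m where
  toFun p := ⟨p.1, p.2⟩
  invFun s := (s.setting, s.outcome)
  left_inv _ := rfl
  right_inv _ := rfl

noncomputable instance : Fintype (Shot n m) := Fintype.ofEquiv _ (shotEquiv n m)

instance : DiscreteMeasurableSpace (Shot n m) := ⟨fun _ => trivial⟩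

theorem sum_shot {R : Type*} [AddCommMonoid R] (F : Shot n m → R) :
    ∑ s, F s = ∑ U, ∑ x, F ⟨U, x⟩ := by
  rw [← (shotEquiv n m).sum_comp, Fintype.sum_prod_type]
  rfl

theorem sum_bits {R : Type*} [AddCommMonoid R] (F : (Qubit n m → Fin 2) → R) :
    ∑ x : ABIndex n m, F (bitAt x) = ∑ f, F f :=
  Fintype.sum_equiv (Equiv.sumArrowEquivProdArrow (Fin n) (Fin m) (Fin 2)).symm _ _ fun _ => rfl

theorem bitAt_injective : Function.Injective (bitAt : ABIndex n m → Qubit n m → Fin 2) :=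
  (Equiv.sumArrowEquivProdArrow (Fin n) (Fin m) (Fin 2)).symm.injective

/-- The probability of a shot. -/
noncomputable def shotProb (ρ : QState n m) (s : Shot n m) : ℝ :=
  (Fintype.card (Setting n m) : ℝ)⁻¹ * bornProb ρ s.setting s.outcome

theorem shotProb_nonneg (ρ : QState n m) (s : Shot n m) : 0 ≤ shotProb ρ s :=
  mul_nonneg (by positivity) (bornProb_nonneg _ _ _)

theorem sum_shotProb (ρ : QState n m) : ∑ s, shotProb ρ s = 1 := by
  have : (Fintype.card (Setting n m) : ℝ) ≠ 0 := by exact_mod_cast Fintype.card_ne_zero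
  simp only [sum_shot, shotProb, ← Finset.mul_sum, bornProb_sum]
  rw [Finset.sum_const, Finset.card_univ, nsmul_eq_mul, mul_one, inv_mul_cancel₀ this]

theorem shotPMF_apply (ρ : QState n m) (s : Shot n m) :
    shotPMF ρ s = ENNReal.ofReal (shotProb ρ s) := by
  obtain ⟨U, x⟩ := s
  have hmap : ∀ V : Setting n m, ((outcomePMF ρ V).map fun y => (⟨V, y⟩ : Shot n m)) ⟨U, x⟩
      = if V = U then ENNReal.ofReal (bornProb ρ U x) else 0 := by
    intro V
    rw [PMF.map_apply]
    split_ifs with h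
    · subst h
      rw [tsum_eq_single x]
      · simp [outcomePMF]
      · intro y hy
        rw [if_neg]
        simpa using fun h => hy h.symm
    · rw [ENNReal.tsum_eq_zero]
      intro y
      rw [if_neg]
      intro h'
      exact h (congrArg Shot.setting h').symm
  rw [shotPMF, PMF.bind_apply, tsum_eq_single U]
  · rw [hmap, if_pos rfl, PMF.uniformOfFintype_apply, shotProb, ENNReal.ofReal_mul (by positivity),
      ENNReal.ofReal_inv_of_pos (by exact_mod_cast Fintype.card_pos), ENNReal.ofReal_natCast]
  · intro V hV
    rw [hmap, if_neg hV, mul_zero]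

/-- Once the bound no longer sees the outcome, the Born probabilities sum to one and only the
uniform average over settings remains. This is where the dependence on the state disappears. -/
theorem sum_shotProb_mul_le (ρ : QState n m) (g : Shot n m → ℝ) (F : Setting n m → ℝ)
    (hg : ∀ s, g s ≤ F s.setting) :
    ∑ s, shotProb ρ s * g s ≤ (Fintype.card (Setting n m) : ℝ)⁻¹ * ∑ U, F U := by
  rw [sum_shot, Finset.mul_sum]
  refine Finset.sum_le_sum fun U _ => ?_
  calc ∑ x, shotProb ρ ⟨U, x⟩ * g ⟨U, x⟩ ≤ ∑ x, shotProb ρ ⟨U, x⟩ * F U :=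
        Finset.sum_le_sum fun x _ => mul_le_mul_of_nonneg_left (hg ⟨U, x⟩) (shotProb_nonneg _ _)
    _ = _ := by
        simp only [shotProb]
        rw [← Finset.sum_mul, ← Finset.mul_sum, bornProb_sum, mul_one]

/-- Expanding in matrix units of `ρ` makes the Born probability a combination of products over
qubits, so that averages reduce to single-qubit sums even for entangled states. -/
theorem bornProb_eq_sum (ρ : QState n m) (U : Setting n m) (x : ABIndex n m) :
    (bornProb ρ U x : ℂ) = ∑ y, ∑ y', ρ.mat y y' *
      ∏ q, outcomeProj (U q) (bitAt x q) (bitAt y' q) (bitAt y q) := by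
  have h0 := (ρ.posSemidef.mul_mul_conjTranspose_same U.rotation).diag_nonneg (i := x)
  have h1 : (bornProb ρ U x : ℂ) = (U.rotation * ρ.mat * U.rotationᴴ) x x :=
    Complex.ext rfl (Complex.le_def.1 h0).2
  rw [h1, Matrix.mul_apply, Finset.sum_comm]
  refine Finset.sum_congr rfl fun y' _ => ?_
  rw [Matrix.mul_apply, Finset.sum_mul]
  refine Finset.sum_congr rfl fun y _ => ?_
  simp only [outcomeProj_apply, Finset.prod_mul_distrib, Setting.rotation, tensorOp,
    Matrix.conjTranspose_apply, Matrix.of_apply, star_prod]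
  simp only [Setting.mat]
  ring

/-- Snapshots are unbiased. -/
theorem sum_shotProb_mul_snapshot (ρ : QState n m) (c d : ABIndex n m) :
    ∑ s, (shotProb ρ s : ℂ) * s.snapshot c d = ρ.mat c d := by
  have hcard : (Fintype.card (Setting n m) : ℂ) ≠ 0 := by exact_mod_cast Fintype.card_ne_zero
  have hloc : ∀ y y' : ABIndex n m, ∑ U : Setting n m, ∑ x : ABIndex n m,
      (∏ q, outcomeProj (U q) (bitAt x q) (bitAt y' q) (bitAt y q)) *
        ∏ q, localSnapshot (U q) (bitAt x q) (bitAt c q) (bitAt d q)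
      = if y = c ∧ y' = d then (Fintype.card (Setting n m) : ℂ) else 0 := by
    intro y y'
    have h1 : ∀ U : Setting n m, ∑ x : ABIndex n m,
        (∏ q, outcomeProj (U q) (bitAt x q) (bitAt y' q) (bitAt y q)) *
          ∏ q, localSnapshot (U q) (bitAt x q) (bitAt c q) (bitAt d q)
        = ∏ q, ∑ b, outcomeProj (U q) b (bitAt y' q) (bitAt y q) *
            localSnapshot (U q) b (bitAt c q) (bitAt d q) := by
      intro U
      rw [prod_sum_eq_sum_prod, ← sum_bits]
      simp only [Finset.prod_mul_distrib]
    rw [Finset.sum_congr rfl fun U _ => h1 U, ← prod_sum_eq_sum_prod fun (q : Qubit n m) V =>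
      ∑ b, outcomeProj V b (bitAt y' q) (bitAt y q) * localSnapshot V b (bitAt c q) (bitAt d q)]
    simp only [sum_outcomeProj_mul_localSnapshot]
    split_ifs with h
    · obtain ⟨rfl, rfl⟩ := h
      simp
    · have : ∃ q, ¬ (bitAt y q = bitAt c q ∧ bitAt y' q = bitAt d q) := by
        by_contra hc
        push Not at hc
        exact h ⟨bitAt_injective (funext fun q => (hc q).1),
          bitAt_injective (funext fun q => (hc q).2)⟩
      obtain ⟨q, hq⟩ := this
      exact Finset.prod_eq_zero (Finset.mem_univ q) (if_neg hq)
  have hexp : ∀ (U : Setting n m) (x : ABIndex n m),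
      (shotProb ρ ⟨U, x⟩ : ℂ) * Shot.snapshot ⟨U, x⟩ c d
      = (Fintype.card (Setting n m) : ℂ)⁻¹ * ∑ y, ∑ y', ρ.mat y y' *
          ((∏ q, outcomeProj (U q) (bitAt x q) (bitAt y' q) (bitAt y q)) *
            ∏ q, localSnapshot (U q) (bitAt x q) (bitAt c q) (bitAt d q)) := by
    intro U x
    rw [shotProb, Complex.ofReal_mul, bornProb_eq_sum, Shot.snapshot_eq, tensorOp, Matrix.of_apply]
    simp only [Finset.mul_sum, Finset.sum_mul]
    refine Finset.sum_congr rfl fun y _ => Finset.sum_congr rfl fun y' _ => ?_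
    push_cast
    ring
  rw [sum_shot, Finset.sum_congr rfl fun U _ => Finset.sum_congr rfl fun x _ => hexp U x]
  simp only [← Finset.mul_sum]
  have hswap : ∑ U : Setting n m, ∑ x : ABIndex n m, ∑ y, ∑ y', ρ.mat y y' *
      ((∏ q, outcomeProj (U q) (bitAt x q) (bitAt y' q) (bitAt y q)) *
        ∏ q, localSnapshot (U q) (bitAt x q) (bitAt c q) (bitAt d q))
      = ∑ y, ∑ y', ρ.mat y y' * ∑ U : Setting n m, ∑ x : ABIndex n m,
        ((∏ q, outcomeProj (U q) (bitAt x q) (bitAt y' q) (bitAt y q)) *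
          ∏ q, localSnapshot (U q) (bitAt x q) (bitAt c q) (bitAt d q)) := by
    simp only [Finset.mul_sum]
    rw [Finset.sum_congr rfl fun U _ => Finset.sum_comm, Finset.sum_comm]
    refine Finset.sum_congr rfl fun y _ => ?_
    rw [Finset.sum_congr rfl fun U _ => Finset.sum_comm, Finset.sum_comm]
  rw [hswap]
  simp only [hloc]
  rw [Finset.sum_eq_single c, Finset.sum_eq_single d]
  · rw [if_pos ⟨rfl, rfl⟩]
    field_simp
  · intro y' _ hy'
    rw [if_neg fun h => hy' h.2, mul_zero]
  · simp
  · intro y _ hy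
    exact Finset.sum_eq_zero fun y' _ => by rw [if_neg fun h => hy h.1, mul_zero]
  · simp

end Shots

/-! ### Second moment of a one-copy observable -/

section OneCopy

variable {n m : ℕ}

/-- The features of one single-qubit setting. -/
noncomputable def oneFeature : Fin 4 → Cl2 → ℝ := ![fun _ => 1, blochX, blochY, blochZ]

/-- At most one component is nonzero, and its square is then 9. -/
theorem bloch_pow_four (U : Cl2) : blochX U ^ 4 = 9 * blochX U ^ 2 ∧
    blochY U ^ 4 = 9 * blochY U ^ 2 ∧ blochZ U ^ 4 = 9 * blochZ U ^ 2 := by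
  have h := bloch_normSq U
  obtain ⟨h1, h2, h3⟩ := axisAligned U
  refine ⟨?_, ?_, ?_⟩
  · linear_combination (blochX U ^ 2) * h - (blochX U * blochY U) * h1 - (blochZ U * blochX U) * h3
  · linear_combination (blochY U ^ 2) * h - (blochX U * blochY U) * h1 - (blochY U * blochZ U) * h2
  · linear_combination (blochZ U ^ 2) * h - (blochY U * blochZ U) * h2 - (blochZ U * blochX U) * h3

/-- With weights 1, 3, 3, 3 the total `∑ w φ² / M` is the constant `1 + |v|² / 3 = 4`, and each `φ²
/ w` has mean 1. So every coefficient equals 4. -/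
theorem sum_sq_oneFeature (a : (Qubit n m → Fin 4) → ℝ) :
    ∑ U : Setting n m, (∑ p, a p * ∏ q, |oneFeature (p q) (U q)|) ^ 2
      ≤ Fintype.card (Setting n m) * ∑ p, a p ^ 2 * ∏ _q : Qubit n m, (4 : ℝ) := by
  refine sum_sq_sum_prod_le (ι := Qubit n m) oneFeature ![1, 9, 9, 9] ![1, 3, 3, 3] (fun _ => 4)
    ?_ ?_ ?_ ?_ a
  · intro j; fin_cases j <;> norm_num
  · intro j; fin_cases j <;> norm_num
  · intro j U
    obtain ⟨h1, h2, h3⟩ := bloch_pow_four U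
    fin_cases j
    · simp [oneFeature]
    · exact h1
    · exact h2
    · exact h3
  · intro j
    have h4 : ∀ U : Cl2, ∑ l, (![1, 3, 3, 3] : Fin 4 → ℝ) l * oneFeature l U ^ 2
        / (![1, 9, 9, 9] : Fin 4 → ℝ) l = 4 := by
      intro U
      have h := bloch_normSq U
      rw [Fin.sum_univ_four]
      simp only [oneFeature, Matrix.cons_val]
      linarith
    simp only [h4, ← Finset.mul_sum, ← Finset.sum_div]
    fin_cases j
    · simp [oneFeature, mul_comm]
    · simp only [oneFeature, Fin.mk_one, Matrix.cons_val]
      rw [sum_blochX_sq]; ring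
    · simp only [oneFeature, Fin.reduceFinMk, Matrix.cons_val]
      rw [sum_blochY_sq]; ring
    · simp only [oneFeature, Fin.reduceFinMk, Matrix.cons_val]
      rw [sum_blochZ_sq]; ring

/-- The coordinates of the matrix entries of a single-qubit snapshot. -/
noncomputable def oneCoord (c d : Fin 2) : Fin 4 → ℂ :=
  ![1 / 2 * (1 : Matrix (Fin 2) (Fin 2) ℂ) c d, 1 / 2 * pauliMat 0 c d, 1 / 2 * pauliMat 1 c d,
    1 / 2 * pauliMat 2 c d]

/-- The signed features of a single-qubit snapshot. -/
noncomputable def oneSigned (U : Cl2) (b : Fin 2) (j : Fin 4) : ℂ :=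
  if j = 0 then 1 else (outcomeSign b : ℂ) * oneFeature j U

theorem norm_oneSigned (U : Cl2) (b : Fin 2) (j : Fin 4) :
    ‖oneSigned U b j‖ = |oneFeature j U| := by
  unfold oneSigned
  split_ifs with h
  · subst h; simp [oneFeature]
  · rw [norm_mul, Complex.norm_real, Complex.norm_real, Real.norm_eq_abs, Real.norm_eq_abs,
      abs_outcomeSign, one_mul]

theorem localSnapshot_apply (U : Cl2) (b c d : Fin 2) :
    localSnapshot U b c d = ∑ j, oneCoord c d j * oneSigned U b j := by
  rw [localSnapshot_eq, pauliMat_combination, Fin.sum_univ_four]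
  simp [oneCoord, oneSigned, oneFeature]
  ring

/-- Equal coefficients make this the completeness relation of the Pauli basis. The matrix entries
are therefore orthogonal, and a product of local factors 2 becomes the factor `2^(n+m)` in front of
the Frobenius norm. -/
theorem sum_oneCoord (c d c' d' : Fin 2) :
    ∑ j, ((4 : ℝ) : ℂ) * (oneCoord c d j * star (oneCoord c' d' j))
      = if c = c' ∧ d = d' then 2 else 0 := by
  rw [Fin.sum_univ_four]
  fin_cases c <;> fin_cases d <;> fin_cases c' <;> fin_cases d' <;>
    simp [oneCoord, pauliMat] <;> ring_nf <;> simp <;> norm_num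

/-- The second moment of a linear functional of a snapshot. -/
theorem sum_shotProb_mul_normSq_trace_le (ρ : QState n m) (O : ABOp n m) :
    ∑ s, shotProb ρ s * ‖(O * s.snapshot).trace‖ ^ 2
      ≤ 2 ^ (n + m) * ∑ x, ∑ y, ‖O x y‖ ^ 2 := by
  have hcard : (Fintype.card (Setting n m) : ℝ) ≠ 0 := by exact_mod_cast Fintype.card_ne_zero
  let c : ABIndex n m × ABIndex n m → ℂ := fun t => O t.1 t.2
  let v : ABIndex n m × ABIndex n m → Qubit n m → Fin 4 → ℂ := fun t q =>
    oneCoord (bitAt t.2 q) (bitAt t.1 q)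
  have hbound : ∀ s : Shot n m, ‖(O * s.snapshot).trace‖ ^ 2
      ≤ (∑ p : Qubit n m → Fin 4, ‖∑ t, c t * ∏ q, v t q (p q)‖ *
          ∏ q, |oneFeature (p q) (s.setting q)|) ^ 2 := by
    intro s
    have h := norm_sum_prod_le c v fun j q => oneSigned (s.setting q) (bitAt s.outcome q) j
    simp only [norm_oneSigned] at h
    refine pow_le_pow_left₀ (norm_nonneg _) (le_trans (le_of_eq ?_) h) 2
    congr 1
    simp only [Matrix.trace, Matrix.diag_apply, Matrix.mul_apply, Shot.snapshot_eq, tensorOp,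
      Matrix.of_apply, localSnapshot_apply, Fintype.sum_prod_type, c, v]
  refine (sum_shotProb_mul_le ρ _ (fun U => (∑ p : Qubit n m → Fin 4,
    ‖∑ t, c t * ∏ q, v t q (p q)‖ * ∏ q, |oneFeature (p q) (U q)|) ^ 2) hbound).trans ?_
  rw [inv_mul_le_iff₀ (by positivity)]
  refine (sum_sq_oneFeature _).trans_eq ?_
  congr 1
  have h := sum_normSq_sum_prod c v fun _ => (4 : ℝ)
  have hgram : ∀ t t' : ABIndex n m × ABIndex n m,
      ∏ q, ∑ j, ((4 : ℝ) : ℂ) * (v t q j * star (v t' q j))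
      = if t = t' then (2 : ℂ) ^ (n + m) else 0 := by
    intro t t'
    simp only [v, sum_oneCoord]
    split_ifs with h
    · subst h; simp
    · have : ∃ q, ¬ (bitAt t.2 q = bitAt t'.2 q ∧ bitAt t.1 q = bitAt t'.1 q) := by
        by_contra hc
        push Not at hc
        exact h (Prod.ext (bitAt_injective (funext fun q => (hc q).2))
          (bitAt_injective (funext fun q => (hc q).1)))
      obtain ⟨q, hq⟩ := this
      exact Finset.prod_eq_zero (Finset.mem_univ q) (if_neg hq)
  simp only [hgram, mul_ite, mul_zero, Finset.sum_ite_eq, Finset.mem_univ, if_true] at h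
  apply Complex.ofReal_injective
  rw [h, Fintype.sum_prod_type]
  push_cast
  simp only [Finset.mul_sum, Complex.star_def, Complex.mul_conj']
  exact Finset.sum_congr rfl fun x _ => Finset.sum_congr rfl fun y _ => mul_comm _ _

end OneCopy

/-! ### The observable as a bilinear form -/

section Observable

variable {n m : ℕ}

theorem sectorProj_mul_apply (i : ℤ) (M : ABOp n m) (x y : ABIndex n m) :
    (sectorProj n m i * M) x y = if x ∈ sectorSet n m i then M x y else 0 := by
  rw [sectorProj_eq_diagonal, Matrix.diagonal_mul, ite_mul, one_mul, zero_mul]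

theorem trace_sectorProj_mul (i : ℤ) (M : ABOp n m) :
    (sectorProj n m i * M).trace = ∑ x ∈ sectorSet n m i, M x x := by
  simp only [Matrix.trace, Matrix.diag_apply, sectorProj_mul_apply, Finset.sum_ite_mem,
    Finset.univ_inter]

theorem swapA_mul_apply (Z : ABABOp n m) (u v : ABIndex n m × ABIndex n m) :
    (swapA n m * Z) u v = Z ((u.2.1, u.1.2), (u.1.1, u.2.2)) v := by
  rw [Matrix.mul_apply, Finset.sum_eq_single ((u.2.1, u.1.2), (u.1.1, u.2.2))]
  · simp [swapA]
  · intro w _ hw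
    rw [swapA, Matrix.of_apply, if_neg, zero_mul]
    rintro rfl
    exact hw rfl
  · simp

theorem swapB_mul_apply (Z : ABABOp n m) (u v : ABIndex n m × ABIndex n m) :
    (swapB n m * Z) u v = Z ((u.1.1, u.2.2), (u.2.1, u.1.2)) v := by
  rw [Matrix.mul_apply, Finset.sum_eq_single ((u.1.1, u.2.2), (u.2.1, u.1.2))]
  · simp [swapB]
  · intro w _ hw
    rw [swapB, Matrix.of_apply, if_neg, zero_mul]
    rintro rfl
    exact hw rfl
  · simp

theorem mul_swapA_apply (Z : ABABOp n m) (u v : ABIndex n m × ABIndex n m) :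
    (Z * swapA n m) u v = Z u ((v.2.1, v.1.2), (v.1.1, v.2.2)) := by
  rw [Matrix.mul_apply, Finset.sum_eq_single ((v.2.1, v.1.2), (v.1.1, v.2.2))]
  · simp [swapA]
  · intro w _ hw
    rw [swapA, Matrix.of_apply, if_neg hw, mul_zero]
  · simp

theorem mul_swapB_apply (Z : ABABOp n m) (u v : ABIndex n m × ABIndex n m) :
    (Z * swapB n m) u v = Z u ((v.1.1, v.2.2), (v.2.1, v.1.2)) := by
  rw [Matrix.mul_apply, Finset.sum_eq_single ((v.1.1, v.2.2), (v.2.1, v.1.2))]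
  · simp [swapB]
  · intro w _ hw
    rw [swapB, Matrix.of_apply, if_neg hw, mul_zero]
  · simp

theorem sectorProj_kronecker_one (i : ℤ) :
    sectorProj n m i ⊗ₖ (1 : ABOp n m)
      = Matrix.diagonal fun u => if u.1 ∈ sectorSet n m i then 1 else 0 := by
  rw [sectorProj_eq_diagonal, ← Matrix.diagonal_one, Matrix.diagonal_kronecker_diagonal]
  simp

/-- Exchanging only the `A` copies on one side and only the `B` copies on the other contracts `X`
and `Y` along crossed indices, which is ordinary multiplication of their partial transposes. -/
theorem trace_swapA_mul_swapB (i : ℤ) (X Y : ABOp n m) :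
    (swapA n m * (sectorProj n m i ⊗ₖ (1 : ABOp n m)) * swapB n m * (X ⊗ₖ Y)).trace
      = (sectorProj n m i * (partialTranspose X * partialTranspose Y)).trace := by
  rw [Matrix.mul_assoc, Matrix.mul_assoc, Matrix.trace_mul_comm, Matrix.mul_assoc,
    sectorProj_kronecker_one, trace_sectorProj_mul, ← Finset.univ_inter (sectorSet n m i),
    ← Finset.sum_ite_mem]
  simp only [Matrix.trace, Matrix.diag_apply, Matrix.diagonal_mul, mul_swapA_apply,
    swapB_mul_apply, kroneckerMap_apply]
  rw [Fintype.sum_prod_type]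
  refine Finset.sum_congr rfl fun x _ => ?_
  simp only [Finset.univ_inter]
  split_ifs
  · simp only [Matrix.mul_apply, partialTranspose, Matrix.of_apply, one_mul]
  · simp only [zero_mul, Finset.sum_const_zero]

theorem trace_swapB_mul_swapA (i : ℤ) (X Y : ABOp n m) :
    (swapB n m * (sectorProj n m i ⊗ₖ (1 : ABOp n m)) * swapA n m * (X ⊗ₖ Y)).trace
      = (sectorProj n m i * (partialTranspose Y * partialTranspose X)).trace := by
  rw [Matrix.mul_assoc, Matrix.mul_assoc, Matrix.trace_mul_comm, Matrix.mul_assoc,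
    sectorProj_kronecker_one, trace_sectorProj_mul, ← Finset.univ_inter (sectorSet n m i),
    ← Finset.sum_ite_mem]
  simp only [Matrix.trace, Matrix.diag_apply, Matrix.diagonal_mul, mul_swapB_apply,
    swapA_mul_apply, kroneckerMap_apply]
  rw [Fintype.sum_prod_type]
  refine Finset.sum_congr rfl fun x _ => ?_
  simp only [Finset.univ_inter]
  split_ifs
  · simp only [Matrix.mul_apply, partialTranspose, Matrix.of_apply, one_mul]
    exact Finset.sum_congr rfl fun w _ => mul_comm _ _
  · simp only [zero_mul, Finset.sum_const_zero]

/-- The bilinear form of the observable. -/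
noncomputable def pairForm (i : ℤ) (X Y : ABOp n m) : ℂ :=
  (D2Observable n m i * (X ⊗ₖ Y)).trace

theorem pairForm_eq (i : ℤ) (X Y : ABOp n m) :
    pairForm i X Y = (sectorProj n m i * X).trace * (sectorProj n m i * Y).trace
      - 1 / 2 * (sectorProj n m i * (partialTranspose X * partialTranspose Y)).trace
      - 1 / 2 * (sectorProj n m i * (partialTranspose Y * partialTranspose X)).trace := by
  rw [pairForm, D2Observable, sub_mul, sub_mul, Matrix.trace_sub, Matrix.trace_sub,
    Matrix.smul_mul, Matrix.smul_mul, Matrix.trace_smul, Matrix.trace_smul,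
    trace_swapA_mul_swapB, trace_swapB_mul_swapA, ← Matrix.mul_kronecker_mul,
    Matrix.trace_kronecker, smul_eq_mul, smul_eq_mul]

theorem pairForm_symm (i : ℤ) (X Y : ABOp n m) : pairForm i X Y = pairForm i Y X := by
  rw [pairForm_eq, pairForm_eq]; ring

end Observable

/-! ### Features of a pair of single-qubit settings and their weights -/

section TwoCopies

variable {n m : ℕ}

/-- The coordinates of the features of a pair of single-qubit settings. -/
noncomputable def twoFeature : Fin 6 → Cl2 × Cl2 → ℝ :=
  ![fun _ => 1, fun U => blochZ U.1, fun U => blochZ U.2, fun U => blochZ U.1 * blochZ U.2,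
    fun U => (blochX U.1 * blochX U.2 + blochY U.1 * blochY U.2) / 4,
    fun U => (blochX U.1 * blochY U.2 - blochY U.1 * blochX U.2) / 4]

/-- The coefficients produced by the weights of the two-copy features. -/
noncomputable def twoCoeff : Fin 6 → ℝ := ![12, 12, 12, 12, 6 / 5, 6 / 5]

theorem sum_pair_bloch (α β γ δ ε ζ η θ : ℝ) :
    ∑ U : Cl2 × Cl2, (α + β * blochZ U.1 ^ 2 + γ * blochZ U.2 ^ 2
        + δ * (blochZ U.1 ^ 2 * blochZ U.2 ^ 2) + ε * (blochX U.1 ^ 2 * blochX U.2 ^ 2)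
        + ζ * (blochY U.1 ^ 2 * blochY U.2 ^ 2) + η * (blochX U.1 ^ 2 * blochY U.2 ^ 2)
        + θ * (blochY U.1 ^ 2 * blochX U.2 ^ 2))
      = Fintype.card (Cl2 × Cl2) * (α + 3 * β + 3 * γ + 9 * δ + 9 * ε + 9 * ζ + 9 * η + 9 * θ) := by
  simp only [Finset.sum_add_distrib, ← Finset.mul_sum, Fintype.sum_prod_type]
  simp only [← Finset.sum_mul, sum_blochX_sq, sum_blochY_sq, sum_blochZ_sq, Finset.sum_const,
    Finset.card_univ, nsmul_eq_mul, Fintype.card_prod, ← Finset.mul_sum]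
  push_cast
  ring

/-- The last two features vanish unless both axes are transverse to `z`. Then just one of their two
products survives, and the value is `±9/4`. -/
theorem twoFeature_pow_four (j : Fin 6) (U : Cl2 × Cl2) :
    twoFeature j U ^ 4 = (![1, 9, 9, 81, 81 / 16, 81 / 16] : Fin 6 → ℝ) j * twoFeature j U ^ 2 := by
  obtain ⟨a1, a2, a3⟩ := axisAligned U.1
  obtain ⟨b1, b2, b3⟩ := axisAligned U.2
  obtain ⟨p1, p2, p3⟩ := bloch_pow_four U.1
  obtain ⟨q1, q2, q3⟩ := bloch_pow_four U.2
  fin_cases j <;> simp only [twoFeature, Fin.zero_eta, Fin.mk_one, Fin.reduceFinMk, Matrix.cons_val]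
  · norm_num
  · exact p3
  · exact q3
  · linear_combination blochZ U.2 ^ 4 * p3 + 9 * blochZ U.1 ^ 2 * q3
  · have h : (blochX U.1 * blochX U.2 + blochY U.1 * blochY U.2) ^ 2
        = blochX U.1 ^ 2 * blochX U.2 ^ 2 + blochY U.1 ^ 2 * blochY U.2 ^ 2 := by
      linear_combination (2 * blochX U.2 * blochY U.2) * a1
    have h' : (blochX U.1 ^ 2 * blochX U.2 ^ 2 + blochY U.1 ^ 2 * blochY U.2 ^ 2) ^ 2
        = 81 * (blochX U.1 ^ 2 * blochX U.2 ^ 2 + blochY U.1 ^ 2 * blochY U.2 ^ 2) := by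
      linear_combination blochX U.2 ^ 4 * p1 + 9 * blochX U.1 ^ 2 * q1 + blochY U.2 ^ 4 * p2
        + 9 * blochY U.1 ^ 2 * q2
        + (2 * blochX U.1 * blochY U.1 * blochX U.2 ^ 2 * blochY U.2 ^ 2) * a1
    rw [div_pow, div_pow, show ∀ r : ℝ, r ^ 4 = (r ^ 2) ^ 2 by intro r; ring, h, h']
    ring
  · have h : (blochX U.1 * blochY U.2 - blochY U.1 * blochX U.2) ^ 2
        = blochX U.1 ^ 2 * blochY U.2 ^ 2 + blochY U.1 ^ 2 * blochX U.2 ^ 2 := by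
      linear_combination (-2 * blochX U.2 * blochY U.2) * a1
    have h' : (blochX U.1 ^ 2 * blochY U.2 ^ 2 + blochY U.1 ^ 2 * blochX U.2 ^ 2) ^ 2
        = 81 * (blochX U.1 ^ 2 * blochY U.2 ^ 2 + blochY U.1 ^ 2 * blochX U.2 ^ 2) := by
      linear_combination blochY U.2 ^ 4 * p1 + 9 * blochX U.1 ^ 2 * q2 + blochX U.2 ^ 4 * p2
        + 9 * blochY U.1 ^ 2 * q1
        + (2 * blochX U.1 * blochY U.1 * blochX U.2 ^ 2 * blochY U.2 ^ 2) * a1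
    rw [div_pow, div_pow, show ∀ r : ℝ, r ^ 4 = (r ^ 2) ^ 2 by intro r; ring, h, h']
    ring

/-- The weights are balanced so that the four diagonal features get the same coefficient 12, which
makes the diagonal terms orthogonal in the Gram matrices below, while the two transverse features
get only 6/5. -/
theorem sum_twoFeature_weight (j : Fin 6) :
    ∑ U, (∑ l, (![1, 3, 3, 21, 15, 15] : Fin 6 → ℝ) l * twoFeature l U ^ 2
        / (![1, 9, 9, 81, 81 / 16, 81 / 16] : Fin 6 → ℝ) l)
        * (twoFeature j U ^ 2 / (![1, 3, 3, 21, 15, 15] : Fin 6 → ℝ) j)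
      = Fintype.card (Cl2 × Cl2) * twoCoeff j := by
  -- The total weight is 16 if no axis is `z`, 4 if exactly one is, and 28 if both are.
  have htot : ∀ U : Cl2 × Cl2, ∑ l, (![1, 3, 3, 21, 15, 15] : Fin 6 → ℝ) l * twoFeature l U ^ 2
        / (![1, 9, 9, 81, 81 / 16, 81 / 16] : Fin 6 → ℝ) l
      = 16 - 4 / 3 * (blochZ U.1 ^ 2 + blochZ U.2 ^ 2)
        + 4 / 9 * (blochZ U.1 ^ 2 * blochZ U.2 ^ 2) := by
    intro U
    have h1 := bloch_normSq U.1
    have h2 := bloch_normSq U.2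
    rw [Fin.sum_univ_six]
    simp only [twoFeature, Matrix.cons_val]
    linear_combination (15 / 81 * (blochX U.2 ^ 2 + blochY U.2 ^ 2)) * h1
      + (15 / 81 * (9 - blochZ U.1 ^ 2)) * h2
  simp only [htot]
  have key : ∀ (α β γ δ ε ζ η θ : ℝ), (∀ U : Cl2 × Cl2,
      (16 - 4 / 3 * (blochZ U.1 ^ 2 + blochZ U.2 ^ 2)
        + 4 / 9 * (blochZ U.1 ^ 2 * blochZ U.2 ^ 2))
        * (twoFeature j U ^ 2 / (![1, 3, 3, 21, 15, 15] : Fin 6 → ℝ) j)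
      = α + β * blochZ U.1 ^ 2 + γ * blochZ U.2 ^ 2
        + δ * (blochZ U.1 ^ 2 * blochZ U.2 ^ 2) + ε * (blochX U.1 ^ 2 * blochX U.2 ^ 2)
        + ζ * (blochY U.1 ^ 2 * blochY U.2 ^ 2) + η * (blochX U.1 ^ 2 * blochY U.2 ^ 2)
        + θ * (blochY U.1 ^ 2 * blochX U.2 ^ 2)) →
      α + 3 * β + 3 * γ + 9 * δ + 9 * ε + 9 * ζ + 9 * η + 9 * θ = twoCoeff j →
      ∑ U : Cl2 × Cl2, (16 - 4 / 3 * (blochZ U.1 ^ 2 + blochZ U.2 ^ 2)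
        + 4 / 9 * (blochZ U.1 ^ 2 * blochZ U.2 ^ 2))
        * (twoFeature j U ^ 2 / (![1, 3, 3, 21, 15, 15] : Fin 6 → ℝ) j)
      = Fintype.card (Cl2 × Cl2) * twoCoeff j := by
    intro α β γ δ ε ζ η θ h h'
    rw [Finset.sum_congr rfl fun U _ => h U, sum_pair_bloch, h']
  have haxis : ∀ V : Cl2, blochX V ^ 2 * blochZ V ^ 2 = 0 ∧ blochY V ^ 2 * blochZ V ^ 2 = 0 ∧
      blochX V * blochY V = 0 ∧ blochZ V ^ 4 = 9 * blochZ V ^ 2 := by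
    intro V
    obtain ⟨a1, a2, a3⟩ := axisAligned V
    refine ⟨?_, ?_, a1, (bloch_pow_four V).2.2⟩
    · linear_combination (blochZ V * blochX V) * a3
    · linear_combination (blochY V * blochZ V) * a2
  fin_cases j
  · apply key 16 (-4 / 3) (-4 / 3) (4 / 9) 0 0 0 0
    · intro U
      simp [twoFeature]
      ring
    · norm_num [twoCoeff]
  · apply key 0 (4 / 3) 0 (8 / 9) 0 0 0 0
    · intro U
      obtain ⟨a1, a2, a3, a4⟩ := haxis U.1
      simp only [twoFeature, Fin.mk_one, Matrix.cons_val]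
      linear_combination (-4 / 9 + 4 / 27 * blochZ U.2 ^ 2) * a4
    · norm_num [twoCoeff]
  · apply key 0 0 (4 / 3) (8 / 9) 0 0 0 0
    · intro U
      obtain ⟨a1, a2, a3, a4⟩ := haxis U.2
      simp only [twoFeature, Fin.reduceFinMk, Matrix.cons_val]
      linear_combination (-4 / 9 + 4 / 27 * blochZ U.1 ^ 2) * a4
    · norm_num [twoCoeff]
  · apply key 0 0 0 (28 / 21) 0 0 0 0
    · intro U
      obtain ⟨a1, a2, a3, a4⟩ := haxis U.1
      obtain ⟨b1, b2, b3, b4⟩ := haxis U.2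
      simp only [twoFeature, Fin.reduceFinMk, Matrix.cons_val]
      linear_combination (-4 / 63 * blochZ U.2 ^ 2 + 4 / 189 * blochZ U.2 ^ 4) * a4
        + (-4 / 63 * blochZ U.1 ^ 2 + 4 / 21 * blochZ U.1 ^ 2) * b4
    · norm_num [twoCoeff]
  · apply key 0 0 0 0 (1 / 15) (1 / 15) 0 0
    · intro U
      obtain ⟨a1, a2, a3, a4⟩ := haxis U.1
      obtain ⟨b1, b2, b3, b4⟩ := haxis U.2
      simp only [twoFeature, Fin.reduceFinMk, Matrix.cons_val]
      have h : (blochX U.1 * blochX U.2 + blochY U.1 * blochY U.2) ^ 2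
          = blochX U.1 ^ 2 * blochX U.2 ^ 2 + blochY U.1 ^ 2 * blochY U.2 ^ 2 := by
        linear_combination (2 * blochX U.2 * blochY U.2) * a3
      rw [div_pow, h]
      linear_combination ((-4 / 3 + 4 / 9 * blochZ U.2 ^ 2) / 240)
          * (blochX U.2 ^ 2 * a1 + blochY U.2 ^ 2 * a2)
        + (-4 / 3 / 240) * (blochX U.1 ^ 2 * b1 + blochY U.1 ^ 2 * b2)
    · norm_num [twoCoeff]
  · apply key 0 0 0 0 0 0 (1 / 15) (1 / 15)
    · intro U
      obtain ⟨a1, a2, a3, a4⟩ := haxis U.1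
      obtain ⟨b1, b2, b3, b4⟩ := haxis U.2
      simp only [twoFeature, Fin.reduceFinMk, Matrix.cons_val]
      have h : (blochX U.1 * blochY U.2 - blochY U.1 * blochX U.2) ^ 2
          = blochX U.1 ^ 2 * blochY U.2 ^ 2 + blochY U.1 ^ 2 * blochX U.2 ^ 2 := by
        linear_combination (-2 * blochX U.2 * blochY U.2) * a3
      rw [div_pow, h]
      linear_combination ((-4 / 3 + 4 / 9 * blochZ U.2 ^ 2) / 240)
          * (blochY U.2 ^ 2 * a1 + blochX U.2 ^ 2 * a2)
        + (-4 / 3 / 240) * (blochX U.1 ^ 2 * b2 + blochY U.1 ^ 2 * b1)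
    · norm_num [twoCoeff]

theorem sum_sq_twoFeature (a : (Qubit n m → Fin 6) → ℝ) :
    ∑ U : Qubit n m → Cl2 × Cl2, (∑ p, a p * ∏ q, |twoFeature (p q) (U q)|) ^ 2
      ≤ Fintype.card (Qubit n m → Cl2 × Cl2) * ∑ p, a p ^ 2 * ∏ q, twoCoeff (p q) := by
  refine sum_sq_sum_prod_le (ι := Qubit n m) twoFeature ![1, 9, 9, 81, 81 / 16, 81 / 16]
    ![1, 3, 3, 21, 15, 15] twoCoeff ?_ ?_ twoFeature_pow_four sum_twoFeature_weight a
  · intro j; fin_cases j <;> norm_num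
  · intro j; fin_cases j <;> norm_num

end TwoCopies

/-! ### Local Gram matrices of the terms of the observable -/

section TwoCopies

variable {n m : ℕ}

/-- The single-qubit factor of a partially transposed product operator. -/
def localTranspose (q : Qubit n m) (M : Matrix (Fin 2) (Fin 2) ℂ) : Matrix (Fin 2) (Fin 2) ℂ :=
  Sum.elim (fun _ => M) (fun _ => Mᵀ) q

theorem partialTranspose_tensorOp (X : Qubit n m → Matrix (Fin 2) (Fin 2) ℂ) :
    partialTranspose (tensorOp X) = tensorOp fun q => localTranspose q (X q) := by
  ext x y
  simp only [partialTranspose, tensorOp, Matrix.of_apply]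
  refine Finset.prod_congr rfl fun q _ => ?_
  rcases q with q | q <;> rfl

/-- The coordinates of `X_aa Y_bb`. -/
noncomputable def diagCoord (a b : Fin 2) : Fin 6 → ℂ :=
  ![1 / 4, outcomeSign a / 4, outcomeSign b / 4, outcomeSign a * outcomeSign b / 4, 0, 0]

/-- The coordinates of the diagonal entries of products of two single-qubit snapshots. -/
noncomputable def prodCoord (τ : ℝ) (a : Fin 2) : Fin 6 → ℂ :=
  ![1 / 4, outcomeSign a / 4, outcomeSign a / 4, 1 / 4, 1, τ * outcomeSign a * Complex.I]

/-- The signed features of a pair of single-qubit snapshots. -/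
noncomputable def twoSigned (U : Cl2 × Cl2) (b b' : Fin 2) (j : Fin 6) : ℂ :=
  ((![1, outcomeSign b, outcomeSign b', outcomeSign b * outcomeSign b',
    outcomeSign b * outcomeSign b', outcomeSign b * outcomeSign b'] : Fin 6 → ℝ) j
      * twoFeature j U : ℝ)

theorem norm_twoSigned (U : Cl2 × Cl2) (b b' : Fin 2) (j : Fin 6) :
    ‖twoSigned U b b' j‖ = |twoFeature j U| := by
  have h : |(![1, outcomeSign b, outcomeSign b', outcomeSign b * outcomeSign b',
    outcomeSign b * outcomeSign b', outcomeSign b * outcomeSign b'] : Fin 6 → ℝ) j| = 1 := by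
    fin_cases j <;> simp [abs_outcomeSign, abs_mul]
  rw [twoSigned, Complex.norm_real, Real.norm_eq_abs, abs_mul, h, one_mul]

theorem outcomeSign_zero : outcomeSign 0 = 1 := rfl

theorem outcomeSign_one : outcomeSign 1 = -1 := by simp [outcomeSign]

theorem localSnapshot_mul_diag (U : Cl2 × Cl2) (b b' a a' : Fin 2) :
    localSnapshot U.1 b a a * localSnapshot U.2 b' a' a'
      = ∑ j, diagCoord a a' j * twoSigned U b b' j := by
  rw [localSnapshot_eq, localSnapshot_eq, Fin.sum_univ_six]
  fin_cases a <;> fin_cases a' <;>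
    simp [diagCoord, twoSigned, twoFeature, outcomeSign_zero, outcomeSign_one] <;> ring

/-- The sign with which the imaginary feature enters on a given qubit. -/
def transposeSign (q : Qubit n m) : ℝ := Sum.elim (fun _ => 1) (fun _ => -1) q

theorem transposeSign_sq (q : Qubit n m) : transposeSign q ^ 2 = 1 := by
  rcases q with q | q <;> simp [transposeSign]

/-- The imaginary feature comes from the commutator part of the product. Transposing both factors on
a qubit of `B` has the effect of reversing their order on diagonal entries, so it changes sign
there; `transposeSign` records this. -/
theorem localSnapshot_mul_localSnapshot (q : Qubit n m) (U : Cl2 × Cl2) (b b' a : Fin 2) :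
    (localTranspose q (localSnapshot U.1 b) * localTranspose q (localSnapshot U.2 b')) a a
      = ∑ j, prodCoord (transposeSign q) a j * twoSigned U b b' j := by
  have hI := Complex.I_sq
  rw [localSnapshot_eq, localSnapshot_eq, Fin.sum_univ_six, Matrix.mul_apply, Fin.sum_univ_two]
  rcases q with q | q <;> fin_cases a <;>
    simp [prodCoord, twoSigned, twoFeature, outcomeSign_zero, outcomeSign_one, localTranspose,
      transposeSign] <;>
    linear_combination
      (-1 / 4 * (outcomeSign b : ℂ) * outcomeSign b' * blochY U.1 * blochY U.2) * hI

theorem localSnapshot_mul_localSnapshot' (q : Qubit n m) (U : Cl2 × Cl2) (b b' a : Fin 2) :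
    (localTranspose q (localSnapshot U.2 b') * localTranspose q (localSnapshot U.1 b)) a a
      = ∑ j, prodCoord (-transposeSign q) a j * twoSigned U b b' j := by
  have hI := Complex.I_sq
  rw [localSnapshot_eq, localSnapshot_eq, Fin.sum_univ_six, Matrix.mul_apply, Fin.sum_univ_two]
  rcases q with q | q <;> fin_cases a <;>
    simp [prodCoord, twoSigned, twoFeature, outcomeSign_zero, outcomeSign_one, localTranspose,
      transposeSign] <;>
    linear_combination
      (-1 / 4 * (outcomeSign b : ℂ) * outcomeSign b' * blochY U.1 * blochY U.2) * hI

theorem gram_diag_diag (a b c d : Fin 2) :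
    ∑ j, (twoCoeff j : ℂ) * (diagCoord a b j * star (diagCoord c d j))
      = if a = c ∧ b = d then 3 else 0 := by
  rw [Fin.sum_univ_six]
  fin_cases a <;> fin_cases b <;> fin_cases c <;> fin_cases d <;>
    simp [diagCoord, twoCoeff, outcomeSign_zero, outcomeSign_one] <;> norm_num

/-- A diagonal pair overlaps a product term only when both indices agree with it. These overlaps
produce the negative term `-2 tr P_i` in the second moment. -/
theorem gram_diag_prod (τ : ℝ) (a b c : Fin 2) :
    ∑ j, (twoCoeff j : ℂ) * (diagCoord a b j * star (prodCoord τ c j))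
      = if a = c ∧ b = c then 3 else 0 := by
  rw [Fin.sum_univ_six]
  fin_cases a <;> fin_cases b <;> fin_cases c <;>
    simp [diagCoord, prodCoord, twoCoeff, outcomeSign_zero, outcomeSign_one] <;> norm_num

theorem gram_prod_diag (τ : ℝ) (a b c : Fin 2) :
    ∑ j, (twoCoeff j : ℂ) * (prodCoord τ c j * star (diagCoord a b j))
      = if a = c ∧ b = c then 3 else 0 := by
  rw [Fin.sum_univ_six]
  fin_cases a <;> fin_cases b <;> fin_cases c <;>
    simp [diagCoord, prodCoord, twoCoeff, outcomeSign_zero, outcomeSign_one] <;> norm_num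

/-- For equal bits the diagonal features give 3 and each transverse one 6/5. For different bits both
groups cancel. -/
theorem gram_prod_same (τ : ℝ) (hτ : τ ^ 2 = 1) (a c : Fin 2) :
    ∑ j, (twoCoeff j : ℂ) * (prodCoord τ a j * star (prodCoord τ c j))
      = if a = c then 27 / 5 else 0 := by
  have hI := Complex.I_sq
  have hτ' : (τ : ℂ) ^ 2 = 1 := by exact_mod_cast hτ
  rw [Fin.sum_univ_six]
  fin_cases a <;> fin_cases c <;>
    simp [prodCoord, twoCoeff, outcomeSign_zero, outcomeSign_one]
  · linear_combination (-6 / 5 * (τ : ℂ) ^ 2) * hI + 6 / 5 * hτ'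
  · linear_combination (6 / 5 * (τ : ℂ) ^ 2) * hI - 6 / 5 * hτ'
  · linear_combination (6 / 5 * (τ : ℂ) ^ 2) * hI - 6 / 5 * hτ'
  · linear_combination (-6 / 5 * (τ : ℂ) ^ 2) * hI + 6 / 5 * hτ'

/-- Reversing the order flips the sign of the imaginary feature, so the transverse contributions now
cancel for equal bits and add up to 12/5 for different ones. -/
theorem gram_prod_opposite (τ : ℝ) (hτ : τ ^ 2 = 1) (a c : Fin 2) :
    ∑ j, (twoCoeff j : ℂ) * (prodCoord τ a j * star (prodCoord (-τ) c j))
      = if a = c then 3 else 12 / 5 := by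
  have hI := Complex.I_sq
  have hτ' : (τ : ℂ) ^ 2 = 1 := by exact_mod_cast hτ
  rw [Fin.sum_univ_six]
  fin_cases a <;> fin_cases c <;>
    simp [prodCoord, twoCoeff, outcomeSign_zero, outcomeSign_one]
  · linear_combination (6 / 5 * (τ : ℂ) ^ 2) * hI - 6 / 5 * hτ'
  · linear_combination (-6 / 5 * (τ : ℂ) ^ 2) * hI + 6 / 5 * hτ'
  · linear_combination (-6 / 5 * (τ : ℂ) ^ 2) * hI + 6 / 5 * hτ'
  · linear_combination (6 / 5 * (τ : ℂ) ^ 2) * hI - 6 / 5 * hτ'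

theorem prod_ite_bits {c : ℂ} {x y x' y' : ABIndex n m} :
    ∏ q : Qubit n m, (if bitAt x q = bitAt x' q ∧ bitAt y q = bitAt y' q then c else 0)
      = if x = x' ∧ y = y' then c ^ (n + m) else 0 := by
  split_ifs with h
  · obtain ⟨rfl, rfl⟩ := h; simp
  · have : ∃ q, ¬ (bitAt x q = bitAt x' q ∧ bitAt y q = bitAt y' q) := by
      by_contra hc
      push Not at hc
      exact h ⟨bitAt_injective (funext fun q => (hc q).1),
        bitAt_injective (funext fun q => (hc q).2)⟩
    obtain ⟨q, hq⟩ := this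
    exact Finset.prod_eq_zero (Finset.mem_univ q) (if_neg hq)

/-- The terms of the observable: pairs of diagonal entries and the two operator orders. -/
abbrev TermIndex (n m : ℕ) (i : ℤ) : Type :=
  (sectorSet n m i × sectorSet n m i) ⊕ (sectorSet n m i ⊕ sectorSet n m i)

/-- The coefficients of the terms of the observable. -/
noncomputable def termCoeff (n m : ℕ) (i : ℤ) : TermIndex n m i → ℂ :=
  Sum.elim (fun _ => 1) (fun _ => -(1 / 2))

/-- The local coordinates of the terms of the observable. -/
noncomputable def termCoord (n m : ℕ) (i : ℤ) : TermIndex n m i → Qubit n m → Fin 6 → ℂ :=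
  Sum.elim (fun t q => diagCoord (bitAt t.1.1 q) (bitAt t.2.1 q))
    (Sum.elim (fun x q => prodCoord (transposeSign q) (bitAt x.1 q))
      fun x q => prodCoord (-transposeSign q) (bitAt x.1 q))

theorem pairForm_snapshot (i : ℤ) (s s' : Shot n m) :
    pairForm i s.snapshot s'.snapshot
      = ∑ t, termCoeff n m i t * ∏ q, ∑ j, termCoord n m i t q j *
          twoSigned (s.setting q, s'.setting q) (bitAt s.outcome q) (bitAt s'.outcome q) j := by
  rw [pairForm_eq, Shot.snapshot_eq, Shot.snapshot_eq, partialTranspose_tensorOp,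
    partialTranspose_tensorOp, tensorOp_mul, tensorOp_mul]
  simp only [trace_sectorProj_mul, tensorOp, Matrix.of_apply]
  rw [Fintype.sum_sum_type, Fintype.sum_sum_type, Fintype.sum_prod_type]
  simp only [termCoeff, termCoord, Sum.elim_inl, Sum.elim_inr, ← localSnapshot_mul_diag,
    ← localSnapshot_mul_localSnapshot, ← localSnapshot_mul_localSnapshot', Finset.prod_mul_distrib]
  rw [← Finset.sum_coe_sort (sectorSet n m i), ← Finset.sum_coe_sort (sectorSet n m i),
    ← Finset.sum_coe_sort (sectorSet n m i), ← Finset.sum_coe_sort (sectorSet n m i),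
    Finset.sum_mul_sum, Finset.mul_sum, Finset.mul_sum]
  simp only [one_mul, neg_mul, Finset.sum_neg_distrib]
  ring

/-- The overlap of the two operator orders. -/
noncomputable def orderOverlap (n m : ℕ) (i : ℤ) : ℝ :=
  ∑ x : sectorSet n m i, ∑ y : sectorSet n m i,
    ∏ q, if bitAt x.1 q = bitAt y.1 q then 3 else 12 / 5

/-- Expansion of the squared norm with coefficients 1 and `-1/2`. The diagonal pairs give the square
of the dimension, their overlaps with the two orders give `-2` times the dimension, and each order
with itself gives `(27/5)^(n+m)` per basis state. The overlap of the two orders is the last term. -/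
theorem sum_termCoord (n m : ℕ) (i : ℤ) :
    ∑ p : Qubit n m → Fin 6, ‖∑ t, termCoeff n m i t * ∏ q, termCoord n m i t q (p q)‖ ^ 2 *
        ∏ q, twoCoeff (p q)
      = 3 ^ (n + m) * ((sectorSet n m i).card ^ 2 - 2 * (sectorSet n m i).card)
        + 1 / 2 * ((27 / 5) ^ (n + m) * (sectorSet n m i).card) + 1 / 2 * orderOverlap n m i := by
  apply Complex.ofReal_injective
  rw [sum_normSq_sum_prod]
  have hs : ∀ q : Qubit n m, (-transposeSign q) ^ 2 = 1 := fun q => by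
    rw [neg_sq, transposeSign_sq]
  have h2 : ∀ q : Qubit n m, ∀ a c, ∑ j, (twoCoeff j : ℂ) *
      (prodCoord (-transposeSign q) a j * star (prodCoord (transposeSign q) c j))
      = if a = c then 3 else 12 / 5 := by
    intro q a c
    have := gram_prod_opposite (-transposeSign q) (hs q) a c
    rwa [neg_neg] at this
  have h27 : ∀ x y : ABIndex n m, ∏ q : Qubit n m,
      (if bitAt x q = bitAt y q then (27 / 5 : ℂ) else 0)
      = if x = y then (27 / 5 : ℂ) ^ (n + m) else 0 := by
    intro x y
    have := prod_ite_bits (c := (27 / 5 : ℂ)) (x := x) (y := x) (x' := y) (y' := y)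
    simpa only [and_self] using this
  simp only [Fintype.sum_sum_type, Fintype.sum_prod_type, termCoeff, termCoord, Sum.elim_inl,
    Sum.elim_inr, gram_diag_diag, gram_diag_prod, gram_prod_diag, h2,
    gram_prod_same _ (transposeSign_sq _), gram_prod_same _ (hs _),
    gram_prod_opposite _ (transposeSign_sq _), prod_ite_bits, h27]
  have hov : (orderOverlap n m i : ℂ) = ∑ x : sectorSet n m i, ∑ y : sectorSet n m i,
      ∏ q, if bitAt x.1 q = bitAt y.1 q then (3 : ℂ) else 12 / 5 := by
    rw [orderOverlap]
    push_cast
    refine Finset.sum_congr rfl fun x _ => Finset.sum_congr rfl fun y _ =>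
      Finset.prod_congr rfl fun q _ => ?_
    split_ifs <;> norm_num
  push_cast
  rw [hov]
  simp only [Subtype.coe_inj, ite_and, mul_ite, mul_zero, Finset.sum_ite_eq, Finset.sum_ite_eq',
    Finset.mem_univ, if_true, Finset.sum_const, Finset.card_univ, Fintype.card_coe, nsmul_eq_mul,
    mul_one, one_mul, star_one, ← Finset.mul_sum, Finset.sum_add_distrib]
  simp
  ring

end TwoCopies

/-! ### Second moment of the observable on two snapshots -/

section PairMoment

variable {n m : ℕ}

/-- Distinct strings differ in at least one qubit, where the factor drops from 3 to 12/5; one such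
factor 4/5 is kept and the others are bounded by 3. -/
theorem orderOverlap_le (n m : ℕ) (i : ℤ) :
    orderOverlap n m i ≤ 3 ^ (n + m) * ((sectorSet n m i).card
      + 4 / 5 * ((sectorSet n m i).card * ((sectorSet n m i).card - 1))) := by
  have hcard : (Finset.univ : Finset (Qubit n m)).card = n + m := by simp
  have hle : ∀ (x y : sectorSet n m i),
      (∏ q, if bitAt x.1 q = bitAt y.1 q then (3 : ℝ) else 12 / 5)
        ≤ 3 ^ (n + m) * (4 / 5) + if x = y then 3 ^ (n + m) * (1 / 5) else 0 := by
    intro x y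
    split_ifs with h
    · subst h
      simp only [if_true, Finset.prod_const, hcard]
      linarith
    · have : ∃ q, bitAt x.1 q ≠ bitAt y.1 q := by
        by_contra hc
        push Not at hc
        exact h (Subtype.ext (bitAt_injective (funext hc)))
      obtain ⟨q, hq⟩ := this
      rw [← Finset.mul_prod_erase _ _ (Finset.mem_univ q), if_neg hq]
      have h1 : (∏ r ∈ Finset.univ.erase q, if bitAt x.1 r = bitAt y.1 r then (3 : ℝ) else 12 / 5)
          ≤ ∏ r ∈ Finset.univ.erase q, (3 : ℝ) :=
        Finset.prod_le_prod (fun r _ => by split_ifs <;> norm_num)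
          fun r _ => by split_ifs <;> norm_num
      have h2 : ∏ r : Qubit n m, (3 : ℝ) = 3 ^ (n + m) := by rw [Finset.prod_const, hcard]
      rw [← Finset.mul_prod_erase _ _ (Finset.mem_univ q)] at h2
      linarith
  have h := Finset.sum_le_sum fun x (_ : x ∈ Finset.univ) =>
    Finset.sum_le_sum fun y (_ : y ∈ Finset.univ) => hle x y
  refine h.trans_eq ?_
  simp only [Finset.sum_add_distrib, Finset.sum_const, Finset.card_univ, Fintype.card_coe,
    nsmul_eq_mul, Finset.sum_ite_eq, Finset.mem_univ, if_true]
  ring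

/-- The bound for the second moment of the observable on two snapshots, in terms of the number of
qubits and the dimension of the sector. -/
noncomputable def pairBound (k : ℕ) (D : ℝ) : ℝ :=
  3 ^ k * (D ^ 2 - 2 * D) + 1 / 2 * ((27 / 5) ^ k * D)
    + 1 / 2 * (3 ^ k * (D + 4 / 5 * (D * (D - 1))))

theorem sum_shotProb_mul_normSq_pairForm_le (i : ℤ) (ρ ρ' : QState n m) :
    ∑ s, ∑ s', shotProb ρ s * (shotProb ρ' s' * ‖pairForm i s.snapshot s'.snapshot‖ ^ 2)
      ≤ pairBound (n + m) (sectorSet n m i).card := by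
  set a : (Qubit n m → Fin 6) → ℝ := fun p =>
    ‖∑ t, termCoeff n m i t * ∏ q, termCoord n m i t q (p q)‖ with ha
  set F : Setting n m → Setting n m → ℝ := fun U U' =>
    (∑ p, a p * ∏ q, |twoFeature (p q) (U q, U' q)|) ^ 2 with hF
  have hcard : (Fintype.card (Setting n m) : ℝ) ≠ 0 := by exact_mod_cast Fintype.card_ne_zero
  have h1 : ∀ s s' : Shot n m,
      ‖pairForm i s.snapshot s'.snapshot‖ ^ 2 ≤ F s.setting s'.setting := by
    intro s s'
    have h := norm_sum_prod_le (termCoeff n m i) (termCoord n m i) fun j q =>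
      twoSigned (s.setting q, s'.setting q) (bitAt s.outcome q) (bitAt s'.outcome q) j
    simp only [norm_twoSigned] at h
    rw [pairForm_snapshot]
    exact pow_le_pow_left₀ (norm_nonneg _) h 2
  have h2 : ∀ s : Shot n m, ∑ s', shotProb ρ' s' * ‖pairForm i s.snapshot s'.snapshot‖ ^ 2
      ≤ (Fintype.card (Setting n m) : ℝ)⁻¹ * ∑ U', F s.setting U' := fun s =>
    sum_shotProb_mul_le ρ' _ (fun U' => F s.setting U') fun s' => h1 s s'
  have h3 := sum_shotProb_mul_le ρ _
    (fun U => (Fintype.card (Setting n m) : ℝ)⁻¹ * ∑ U', F U U') h2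
  simp only [Finset.mul_sum] at h3 ⊢
  refine h3.trans ?_
  simp only [← Finset.mul_sum]
  rw [inv_mul_le_iff₀ (by positivity), inv_mul_le_iff₀ (by positivity), ← mul_assoc]
  have h4 : ∑ U, ∑ U', F U U' = ∑ U : Qubit n m → Cl2 × Cl2,
      (∑ p, a p * ∏ q, |twoFeature (p q) (U q)|) ^ 2 := by
    rw [← Fintype.sum_prod_type']
    exact Fintype.sum_equiv
      (Equiv.arrowProdEquivProdArrow (Qubit n m) (fun _ => Cl2) fun _ => Cl2).symm _ _
      fun _ => rfl
  have h5 : (Fintype.card (Qubit n m → Cl2 × Cl2) : ℝ)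
      = Fintype.card (Setting n m) * Fintype.card (Setting n m) := by
    rw [Fintype.card_congr
      (Equiv.arrowProdEquivProdArrow (Qubit n m) (fun _ => Cl2) fun _ => Cl2), Fintype.card_prod]
    push_cast
    rfl
  rw [h4, ← h5]
  refine (sum_sq_twoFeature a).trans (mul_le_mul_of_nonneg_left ?_ (Nat.cast_nonneg _))
  rw [ha, sum_termCoord, pairBound]
  have := orderOverlap_le n m i
  linarith

end PairMoment

/-! ### Number-conserving states and the contracted observable -/

section States

variable {n m : ℕ}

theorem partialTranspose_apply (σ : ABOp n m) (x y : ABIndex n m) :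
    partialTranspose σ x y = σ (x.1, y.2) (y.1, x.2) := rfl

theorem sum_partialTranspose {R : Type*} [AddCommMonoid R] (F : ABIndex n m → ABIndex n m → R) :
    ∑ x : ABIndex n m, ∑ y : ABIndex n m, F (x.1, y.2) (y.1, x.2) = ∑ x, ∑ y, F x y := by
  simp only [Fintype.sum_prod_type]
  refine Finset.sum_congr rfl fun a _ => ?_
  calc ∑ b, ∑ c, ∑ d, F (a, d) (c, b) = ∑ b, ∑ d, ∑ c, F (a, d) (c, b) :=
        Finset.sum_congr rfl fun b _ => Finset.sum_comm
    _ = ∑ d, ∑ b, ∑ c, F (a, d) (c, b) := Finset.sum_comm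
    _ = ∑ d, ∑ c, ∑ b, F (a, d) (c, b) := Finset.sum_congr rfl fun d _ => Finset.sum_comm

theorem trace_mul_partialTranspose (O X : ABOp n m) :
    (O * partialTranspose X).trace = (partialTranspose O * X).trace := by
  simp only [Matrix.trace, Matrix.diag_apply, Matrix.mul_apply]
  rw [← sum_partialTranspose]
  rfl

/-- A state with a conserved total number of excitations has no matrix element between different
numbers of excitations. -/
theorem apply_eq_zero_of_commute {σ : ABOp n m} (h : Commute σ (numberOp n m))
    {x y : ABIndex n m}
    (hxy : excitations x.1 + excitations x.2 ≠ excitations y.1 + excitations y.2) :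
    σ x y = 0 := by
  have h1 := congrFun (congrFun h.eq x) y
  rw [numberOp, Matrix.mul_diagonal, Matrix.diagonal_mul] at h1
  have h2 : (((excitations y.1 + excitations y.2 : ℕ) : ℂ)
      - ((excitations x.1 + excitations x.2 : ℕ) : ℂ)) * σ x y = 0 := by
    linear_combination h1
  rcases mul_eq_zero.1 h2 with h3 | h3
  · exact absurd (by exact_mod_cast (sub_eq_zero.1 h3).symm) hxy
  · exact h3

/-- Exchanging the `B` indices turns conservation of `a + b` into conservation of `a - b`, so the
partial transpose is block diagonal in the sectors. -/
theorem partialTranspose_mem_iff {σ : ABOp n m} (h : Commute σ (numberOp n m)) (i : ℤ)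
    {x y : ABIndex n m} (hxy : partialTranspose σ x y ≠ 0) :
    x ∈ sectorSet n m i ↔ y ∈ sectorSet n m i := by
  have h1 : excitations x.1 + excitations y.2 = excitations y.1 + excitations x.2 := by
    by_contra hne
    exact hxy (apply_eq_zero_of_commute h hne)
  rw [mem_sectorSet, mem_sectorSet]
  constructor <;> intro h2 <;> omega

theorem sectorProj_mul_partialTranspose {σ : ABOp n m} (h : Commute σ (numberOp n m)) (i : ℤ) :
    sectorProj n m i * partialTranspose σ = partialTranspose σ * sectorProj n m i := by
  ext x y
  rw [sectorProj_eq_diagonal, Matrix.diagonal_mul, Matrix.mul_diagonal]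
  by_cases hxy : partialTranspose σ x y = 0
  · rw [hxy]; ring
  · simp only [partialTranspose_mem_iff h i hxy]; ring

theorem sectorProj_mul_self (i : ℤ) : sectorProj n m i * sectorProj n m i = sectorProj n m i := by
  rw [sectorProj_eq_diagonal, Matrix.diagonal_mul_diagonal]
  simp

theorem trace_sectorProj_mul_partialTranspose (i : ℤ) (σ : ABOp n m) :
    (sectorProj n m i * partialTranspose σ).trace = (sectorProj n m i * σ).trace := by
  rw [trace_sectorProj_mul, trace_sectorProj_mul]
  rfl

/-- Since the projector commutes with `σ^Γ`, the two inner copies of it in the purity can be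
dropped, and the two operator orders in `Q` coincide on equal arguments. -/
theorem D2_eq_pairForm {σ : ABOp n m} (h : Commute σ (numberOp n m)) (i : ℤ) :
    D2 i σ = pairForm i σ σ := by
  have hc := sectorProj_mul_partialTranspose h i
  have h1 : sectorProj n m i * partialTranspose σ * sectorProj n m i
      = sectorProj n m i * partialTranspose σ := by
    rw [Matrix.mul_assoc, ← hc, ← Matrix.mul_assoc, sectorProj_mul_self]
  have h2 : (sectorProj n m i * partialTranspose σ) ^ 2
      = sectorProj n m i * (partialTranspose σ * partialTranspose σ) := by
    rw [sq, ← Matrix.mul_assoc, h1, Matrix.mul_assoc]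
  rw [D2, h1, h2, pairForm_eq, trace_sectorProj_mul_partialTranspose]
  ring

/-- The weight of a state in the sector. -/
noncomputable def sectorWeight (i : ℤ) (ρ : QState n m) : ℝ := (sectorProj n m i * ρ.mat).trace.re

/-- The squared norm of the sector block of the partial transpose. -/
noncomputable def sectorPurity (i : ℤ) (ρ : QState n m) : ℝ :=
  ∑ x ∈ sectorSet n m i, ∑ y, ‖partialTranspose ρ.mat x y‖ ^ 2

theorem QState.apply_self (ρ : QState n m) (x : ABIndex n m) : ((ρ.mat x x).re : ℂ) = ρ.mat x x :=
  Complex.ext rfl (Complex.le_def.1 (ρ.posSemidef.diag_nonneg (i := x))).2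

theorem QState.apply_self_nonneg (ρ : QState n m) (x : ABIndex n m) : 0 ≤ (ρ.mat x x).re :=
  (Complex.le_def.1 (ρ.posSemidef.diag_nonneg (i := x))).1

theorem QState.sum_apply_self (ρ : QState n m) : ∑ x, (ρ.mat x x).re = 1 := by
  have h := congrArg Complex.re ρ.trace_eq_one
  simpa [Matrix.trace] using h

/-- Nonnegativity of the two-by-two principal minor at `x` and `y`. -/
theorem QState.normSq_apply_le (ρ : QState n m) (x y : ABIndex n m) :
    ‖ρ.mat x y‖ ^ 2 ≤ (ρ.mat x x).re * (ρ.mat y y).re := by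
  have h := (ρ.posSemidef.submatrix ![x, y]).det_nonneg
  rw [Matrix.det_fin_two] at h
  simp only [Matrix.submatrix_apply, Matrix.cons_val_zero, Matrix.cons_val_one] at h
  rw [← ρ.apply_self x, ← ρ.apply_self y, ← ρ.posSemidef.isHermitian.apply x y,
    Complex.star_def, ← Complex.normSq_eq_conj_mul_self] at h
  have h' : 0 ≤ (ρ.mat x x).re * (ρ.mat y y).re - Complex.normSq (ρ.mat y x) := by
    exact_mod_cast h
  rw [← ρ.posSemidef.isHermitian.apply x y, norm_star, ← Complex.normSq_eq_norm_sq]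
  linarith

theorem QState.sum_normSq_le (ρ : QState n m) : ∑ x, ∑ y, ‖ρ.mat x y‖ ^ 2 ≤ 1 := by
  calc ∑ x, ∑ y, ‖ρ.mat x y‖ ^ 2 ≤ ∑ x, ∑ y, (ρ.mat x x).re * (ρ.mat y y).re :=
        Finset.sum_le_sum fun x _ => Finset.sum_le_sum fun y _ => ρ.normSq_apply_le x y
    _ = 1 := by rw [← Finset.sum_mul_sum, ρ.sum_apply_self, one_mul]

theorem sectorPurity_nonneg (i : ℤ) (ρ : QState n m) : 0 ≤ sectorPurity i ρ := by
  unfold sectorPurity; positivity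

theorem sectorPurity_le_one (i : ℤ) (ρ : QState n m) : sectorPurity i ρ ≤ 1 := by
  refine le_trans ?_ ρ.sum_normSq_le
  rw [← sum_partialTranspose]
  exact Finset.sum_le_univ_sum_of_nonneg fun x => Finset.sum_nonneg fun y _ => sq_nonneg _

theorem sectorWeight_eq_sum (i : ℤ) (ρ : QState n m) :
    sectorWeight i ρ = ∑ x ∈ sectorSet n m i, (ρ.mat x x).re := by
  rw [sectorWeight, trace_sectorProj_mul, Complex.re_sum]

theorem trace_sectorProj_mul_state (i : ℤ) (ρ : QState n m) :
    (sectorProj n m i * ρ.mat).trace = sectorWeight i ρ := by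
  rw [sectorWeight_eq_sum, trace_sectorProj_mul]
  push_cast
  exact Finset.sum_congr rfl fun x _ => (ρ.apply_self x).symm

theorem sectorWeight_nonneg (i : ℤ) (ρ : QState n m) : 0 ≤ sectorWeight i ρ := by
  rw [sectorWeight_eq_sum]
  exact Finset.sum_nonneg fun x _ => ρ.apply_self_nonneg x

theorem sectorWeight_le_one (i : ℤ) (ρ : QState n m) : sectorWeight i ρ ≤ 1 := by
  rw [sectorWeight_eq_sum, ← ρ.sum_apply_self]
  exact Finset.sum_le_univ_sum_of_nonneg fun x => ρ.apply_self_nonneg x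

theorem trace_sectorProj_mul_sq (i : ℤ) (ρ : QState n m) :
    (sectorProj n m i * (partialTranspose ρ.mat * partialTranspose ρ.mat)).trace
      = sectorPurity i ρ := by
  rw [trace_sectorProj_mul, sectorPurity]
  push_cast
  refine Finset.sum_congr rfl fun x _ => ?_
  rw [Matrix.mul_apply]
  refine Finset.sum_congr rfl fun y _ => ?_
  rw [← Complex.mul_conj', partialTranspose_apply, partialTranspose_apply,
    ← ρ.posSemidef.isHermitian.apply (y.1, x.2)]
  rfl

theorem pairForm_self (i : ℤ) (ρ : QState n m) :
    pairForm i ρ.mat ρ.mat = ((sectorWeight i ρ ^ 2 - sectorPurity i ρ : ℝ) : ℂ) := by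
  rw [pairForm_eq, trace_sectorProj_mul_sq, trace_sectorProj_mul_state]
  push_cast
  ring

theorem norm_pairForm_self_le (i : ℤ) (ρ : QState n m) : ‖pairForm i ρ.mat ρ.mat‖ ≤ 1 := by
  rw [pairForm_self, Complex.norm_real, Real.norm_eq_abs, abs_le]
  have h1 := sectorPurity_nonneg i ρ
  have h2 := sectorPurity_le_one i ρ
  have h3 := sectorWeight_nonneg i ρ
  have h4 := sectorWeight_le_one i ρ
  constructor <;> nlinarith

/-- The squared norm of the operator obtained by contracting the observable with a state. -/
noncomputable def linearNorm (i : ℤ) (ρ : QState n m) : ℝ :=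
  (sectorSet n m i).card * sectorWeight i ρ ^ 2 - 2 * sectorWeight i ρ ^ 2 + sectorPurity i ρ

/-- A partial transpose only permutes entries and keeps the Frobenius norm. The cross term is `-2`
times the weight times the trace on the sector, which is again the weight. -/
theorem sum_normSq_contracted (i : ℤ) (ρ : QState n m) :
    ∑ x, ∑ y, ‖partialTranspose ((sectorWeight i ρ : ℂ) • sectorProj n m i
        - sectorProj n m i * partialTranspose ρ.mat) x y‖ ^ 2 = linearNorm i ρ := by
  simp only [partialTranspose_apply]
  rw [sum_partialTranspose fun x y => ‖((sectorWeight i ρ : ℂ) • sectorProj n m i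
        - sectorProj n m i * partialTranspose ρ.mat) x y‖ ^ 2]
  have h : ∀ x, ∑ y, ‖((sectorWeight i ρ : ℂ) • sectorProj n m i
        - sectorProj n m i * partialTranspose ρ.mat) x y‖ ^ 2
      = if x ∈ sectorSet n m i then (sectorWeight i ρ ^ 2 - 2 * sectorWeight i ρ * (ρ.mat x x).re
        + ∑ y, ‖partialTranspose ρ.mat x y‖ ^ 2) else 0 := by
    intro x
    have hentry : ∀ y, ((sectorWeight i ρ : ℂ) • sectorProj n m i
        - sectorProj n m i * partialTranspose ρ.mat) x y
        = if x ∈ sectorSet n m i then (if x = y then (sectorWeight i ρ : ℂ) else 0)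
          - partialTranspose ρ.mat x y else 0 := by
      intro y
      rw [Matrix.sub_apply, sectorProj_mul_apply, Matrix.smul_apply, sectorProj_eq_diagonal,
        Matrix.diagonal_apply, smul_eq_mul]
      split_ifs <;> simp
    simp only [hentry]
    split_ifs with hx
    · have h2 : ∀ y,
          ‖(if x = y then (sectorWeight i ρ : ℂ) else 0) - partialTranspose ρ.mat x y‖ ^ 2
          = (if x = y then sectorWeight i ρ ^ 2 - 2 * sectorWeight i ρ * (ρ.mat x x).re else 0)
            + ‖partialTranspose ρ.mat x y‖ ^ 2 := by
        intro y
        split_ifs with hxy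
        · subst hxy
          rw [partialTranspose_apply]
          simp only [← Complex.normSq_eq_norm_sq, Complex.normSq_apply, Complex.sub_re,
            Complex.sub_im, Complex.ofReal_re, Complex.ofReal_im, Prod.mk.eta]
          ring
        · simp
      simp only [h2, Finset.sum_add_distrib, Finset.sum_ite_eq, Finset.mem_univ, if_true]
    · simp
  simp only [h, Finset.sum_ite_mem, Finset.univ_inter, Finset.sum_add_distrib,
    Finset.sum_sub_distrib, Finset.sum_const, nsmul_eq_mul, ← Finset.mul_sum,
    ← sectorWeight_eq_sum]
  rw [linearNorm, sectorPurity]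
  ring

theorem linearNorm_nonneg (i : ℤ) (ρ : QState n m) : 0 ≤ linearNorm i ρ := by
  rw [← sum_normSq_contracted]
  positivity

/-- By cyclicity and the commutation with the projector, both operator orders give the same
functional of `X`. Moving the partial transpose to the other factor exhibits the one-copy operator.
-/
theorem pairForm_state (i : ℤ) (ρ : QState n m) (h : Commute ρ.mat (numberOp n m)) (X : ABOp n m) :
    pairForm i X ρ.mat = (partialTranspose ((sectorWeight i ρ : ℂ) • sectorProj n m i
        - sectorProj n m i * partialTranspose ρ.mat) * X).trace := by
  rw [← trace_mul_partialTranspose, pairForm_eq, trace_sectorProj_mul_state, sub_mul,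
    Matrix.trace_sub, Matrix.smul_mul, Matrix.trace_smul, trace_sectorProj_mul_partialTranspose,
    ← Matrix.mul_assoc, Matrix.trace_mul_comm _ (partialTranspose ρ.mat), ← Matrix.mul_assoc,
    ← sectorProj_mul_partialTranspose h i, smul_eq_mul, ← Matrix.mul_assoc]
  ring

theorem sum_shotProb_mul_normSq_pairForm_state_le (i : ℤ) (τ ρ : QState n m)
    (h : Commute ρ.mat (numberOp n m)) :
    ∑ s, shotProb τ s * ‖pairForm i s.snapshot ρ.mat‖ ^ 2 ≤ 2 ^ (n + m) * linearNorm i ρ := by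
  simp only [pairForm_state i ρ h, ← sum_normSq_contracted]
  exact sum_shotProb_mul_normSq_trace_le τ _

end States

/-! ### Mean square error of a U-statistic of non-identically distributed variables -/

section Hoeffding

variable {Ω : Type*} [Fintype Ω]

/-- Centering never increases a second moment; it is applied first in `x` for fixed `y`, then in `y`
for fixed `x`. -/
theorem sum_normSq_doublyCentered_le (p p' : Ω → ℝ) (hp : ∑ x, p x = 1) (hp' : ∑ x, p' x = 1)
    (hp0 : ∀ x, 0 ≤ p x) (hp0' : ∀ x, 0 ≤ p' x) (f : Ω → Ω → ℂ) :
    ∑ x, ∑ y, p x * (p' y * ‖f x y - ∑ z, (p' z : ℂ) * f x z - ∑ w, (p w : ℂ) * f w y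
        + ∑ w, (p w : ℂ) * ∑ z, (p' z : ℂ) * f w z‖ ^ 2)
      ≤ ∑ x, ∑ y, p x * (p' y * ‖f x y‖ ^ 2) := by
  have h1 : ∀ y, ∑ x, p x * ‖f x y - ∑ z, (p' z : ℂ) * f x z - ∑ w, (p w : ℂ) * f w y
        + ∑ w, (p w : ℂ) * ∑ z, (p' z : ℂ) * f w z‖ ^ 2
      ≤ ∑ x, p x * ‖f x y - ∑ z, (p' z : ℂ) * f x z‖ ^ 2 := by
    intro y
    refine le_trans (le_of_eq ?_)
      (sum_mul_normSq_le_of_centered p hp fun x => f x y - ∑ z, (p' z : ℂ) * f x z)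
    refine Finset.sum_congr rfl fun x _ => ?_
    simp only [mul_sub, Finset.sum_sub_distrib]
    congr 3
    ring
  have h2 : ∀ x, ∑ y, p' y * ‖f x y - ∑ z, (p' z : ℂ) * f x z‖ ^ 2 ≤ ∑ y, p' y * ‖f x y‖ ^ 2 :=
    fun x => sum_mul_normSq_le_of_centered p' hp' fun y => f x y
  calc ∑ x, ∑ y, p x * (p' y * ‖f x y - ∑ z, (p' z : ℂ) * f x z - ∑ w, (p w : ℂ) * f w y
        + ∑ w, (p w : ℂ) * ∑ z, (p' z : ℂ) * f w z‖ ^ 2)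
      = ∑ y, p' y * ∑ x, p x * ‖f x y - ∑ z, (p' z : ℂ) * f x z - ∑ w, (p w : ℂ) * f w y
        + ∑ w, (p w : ℂ) * ∑ z, (p' z : ℂ) * f w z‖ ^ 2 := by
        rw [Finset.sum_comm]
        refine Finset.sum_congr rfl fun y _ => ?_
        rw [Finset.mul_sum]
        exact Finset.sum_congr rfl fun x _ => by ring
    _ ≤ ∑ y, p' y * ∑ x, p x * ‖f x y - ∑ z, (p' z : ℂ) * f x z‖ ^ 2 :=
        Finset.sum_le_sum fun y _ => mul_le_mul_of_nonneg_left (h1 y) (hp0' y)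
    _ = ∑ x, p x * ∑ y, p' y * ‖f x y - ∑ z, (p' z : ℂ) * f x z‖ ^ 2 := by
        simp only [Finset.mul_sum]
        rw [Finset.sum_comm]
        exact Finset.sum_congr rfl fun x _ => Finset.sum_congr rfl fun y _ => by ring
    _ ≤ ∑ x, p x * ∑ y, p' y * ‖f x y‖ ^ 2 :=
        Finset.sum_le_sum fun x _ => mul_le_mul_of_nonneg_left (h2 x) (hp0 x)
    _ = _ := by simp only [Finset.mul_sum]

theorem normSq_sum_le_card_mul {ι : Type*} (s : Finset ι) (f : ι → ℂ) :
    ‖∑ k ∈ s, f k‖ ^ 2 ≤ s.card * ∑ k ∈ s, ‖f k‖ ^ 2 :=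
  (pow_le_pow_left₀ (norm_nonneg _) (norm_sum_le s f) 2).trans (sq_sum_le_card_mul_sum_sq)

theorem sum_offDiag_eq {N : ℕ} {R : Type*} [AddCommMonoid R] (F : Fin N → Fin N → R) :
    ∑ q ∈ (Finset.univ : Finset (Fin N)).offDiag, F q.1 q.2
      = ∑ j, ∑ k, if j = k then 0 else F j k := by
  rw [← Fintype.sum_prod_type' fun j k => if j = k then 0 else F j k]
  have : (Finset.univ : Finset (Fin N)).offDiag
      = Finset.univ.filter fun q : Fin N × Fin N => ¬ q.1 = q.2 := by
    ext q; simp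
  rw [this, Finset.sum_filter]
  exact Finset.sum_congr rfl fun q _ => by split_ifs <;> simp_all

theorem sum_ite_ne_const {N : ℕ} (j : Fin N) (c : ℝ) :
    (∑ k, if j = k then 0 else c) = (N - 1) * c := by
  have : ∀ k, (if j = k then (0 : ℝ) else c) = c - if j = k then c else 0 := fun k => by
    split_ifs <;> simp
  simp only [this, Finset.sum_sub_distrib, Finset.sum_ite_eq, Finset.mem_univ, if_true,
    Finset.sum_const, Finset.card_univ, Fintype.card_fin, nsmul_eq_mul]
  ring

theorem normSq_sum_ite_ne_le {N : ℕ} (j : Fin N) (g : Fin N → ℂ) :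
    ‖∑ k, if j = k then 0 else g k‖ ^ 2 ≤ (N - 1) * ∑ k, if j = k then 0 else ‖g k‖ ^ 2 := by
  have e : (Finset.univ.erase j : Finset (Fin N)) = Finset.univ.filter fun k => ¬ j = k := by
    ext k; simp [eq_comm]
  have e1 : (∑ k, if j = k then 0 else g k) = ∑ k ∈ Finset.univ.erase j, g k := by
    rw [e, Finset.sum_filter]
    exact Finset.sum_congr rfl fun k _ => by by_cases h : j = k <;> simp [h]
  have e2 : (∑ k, if j = k then 0 else ‖g k‖ ^ 2) = ∑ k ∈ Finset.univ.erase j, ‖g k‖ ^ 2 := by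
    rw [e, Finset.sum_filter]
    exact Finset.sum_congr rfl fun k _ => by by_cases h : j = k <;> simp [h]
  rw [e1, e2]
  refine (normSq_sum_le_card_mul _ _).trans_eq ?_
  rw [Finset.card_erase_of_mem (Finset.mem_univ j), Finset.card_univ, Fintype.card_fin,
    Nat.cast_sub (by have := j.2; omega), Nat.cast_one]

/-- The means are removed by the variance inequality, and Cauchy–Schwarz over the `N - 1` partners
of `j` costs one factor `N - 1` besides the number of summands. No averaging over the states is
needed. -/
theorem sum_normSq_linear_le {N : ℕ} (p : Ω → ℝ) (hp : ∑ x, p x = 1) (hp0 : ∀ x, 0 ≤ p x)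
    (e : Fin N → Ω → ℂ) (ν : Fin N → ℂ) (hν : ∀ k, ν k = ∑ x, (p x : ℂ) * e k x) (L : ℝ)
    (hL : ∀ k, ∑ x, p x * ‖e k x‖ ^ 2 ≤ L) (κ : ℂ) (j : Fin N) :
    ∑ x, p x * ‖κ * (2 * ∑ k, if j = k then 0 else e k x - ν k)‖ ^ 2
      ≤ ‖κ‖ ^ 2 * (4 * ((N - 1) * ((N - 1) * L))) := by
  have h2 : ∀ x, ‖κ * (2 * ∑ k, if j = k then 0 else e k x - ν k)‖ ^ 2
      = ‖κ‖ ^ 2 * (4 * ‖(∑ k, if j = k then 0 else e k x) - ∑ y, (p y : ℂ) *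
        ∑ k, if j = k then 0 else e k y‖ ^ 2) := by
    intro x
    have hM : ∑ y, (p y : ℂ) * (∑ k, if j = k then 0 else e k y)
        = ∑ k, if j = k then 0 else ν k := by
      simp only [Finset.mul_sum]
      rw [Finset.sum_comm]
      refine Finset.sum_congr rfl fun k _ => ?_
      by_cases h : j = k
      · simp [h]
      · simp [h, hν k]
    have : (∑ k, if j = k then 0 else e k x - ν k)
        = (∑ k, if j = k then 0 else e k x) - ∑ k, if j = k then 0 else ν k := by
      rw [← Finset.sum_sub_distrib]
      exact Finset.sum_congr rfl fun k _ => by by_cases h : j = k <;> simp [h]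
    rw [hM, this, norm_mul, norm_mul, mul_pow, mul_pow]
    norm_num
  have hN1 : (0 : ℝ) ≤ N - 1 := by
    have : (1 : ℝ) ≤ N := by exact_mod_cast (by have := j.2; omega : 1 ≤ N)
    linarith
  have h3 : ∑ x, p x * ‖(∑ k, if j = k then 0 else e k x) - ∑ y, (p y : ℂ) *
        ∑ k, if j = k then 0 else e k y‖ ^ 2 ≤ (N - 1) * ((N - 1) * L) := by
    calc _ ≤ ∑ x, p x * ‖∑ k, if j = k then 0 else e k x‖ ^ 2 :=
          sum_mul_normSq_le_of_centered p hp _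
      _ ≤ ∑ x, p x * ((N - 1) * ∑ k, if j = k then 0 else ‖e k x‖ ^ 2) :=
          Finset.sum_le_sum fun x _ =>
            mul_le_mul_of_nonneg_left (normSq_sum_ite_ne_le j fun k => e k x) (hp0 x)
      _ = (N - 1) * ∑ k, if j = k then 0 else ∑ x, p x * ‖e k x‖ ^ 2 := by
          simp only [mul_left_comm (p _), ← Finset.mul_sum]
          congr 1
          simp only [Finset.mul_sum]
          rw [Finset.sum_comm]
          refine Finset.sum_congr rfl fun k _ => ?_
          by_cases h : j = k <;> simp [h]
      _ ≤ (N - 1) * ∑ k, if j = k then 0 else L := by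
          refine mul_le_mul_of_nonneg_left (Finset.sum_le_sum fun k _ => ?_) hN1
          by_cases h : j = k
          · simp [h]
          · simpa [h] using hL k
      _ = _ := by rw [sum_ite_ne_const]
  simp only [h2, mul_left_comm (p _), ← Finset.mul_sum]
  gcongr

/-- The mean square error of a `U`-statistic of independent, not necessarily identically
distributed variables. -/
theorem sum_normSq_ustatistic_le {N : ℕ} (p : Fin N → Ω → ℝ) (hp : ∀ k, ∑ x, p k x = 1)
    (hp0 : ∀ k x, 0 ≤ p k x) (f : Ω → Ω → ℂ) (hf : ∀ x y, f x y = f y x)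
    (e : Fin N → Ω → ℂ) (he : ∀ k x, e k x = ∑ y, (p k y : ℂ) * f x y)
    (μ : Fin N → Fin N → ℂ) (hμ : ∀ j k, μ j k = ∑ x, (p j x : ℂ) * e k x)
    (L V : ℝ) (hL : ∀ j k, ∑ x, p j x * ‖e k x‖ ^ 2 ≤ L)
    (hV : ∀ j k, ∑ x, ∑ y, p j x * (p k y * ‖f x y‖ ^ 2) ≤ V) (κ T : ℂ) :
    ∑ s : Fin N → Ω, (∏ k, p k (s k)) *
        ‖κ * (∑ j, ∑ k, if j = k then 0 else f (s j) (s k)) - T‖ ^ 2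
      ≤ ‖κ * (∑ j, ∑ k, if j = k then 0 else μ j k) - T‖ ^ 2
        + ‖κ‖ ^ 2 * (4 * (N * ((N - 1) * ((N - 1) * L))))
        + ‖κ‖ ^ 2 * (2 * (N * ((N - 1) * V))) := by
  have hpC : ∀ k, ∑ x, (p k x : ℂ) = 1 := fun k => by exact_mod_cast hp k
  have he' : ∀ k y, ∑ x, (p k x : ℂ) * f x y = e k y := fun k y => by
    rw [he]; exact Finset.sum_congr rfl fun x _ => by rw [hf]
  have hμsymm : ∀ j k, μ j k = μ k j := by
    intro j k
    simp only [hμ, he, Finset.mul_sum]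
    rw [Finset.sum_comm]
    exact Finset.sum_congr rfl fun x _ => Finset.sum_congr rfl fun y _ => by rw [hf]; ring
  -- The first-order projection, doubled because a symmetric kernel meets `x` in either slot; `h`
  -- below is the doubly centered remainder.
  set t : Fin N → Ω → ℂ := fun j x => κ * (2 * ∑ k, if j = k then 0 else e k x - μ j k) with ht
  set h : Fin N → Fin N → Ω → Ω → ℂ := fun j k x y =>
    if j = k then 0 else κ * (f x y - e k x - e j y + μ j k) with hh
  have hdecomp : ∀ s : Fin N → Ω,
      κ * (∑ j, ∑ k, if j = k then 0 else f (s j) (s k)) - T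
        = (κ * (∑ j, ∑ k, if j = k then 0 else μ j k) - T) + ∑ k, t k (s k)
          + ∑ j, ∑ k, h j k (s j) (s k) := by
    intro s
    have h1 : (∑ j, ∑ k, if j = k then 0 else e j (s k) - μ j k)
        = ∑ j, ∑ k, if j = k then 0 else e k (s j) - μ j k := by
      rw [Finset.sum_comm]
      refine Finset.sum_congr rfl fun j _ => Finset.sum_congr rfl fun k _ => ?_
      rw [hμsymm k j]
      by_cases hjk : j = k
      · rw [if_pos hjk, if_pos hjk.symm]
      · rw [if_neg hjk, if_neg (Ne.symm hjk)]
    have h2 : (∑ j, ∑ k, if j = k then 0 else f (s j) (s k))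
        = (∑ j, ∑ k, if j = k then 0 else μ j k)
          + (∑ j, ∑ k, if j = k then 0 else e k (s j) - μ j k)
          + (∑ j, ∑ k, if j = k then 0 else e j (s k) - μ j k)
          + ∑ j, ∑ k, if j = k then 0 else f (s j) (s k) - e k (s j) - e j (s k) + μ j k := by
      simp only [← Finset.sum_add_distrib]
      refine Finset.sum_congr rfl fun j _ => Finset.sum_congr rfl fun k _ => ?_
      split_ifs
      · simp
      · ring
    have h3 : ∑ k, t k (s k) = κ * (2 * ∑ j, ∑ k, if j = k then 0 else e k (s j) - μ j k) := by
      simp only [ht, Finset.mul_sum]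
    have h4 : ∑ j, ∑ k, h j k (s j) (s k) = κ *
        ∑ j, ∑ k, if j = k then 0 else f (s j) (s k) - e k (s j) - e j (s k) + μ j k := by
      simp only [hh, Finset.mul_sum, mul_ite, mul_zero]
    rw [h2, h1, h3, h4]
    ring
  have htc : ∀ k, ∑ x, (p k x : ℂ) * t k x = 0 := by
    intro j
    have h1 : ∀ k, ∑ x, (p j x : ℂ) * (if j = k then 0 else e k x - μ j k) = 0 := by
      intro k
      split_ifs
      · simp
      · simp only [mul_sub, Finset.sum_sub_distrib, ← Finset.sum_mul, hpC, one_mul, ← hμ, sub_self]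
    have h2 : ∑ x, (p j x : ℂ) * t j x
        = κ * (2 * ∑ k, ∑ x, (p j x : ℂ) * (if j = k then 0 else e k x - μ j k)) := by
      rw [Finset.sum_comm, Finset.mul_sum, Finset.mul_sum]
      refine Finset.sum_congr rfl fun x _ => ?_
      rw [← Finset.mul_sum]
      simp only [ht]
      ring
    rw [h2, Finset.sum_eq_zero fun k _ => h1 k, mul_zero, mul_zero]
  have hhc : ∀ j k y, ∑ x, (p j x : ℂ) * h j k x y = 0 := by
    intro j k y
    simp only [hh]
    split_ifs
    · simp
    · simp only [mul_left_comm _ κ, ← Finset.mul_sum]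
      simp only [mul_add, mul_sub, Finset.sum_add_distrib, Finset.sum_sub_distrib,
        ← Finset.sum_mul, hpC, one_mul, ← hμ, he']
      ring
  rw [Finset.sum_congr rfl fun s _ => by rw [hdecomp s],
    sum_normSq_quadratic p hp _ t htc h (fun k x y => by simp [hh]) (fun j k x y => by
      simp only [hh, hf x y, hμsymm j k]
      by_cases hjk : j = k
      · rw [if_pos hjk, if_pos hjk.symm]
      · rw [if_neg hjk, if_neg (Ne.symm hjk)]
        ring) hhc, add_assoc, add_assoc]
  refine add_le_add_right (add_le_add ?_ ?_) _
  · have h1 : ∀ j, ∑ x, p j x * ‖t j x‖ ^ 2 ≤ ‖κ‖ ^ 2 * (4 * ((N - 1) * ((N - 1) * L))) := fun j =>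
      sum_normSq_linear_le (p j) (hp j) (hp0 j) e (μ j) (hμ j) L (hL j) κ j
    refine (Finset.sum_le_sum fun j _ => h1 j).trans_eq ?_
    rw [Finset.sum_const, Finset.card_univ, Fintype.card_fin, nsmul_eq_mul]
    ring
  -- Only off-diagonal pairs carry a remainder, and double centering bounds each by the raw second
  -- moment `V`.
  · have h1 : ∀ j k, ∑ x, ∑ y, p j x * (p k y * ‖h j k x y‖ ^ 2)
        ≤ if j = k then 0 else ‖κ‖ ^ 2 * V := by
      intro j k
      simp only [hh]
      split_ifs
      · simp
      · have h2 := sum_normSq_doublyCentered_le (p j) (p k) (hp j) (hp k) (hp0 j) (hp0 k) f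
        simp only [← he, ← hμ, he'] at h2
        have h3 : ∑ x, ∑ y, p j x * (p k y * ‖κ * (f x y - e k x - e j y + μ j k)‖ ^ 2)
            = ‖κ‖ ^ 2 * ∑ x, ∑ y, p j x * (p k y * ‖f x y - e k x - e j y + μ j k‖ ^ 2) := by
          simp only [Finset.mul_sum, norm_mul, mul_pow]
          exact Finset.sum_congr rfl fun x _ => Finset.sum_congr rfl fun y _ => by ring
        rw [h3]
        exact mul_le_mul_of_nonneg_left (h2.trans (hV j k)) (sq_nonneg _)
    have h2 : ∑ j, ∑ k, ∑ x, ∑ y, p j x * (p k y * ‖h j k x y‖ ^ 2)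
        ≤ N * ((N - 1) * (‖κ‖ ^ 2 * V)) := by
      refine (Finset.sum_le_sum fun j _ => Finset.sum_le_sum fun k _ => h1 j k).trans_eq ?_
      simp only [sum_ite_ne_const, Finset.sum_const, Finset.card_univ,
        Fintype.card_fin, nsmul_eq_mul]
    calc _ ≤ 2 * (N * ((N - 1) * (‖κ‖ ^ 2 * V))) := by linarith
      _ = _ := by ring

end Hoeffding

/-! ### Comparison of the pair bound with the constant `C₂` -/

section Numerics

/-- For `k ≥ 5` the coefficient of `D²` on the left, `(56/5) 3^k`, is below `3 · 4^k`, and the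
linear term has room for the constant. At `k = 4` it is larger (907.2 against 768), so there the
bound `D ≤ 6` must be used. -/
theorem pairBound_le_of_four_le {k : ℕ} (hk : 4 ≤ k) {D : ℝ} (hD : 1 ≤ D) (hD4 : k = 4 → D ≤ 6) :
    8 * pairBound k D + 8 ≤ 8 ^ k * D + 4 ^ k * (D * (3 * D - 4)) := by
  unfold pairBound
  rcases hk.eq_or_lt with rfl | hk5
  · have := hD4 rfl
    norm_num
    nlinarith [mul_nonneg (sub_nonneg.2 hD) (sub_nonneg.2 this)]
  · obtain ⟨j, rfl⟩ := Nat.exists_eq_add_of_le (show 5 ≤ k from hk5)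
    have h1 : (3 : ℝ) ^ j ≤ 4 ^ j := pow_le_pow_left₀ (by norm_num) (by norm_num) j
    have h2 : (27 / 5 : ℝ) ^ j ≤ 8 ^ j := pow_le_pow_left₀ (by norm_num) (by norm_num) j
    have h3 : (4 : ℝ) ^ j ≤ 8 ^ j := pow_le_pow_left₀ (by norm_num) (by norm_num) j
    have h4 : (1 : ℝ) ≤ 8 ^ j := one_le_pow₀ (by norm_num)
    have h5 : (1 : ℝ) ≤ 3 ^ j := one_le_pow₀ (by norm_num)
    simp only [pow_add]
    generalize (3 : ℝ) ^ j = a at *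
    generalize (4 : ℝ) ^ j = b at *
    generalize (27 / 5 : ℝ) ^ j = c at *
    generalize (8 : ℝ) ^ j = e at *
    have hq : 0 ≤ (3 * 1024 * b - 56 / 5 * 243 * a) * D ^ 2 :=
      mul_nonneg (by linarith) (sq_nonneg D)
    have hl : 8 * 1 ≤ (32768 * e - 4 * 1024 * b + 76 / 5 * 243 * a - 4 * (27 / 5) ^ 5 * c) * D := by
      refine mul_le_mul ?_ hD zero_le_one ?_ <;> norm_num <;> linarith
    norm_num at hl ⊢
    nlinarith

/-- This is the case `D = 1` of the next inequality, with equality at `k = 0`. -/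
theorem pow_eight_add_pow_three_ge (k : ℕ) : (4 : ℝ) ^ k + (27 / 5) ^ k ≤ 8 ^ k + 3 ^ k := by
  induction k with
  | zero => norm_num
  | succ k ih =>
    have h1 : (3 : ℝ) ^ k ≤ 4 ^ k := pow_le_pow_left₀ (by norm_num) (by norm_num) k
    have h2 : (3 : ℝ) ^ k ≤ (27 / 5) ^ k := pow_le_pow_left₀ (by norm_num) (by norm_num) k
    have h3 : (0 : ℝ) < 3 ^ k := by positivity
    simp only [pow_succ]
    linarith

theorem two_mul_pairBound_le (k : ℕ) {D : ℝ} (hD : 1 ≤ D) :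
    2 * pairBound k D ≤ 8 ^ k * D + 4 ^ k * (D * (3 * D - 4)) := by
  unfold pairBound
  have h0 := pow_eight_add_pow_three_ge k
  have h1 : (3 : ℝ) ^ k ≤ 4 ^ k := pow_le_pow_left₀ (by norm_num) (by norm_num) k
  have h2 : (0 : ℝ) < 3 ^ k := by positivity
  generalize (3 : ℝ) ^ k = a at *
  generalize (4 : ℝ) ^ k = b at *
  generalize (27 / 5 : ℝ) ^ k = c at *
  generalize (8 : ℝ) ^ k = e at *
  -- The difference of the two sides, written around `D = 1`.
  have h3 : 0 ≤ D * ((3 * b - 14 / 5 * a) * (D - 1) + (e + a - b - c)) :=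
    mul_nonneg (by linarith) (add_nonneg (mul_nonneg (by linarith) (by linarith)) (by linarith))
  nlinarith

end Numerics

/-! ### Bias, mean square error and the sample bound -/

section Estimator

variable {n m N : ℕ}

/-- The bilinear form of the observable as a linear map in the first argument. -/
noncomputable def pairFormLinear (i : ℤ) (Y : ABOp n m) : ABOp n m →ₗ[ℂ] ℂ where
  toFun X := pairForm i X Y
  map_add' X X' := by
    simp only [pairForm, Matrix.add_kronecker, Matrix.mul_add, Matrix.trace_add]
  map_smul' c X := by
    simp only [pairForm, Matrix.smul_kronecker, Matrix.mul_smul, Matrix.trace_smul,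
      RingHom.id_apply]

/-- Unbiasedness of the snapshot passes through the bilinear form, so replacing a snapshot by its
state is exactly the conditional expectation needed for Hoeffding's decomposition. -/
theorem pairForm_eq_sum_shotProb (i : ℤ) (ρ : QState n m) (X : ABOp n m) :
    pairForm i X ρ.mat = ∑ s, (shotProb ρ s : ℂ) * pairForm i X s.snapshot := by
  have h : ρ.mat = ∑ s, (shotProb ρ s : ℂ) • s.snapshot := by
    ext c d
    rw [Matrix.sum_apply, ← sum_shotProb_mul_snapshot]
    rfl
  rw [pairForm_symm, h]
  change pairFormLinear i X _ = _
  rw [map_sum]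
  refine Finset.sum_congr rfl fun s _ => ?_
  rw [map_smul, smul_eq_mul, pairForm_symm]
  rfl

theorem pairForm_avgState (i : ℤ) (ρ : Fin N → QState n m) :
    pairForm i (avgState ρ) (avgState ρ)
      = 1 / (N : ℂ) * (1 / (N : ℂ) * ∑ j, ∑ k, pairForm i (ρ j).mat (ρ k).mat) := by
  have h : ∀ Y, pairForm i (avgState ρ) Y = 1 / (N : ℂ) * ∑ j, pairForm i (ρ j).mat Y := by
    intro Y
    change pairFormLinear i Y _ = _
    rw [avgState, map_smul, map_sum, smul_eq_mul]
    rfl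
  rw [h]
  simp only [pairForm_symm i _ (avgState ρ), h]
  rw [← Finset.mul_sum, Finset.sum_comm]

/-- The average of states as a state. -/
noncomputable def avgQState (hN : N ≠ 0) (ρ : Fin N → QState n m) : QState n m where
  mat := avgState ρ
  posSemidef := by
    have h : (0 : ℂ) ≤ 1 / (N : ℂ) := by
      rw [one_div, ← Complex.ofReal_natCast, ← Complex.ofReal_inv]
      exact_mod_cast (by positivity : (0 : ℝ) ≤ (N : ℝ)⁻¹)
    exact (Matrix.posSemidef_sum _ fun k _ => (ρ k).posSemidef).smul h
  trace_eq_one := by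
    rw [avgState, Matrix.trace_smul, Matrix.trace_sum]
    simp [(ρ _).trace_eq_one, hN]

theorem commute_avgState (ρ : Fin N → QState n m) (h : ∀ k, Commute (ρ k).mat (numberOp n m)) :
    Commute (avgState ρ) (numberOp n m) :=
  (Commute.sum_left _ _ _ fun k _ => h k).smul_left _

/-- The bias of the estimator. -/
theorem norm_bias_le (hN : 2 ≤ N) (i : ℤ) (ρ : Fin N → QState n m)
    (h : ∀ k, Commute (ρ k).mat (numberOp n m)) :
    ‖1 / ((N : ℂ) * ((N : ℂ) - 1)) *
        (∑ j, ∑ k, if j = k then 0 else pairForm i (ρ j).mat (ρ k).mat) - D2 i (avgState ρ)‖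
      ≤ 2 / ((N : ℝ) - 1) := by
  have hN0 : N ≠ 0 := by omega
  have hNC : (N : ℂ) ≠ 0 := by exact_mod_cast hN0
  have hN1 : (0 : ℝ) < (N : ℝ) - 1 := by
    have : (2 : ℝ) ≤ N := by exact_mod_cast hN
    linarith
  have hN1C : (N : ℂ) - 1 ≠ 0 := by
    have := hN1.ne'
    exact_mod_cast this
  have hsum : (∑ j, ∑ k, if j = k then 0 else pairForm i (ρ j).mat (ρ k).mat)
      = (∑ j, ∑ k, pairForm i (ρ j).mat (ρ k).mat) - ∑ k, pairForm i (ρ k).mat (ρ k).mat := by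
    rw [← Finset.sum_sub_distrib]
    refine Finset.sum_congr rfl fun j _ => ?_
    have : ∀ k, (if j = k then 0 else pairForm i (ρ j).mat (ρ k).mat)
        = pairForm i (ρ j).mat (ρ k).mat - if j = k then pairForm i (ρ j).mat (ρ k).mat else 0 :=
      fun k => by split_ifs <;> simp
    simp only [this, Finset.sum_sub_distrib, Finset.sum_ite_eq, Finset.mem_univ, if_true]
  have havg := pairForm_avgState i ρ
  have hD := D2_eq_pairForm (commute_avgState ρ h) i
  -- Omitting the diagonal pairs leaves the difference between the form on the average state and the
  -- average of the diagonal values, divided by `N - 1`. Both have modulus at most 1.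
  have hrepr : 1 / ((N : ℂ) * ((N : ℂ) - 1)) *
        (∑ j, ∑ k, if j = k then 0 else pairForm i (ρ j).mat (ρ k).mat) - D2 i (avgState ρ)
      = (((N : ℝ) - 1)⁻¹ : ℝ) * (pairForm i (avgState ρ) (avgState ρ)
        - 1 / (N : ℂ) * ∑ k, pairForm i (ρ k).mat (ρ k).mat) := by
    rw [hsum, hD, havg]
    push_cast
    field_simp
    ring
  have h1 : ‖pairForm i (avgState ρ) (avgState ρ)‖ ≤ 1 :=
    norm_pairForm_self_le i (avgQState hN0 ρ)
  have h2 : ‖1 / (N : ℂ) * ∑ k, pairForm i (ρ k).mat (ρ k).mat‖ ≤ 1 := by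
    rw [norm_mul, norm_div, norm_one, Complex.norm_natCast, one_div,
      inv_mul_le_iff₀ (by positivity), mul_one]
    refine (norm_sum_le _ _).trans ((Finset.sum_le_sum fun k _ =>
      norm_pairForm_self_le i (ρ k)).trans_eq ?_)
    simp
  rw [hrepr, norm_mul, Complex.norm_real, Real.norm_eq_abs, abs_of_pos (inv_pos.2 hN1),
    inv_mul_le_iff₀ hN1, mul_div_cancel₀ _ hN1.ne']
  exact (norm_sub_le _ _).trans (by linarith)

/-- The mean square error of the estimator. -/
theorem sum_normSq_estimator_le (hN : 2 ≤ N) (i : ℤ) (ρ : Fin N → QState n m)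
    (h : ∀ k, Commute (ρ k).mat (numberOp n m)) (L : ℝ) (hL : ∀ k, linearNorm i (ρ k) ≤ L) :
    ∑ s : Fin N → Shot n m, (∏ k, shotProb (ρ k) (s k)) *
        ‖D2Estimator i s - D2 i (avgState ρ)‖ ^ 2
      ≤ 4 * (2 ^ (n + m) * L) / (N - 1)
        + (2 * pairBound (n + m) (sectorSet n m i).card + 4) / (N - 1) ^ 2 := by
  have hN1 : (1 : ℝ) ≤ (N : ℝ) - 1 := by
    have : (2 : ℝ) ≤ N := by exact_mod_cast hN
    linarith
  have hNN : (N : ℝ) - 1 ≤ N := by linarith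
  have hest : ∀ s : Fin N → Shot n m, D2Estimator i s = 1 / ((N : ℂ) * ((N : ℂ) - 1)) *
      (∑ j, ∑ k, if j = k then 0 else pairForm i (s j).snapshot (s k).snapshot) := by
    intro s
    rw [D2Estimator, ← sum_offDiag_eq fun j k => pairForm i (s j).snapshot (s k).snapshot]
    rfl
  have hmain := sum_normSq_ustatistic_le (fun k => shotProb (ρ k)) (fun k => sum_shotProb (ρ k))
    (fun k => shotProb_nonneg (ρ k)) (fun s s' : Shot n m => pairForm i s.snapshot s'.snapshot)
    (fun s s' => pairForm_symm i _ _) (fun k s => pairForm i s.snapshot (ρ k).mat)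
    (fun k s => pairForm_eq_sum_shotProb i (ρ k) _) (fun j k => pairForm i (ρ j).mat (ρ k).mat)
    (fun j k => by
      rw [pairForm_symm, pairForm_eq_sum_shotProb]
      exact Finset.sum_congr rfl fun s _ => by rw [pairForm_symm])
    (2 ^ (n + m) * L) (pairBound (n + m) (sectorSet n m i).card)
    (fun j k => (sum_shotProb_mul_normSq_pairForm_state_le i (ρ j) (ρ k) (h k)).trans
      (mul_le_mul_of_nonneg_left (hL k) (by positivity)))
    (fun j k => sum_shotProb_mul_normSq_pairForm_le i (ρ j) (ρ k))
    (1 / ((N : ℂ) * ((N : ℂ) - 1))) (D2 i (avgState ρ))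
  simp only [hest]
  refine hmain.trans ?_
  have hbias := pow_le_pow_left₀ (norm_nonneg _) (norm_bias_le hN i ρ h) 2
  have hκ : ‖1 / ((N : ℂ) * ((N : ℂ) - 1))‖ = 1 / ((N : ℝ) * ((N : ℝ) - 1)) := by
    have : (1 / ((N : ℂ) * ((N : ℂ) - 1))) = ((1 / ((N : ℝ) * ((N : ℝ) - 1)) : ℝ) : ℂ) := by
      push_cast; rfl
    rw [this, Complex.norm_real, Real.norm_eq_abs, abs_of_nonneg]
    positivity
  have hL0 : 0 ≤ L := (linearNorm_nonneg i (ρ ⟨0, by omega⟩)).trans (hL _)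
  have hV0 : 0 ≤ pairBound (n + m) (sectorSet n m i).card := by
    refine le_trans ?_ (sum_shotProb_mul_normSq_pairForm_le i (ρ ⟨0, by omega⟩) (ρ ⟨0, by omega⟩))
    exact Finset.sum_nonneg fun s _ => Finset.sum_nonneg fun s' _ =>
      mul_nonneg (shotProb_nonneg _ _) (mul_nonneg (shotProb_nonneg _ _) (sq_nonneg _))
  rw [hκ]
  generalize pairBound (n + m) (sectorSet n m i).card = V at *
  -- One factor `N` in the denominator is weakened to `N - 1`, here and in the quadratic part, so
  -- that the whole error is expressed in `1 / (N - 1)`.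
  have hlin : (1 / ((N : ℝ) * ((N : ℝ) - 1))) ^ 2 *
      (4 * (N * ((N - 1) * ((N - 1) * (2 ^ (n + m) * L)))))
      ≤ 4 * (2 ^ (n + m) * L) / (N - 1) := by
    have : (1 / ((N : ℝ) * ((N : ℝ) - 1))) ^ 2 *
      (4 * (N * ((N - 1) * ((N - 1) * (2 ^ (n + m) * L))))) = 4 * (2 ^ (n + m) * L) / N := by
      have h1 : (N : ℝ) ≠ 0 := by linarith
      have h2 : (N : ℝ) - 1 ≠ 0 := by linarith
      field_simp
    rw [this]
    exact div_le_div_of_nonneg_left (by positivity) (by linarith) hNN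
  have hquad : (1 / ((N : ℝ) * ((N : ℝ) - 1))) ^ 2 * (2 * (N * ((N - 1) * V)))
      ≤ 2 * V / (N - 1) ^ 2 := by
    have : (1 / ((N : ℝ) * ((N : ℝ) - 1))) ^ 2 * (2 * (N * ((N - 1) * V)))
        = 2 * V / (N * (N - 1)) := by
      have h1 : (N : ℝ) ≠ 0 := by linarith
      have h2 : (N : ℝ) - 1 ≠ 0 := by linarith
      field_simp
    rw [this, sq]
    exact div_le_div_of_nonneg_left (by positivity) (by nlinarith) (by nlinarith)
  have hb : (2 / ((N : ℝ) - 1)) ^ 2 = 4 / (N - 1) ^ 2 := by rw [div_pow]; norm_num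
  rw [hb] at hbias
  rw [add_div]
  linarith

theorem shadowLaw_singleton (ρ : Fin N → QState n m) (s : Fin N → Shot n m) :
    shadowLaw ρ {s} = ENNReal.ofReal (∏ k, shotProb (ρ k) (s k)) := by
  rw [shadowLaw, MeasureTheory.Measure.pi_singleton,
    ENNReal.ofReal_prod_of_nonneg fun k _ => shotProb_nonneg _ _]
  refine Finset.prod_congr rfl fun k _ => ?_
  rw [PMF.toMeasure_apply_singleton _ _ (measurableSet_singleton _), shotPMF_apply]

/-- Chebyshev's inequality for the estimator. -/
theorem accurateD2_of_sum_le (i : ℤ) (ρ : Fin N → QState n m) {ε δ : ℝ} (hε : 0 < ε) (hδ : 0 < δ)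
    (h : ∑ s : Fin N → Shot n m, (∏ k, shotProb (ρ k) (s k)) *
        ‖D2Estimator i s - D2 i (avgState ρ)‖ ^ 2 ≤ ε ^ 2 * δ) :
    AccurateD2 i ρ ε δ := by
  classical
  have hp0 : ∀ s : Fin N → Shot n m, 0 ≤ ∏ k, shotProb (ρ k) (s k) := fun s =>
    Finset.prod_nonneg fun k _ => shotProb_nonneg _ _
  set B : Finset (Fin N → Shot n m) :=
    Finset.univ.filter fun s => ¬ ‖D2Estimator i s - D2 i (avgState ρ)‖ ≤ ε with hB
  have hprob : MeasureTheory.IsProbabilityMeasure (shadowLaw ρ) := by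
    unfold shadowLaw; infer_instance
  have hset : {s : Fin N → Shot n m | ‖D2Estimator i s - D2 i (avgState ρ)‖ ≤ ε}
      = (B : Set (Fin N → Shot n m))ᶜ := by
    ext s; simp [hB]
  have hsumB : ∑ s ∈ B, ∏ k, shotProb (ρ k) (s k) ≤ δ := by
    -- Markov's inequality for the squared error, on the finite set of records.
    have h1 : ε ^ 2 * ∑ s ∈ B, ∏ k, shotProb (ρ k) (s k)
        ≤ ∑ s : Fin N → Shot n m, (∏ k, shotProb (ρ k) (s k)) *
          ‖D2Estimator i s - D2 i (avgState ρ)‖ ^ 2 := by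
      rw [Finset.mul_sum]
      refine le_trans (Finset.sum_le_sum fun s hs => ?_)
        (Finset.sum_le_univ_sum_of_nonneg (s := B) fun s => mul_nonneg (hp0 s) (sq_nonneg _))
      rw [mul_comm]
      refine mul_le_mul_of_nonneg_left (pow_le_pow_left₀ hε.le ?_ 2) (hp0 s)
      exact (not_le.1 (Finset.mem_filter.1 hs).2).le
    exact le_of_mul_le_mul_left (h1.trans h) (by positivity)
  have hmB : shadowLaw ρ (B : Set (Fin N → Shot n m)) ≤ ENNReal.ofReal δ := by
    rw [← MeasureTheory.sum_measure_singleton]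
    simp only [shadowLaw_singleton]
    rw [← ENNReal.ofReal_sum_of_nonneg fun s _ => hp0 s]
    exact ENNReal.ofReal_le_ofReal hsumB
  rw [AccurateD2, hset, MeasureTheory.prob_compl_eq_one_sub B.measurableSet,
    ENNReal.ofReal_sub _ hδ.le, ENNReal.ofReal_one]
  exact tsub_le_tsub_left hmB 1

/-- A sample bound makes the estimator accurate. -/
theorem accurateD2_of_sampleBound (i : ℤ) (ρ : Fin N → QState n m)
    (h : ∀ k, Commute (ρ k).mat (numberOp n m)) {ε δ c₁ c₂ : ℝ} (hε : 0 < ε) (hδ : 0 < δ)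
    (hD : 1 ≤ sectorDim n m i) (hc₁ : 0 ≤ c₁) (hc₂ : 0 < c₂)
    (hL : ∀ k, 4 * linearNorm i (ρ k) ≤ sectorDim n m i * c₁)
    (hV : 8 * pairBound (n + m) (sectorDim n m i) + 16 ≤ 8 ^ (n + m) * sectorDim n m i * c₂)
    (hN : sampleBound n m i ε δ c₁ c₂ ≤ (N : ℝ)) : AccurateD2 i ρ ε δ := by
  unfold sampleBound at hN
  have hw2 : (0 : ℝ) < 2 ^ (n + m) := by positivity
  have h8 : (8 : ℝ) ^ (n + m) = 2 ^ (n + m) * 2 ^ (n + m) * 2 ^ (n + m) := by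
    rw [← mul_pow, ← mul_pow]; norm_num
  have he : 0 < ε ^ 2 * δ := by positivity
  have hL' : ∀ k, linearNorm i (ρ k) ≤ sectorDim n m i * c₁ / 4 := fun k => by
    have := hL k; linarith
  have hmse := fun hN2 : 2 ≤ N => sum_normSq_estimator_le hN2 i ρ h _ hL'
  rw [← sectorDim_eq_card] at hmse
  rw [h8] at hV
  generalize sectorDim n m i = D at *
  generalize pairBound (n + m) D = V at *
  generalize (2 : ℝ) ^ (n + m) = w at *
  have hD0 : 0 < D := by linarith
  set r := Real.sqrt (c₁ ^ 2 + c₂ * (ε ^ 2 * δ * w / D)) with hr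
  have hr2 : r ^ 2 = c₁ ^ 2 + c₂ * (ε ^ 2 * δ * w / D) := Real.sq_sqrt (by positivity)
  have hr0 : 0 < r := Real.sqrt_pos.2 (by positivity)
  have hM0 : 0 < w * D / (ε ^ 2 * δ) * (1 / 2) * (c₁ + r) := by positivity
  have hM : w * D / (ε ^ 2 * δ) * (1 / 2) * (c₁ + r) ≤ (N : ℝ) - 1 := by linarith
  -- Positivity of `c₂` makes the sample bound strictly larger than 1, which excludes the degenerate
  -- cases `N = 0` and `N = 1`.
  have hN2 : 2 ≤ N := by
    have : (1 : ℝ) < N := by linarith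
    exact_mod_cast this
  refine accurateD2_of_sum_le i ρ hε hδ ((hmse hN2).trans ?_)
  generalize (N : ℝ) - 1 = M at *
  have hMpos : 0 < M := hM0.trans_le hM
  have hy : c₁ + r ≤ 2 * (ε ^ 2 * δ) * M / (w * D) := by
    rw [le_div_iff₀ (by positivity)]
    have : w * D / (ε ^ 2 * δ) * (1 / 2) * (c₁ + r) * (2 * (ε ^ 2 * δ)) ≤ M * (2 * (ε ^ 2 * δ)) :=
      mul_le_mul_of_nonneg_right hM (by positivity)
    have e : w * D / (ε ^ 2 * δ) * (1 / 2) * (c₁ + r) * (2 * (ε ^ 2 * δ)) = (c₁ + r) * (w * D) := by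
      field_simp
    linarith
  set y := 2 * (ε ^ 2 * δ) * M / (w * D) with hydef
  -- Since `y - c₁` is at least the square root `r`, squaring removes the root; rescaling below
  -- gives the quadratic inequality in `M`.
  have hq : c₂ * (ε ^ 2 * δ * w / D) ≤ y ^ 2 - 2 * c₁ * y := by
    have h1 : r ^ 2 ≤ (y - c₁) ^ 2 := pow_le_pow_left₀ hr0.le (by linarith) 2
    nlinarith
  have hq2 : w * w * w * D * c₂ / 4 ≤ ε ^ 2 * δ * M ^ 2 - w * D * c₁ * M := by
    have h1 := mul_le_mul_of_nonneg_left hq (show 0 ≤ (w * D) ^ 2 / (4 * (ε ^ 2 * δ)) by positivity)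
    have e1 :
        (w * D) ^ 2 / (4 * (ε ^ 2 * δ)) * (c₂ * (ε ^ 2 * δ * w / D)) = w * w * w * D * c₂ / 4 := by
      field_simp
    have e2 : (w * D) ^ 2 / (4 * (ε ^ 2 * δ)) * (y ^ 2 - 2 * c₁ * y)
        = ε ^ 2 * δ * M ^ 2 - w * D * c₁ * M := by
      rw [hydef]
      field_simp
      ring
    rwa [e1, e2] at h1
  have hfin : 4 * (w * (D * c₁ / 4)) / M + (2 * V + 4) / M ^ 2
      = (w * D * c₁ * M + (2 * V + 4)) / M ^ 2 := by
    field_simp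
  rw [hfin, div_le_iff₀ (by positivity)]
  linarith

end Estimator

/-! ### The constants `C₁` and `C₂` -/

section Constants

variable {n m N : ℕ}

theorem constC1_eq (i : ℤ) (ρ : Fin N → QState n m) (hD : 1 ≤ sectorDim n m i)
    (h : ∀ k, Commute (ρ k).mat (numberOp n m)) :
    constC1 i ρ = ⨆ k, 4 * linearNorm i (ρ k) / sectorDim n m i := by
  unfold constC1
  congr 1
  funext k
  have h1 : (partialTranspose (ρ k).mat * sectorProj n m i * partialTranspose (ρ k).mat).trace.re
      = sectorPurity i (ρ k) := by
    rw [← sectorProj_mul_partialTranspose (h k), Matrix.mul_assoc, trace_sectorProj_mul_sq,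
      Complex.ofReal_re]
  rw [h1, linearNorm, ← sectorDim_eq_card]
  change 4 * (sectorWeight i (ρ k) ^ 2 + (_ - 2 * sectorWeight i (ρ k) ^ 2) / _) = _
  field_simp
  ring

/-- For dimension at least 2 the coefficient of the squared weight is nonnegative, so weight and
purity can both be replaced by 1. -/
theorem linearNorm_le (i : ℤ) (ρ : QState n m) (hD : 2 ≤ sectorDim n m i) :
    linearNorm i ρ ≤ sectorDim n m i - 1 := by
  rw [linearNorm, ← sectorDim_eq_card]
  have h1 := sectorPurity_le_one i ρ
  have h2 : sectorWeight i ρ ^ 2 ≤ 1 :=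
    pow_le_one₀ (sectorWeight_nonneg i ρ) (sectorWeight_le_one i ρ)
  nlinarith

/-- Clearing denominators; the odd-looking last term of `C₂` becomes the constant 8, one half of the
16 that the sample bound requires. -/
theorem mul_constC2 (n m : ℕ) (i : ℤ) (hD : 1 ≤ sectorDim n m i) :
    8 ^ (n + m) * sectorDim n m i * constC2 n m i
      = 8 ^ (n + m) * sectorDim n m i
        + 4 ^ (n + m) * (sectorDim n m i * (3 * sectorDim n m i - 4)) + 8 := by
  have h8 : (8 : ℝ) ^ (n + m) = 2 ^ (n + m) * 2 ^ (n + m) * 2 ^ (n + m) := by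
    rw [← mul_pow, ← mul_pow]; norm_num
  have h4 : (4 : ℝ) ^ (n + m) = 2 ^ (n + m) * 2 ^ (n + m) := by
    rw [← mul_pow]; norm_num
  have h2 : (2 : ℝ) ^ (2 * (n + m)) = 2 ^ (n + m) * 2 ^ (n + m) := by
    rw [two_mul, pow_add]
  rw [constC2, h8, h4, h2]
  have : (0 : ℝ) < 2 ^ (n + m) := by positivity
  generalize (2 : ℝ) ^ (n + m) = w at *
  field_simp
  ring

theorem constC2_pos (n m : ℕ) (i : ℤ) (hD : 1 ≤ sectorDim n m i) : 0 < constC2 n m i := by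
  have h := mul_constC2 n m i hD
  have h1 : (4 : ℝ) ^ (n + m) ≤ 8 ^ (n + m) := pow_le_pow_left₀ (by norm_num) (by norm_num) _
  have h2 : (0 : ℝ) < 4 ^ (n + m) := by positivity
  have h3 : 0 < 8 ^ (n + m) * sectorDim n m i := by positivity
  refine (mul_pos_iff_of_pos_left h3).1 ?_
  rw [h]
  nlinarith [mul_nonneg h2.le (mul_nonneg (show 0 ≤ sectorDim n m i by linarith)
    (sub_nonneg.2 hD)), mul_le_mul_of_nonneg_right h1 (show 0 ≤ sectorDim n m i by linarith)]

theorem three_mul_sectorDim_le {i : ℤ} (hi : -(m : ℤ) ≤ i) (hk : 4 ≤ n + m) :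
    3 * sectorDim n m i ≤ 2 ^ (n + m) + 3 := by
  rw [sectorDim_eq_card, card_sectorSet hi]
  exact_mod_cast three_mul_choose_le hk _

theorem constC2_le_two {i : ℤ} (hi : -(m : ℤ) ≤ i) (hD : 1 ≤ sectorDim n m i) (hk : 4 ≤ n + m) :
    constC2 n m i ≤ 2 := by
  have h1 := three_mul_sectorDim_le hi hk
  have h2 : (2 : ℝ) ^ (2 * 4) ≤ 2 ^ (2 * (n + m)) :=
    pow_le_pow_right₀ (by norm_num) (by omega)
  have h3 : 8 / (sectorDim n m i * 2 ^ (2 * (n + m))) ≤ 1 := by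
    rw [div_le_one (by positivity)]
    have := mul_le_mul hD h2 (by norm_num) (by linarith)
    norm_num at this
    linarith
  have h4 : (3 * sectorDim n m i - 4 + 8 / (sectorDim n m i * 2 ^ (2 * (n + m)))) / 2 ^ (n + m)
      ≤ 1 := by
    rw [div_le_one (by positivity)]
    linarith
  rw [constC2]
  linarith

end Constants

/-! ### Assembly of the three claims -/

theorem mainTheorem2 (n m N : ℕ) (i : ℤ) (hi : -(m : ℤ) ≤ i ∧ i ≤ (n : ℤ))
    (ε δ : ℝ) (hε : ε ∈ Set.Ioo (0 : ℝ) 1) (hδ : δ ∈ Set.Ioo (0 : ℝ) 1)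
    (ρ : Fin N → QState n m) (hsymm : ∀ k, Commute (ρ k).mat (numberOp n m)) :
    (4 ≤ n + m → sampleBound n m i ε δ (constC1 i ρ) (constC2 n m i) ≤ (N : ℝ) →
      AccurateD2 i ρ ε δ) ∧
    (sampleBound n m i ε δ (constC1 i ρ) (4 * constC2 n m i) ≤ (N : ℝ) →
      AccurateD2 i ρ ε δ) ∧
    (4 ≤ n + m → -(m : ℤ) < i → i < (n : ℤ) →
      constC1 i ρ ≤ 4 * (1 - 1 / sectorDim n m i) ∧ constC2 n m i ≤ 2 ∧
      (sampleBound n m i ε δ 4 2 ≤ (N : ℝ) → AccurateD2 i ρ ε δ)) := by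
  have hD : 1 ≤ sectorDim n m i := by
    rw [sectorDim_eq_card]
    exact_mod_cast one_le_card_sectorSet hi.1 hi.2
  have hD0 : 0 < sectorDim n m i := by linarith
  have hC1 := constC1_eq i ρ hD hsymm
  have hC1nonneg : 0 ≤ constC1 i ρ := by
    rw [hC1]
    exact Real.iSup_nonneg fun k =>
      div_nonneg (mul_nonneg (by norm_num) (linearNorm_nonneg i _)) hD0.le
  have hL : ∀ k, 4 * linearNorm i (ρ k) ≤ sectorDim n m i * constC1 i ρ := by
    intro k
    rw [← div_le_iff₀' hD0, hC1]
    exact le_ciSup (f := fun k => 4 * linearNorm i (ρ k) / sectorDim n m i)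
      (Set.finite_range _).bddAbove k
  have hC2 := mul_constC2 n m i hD
  have hC2pos := constC2_pos n m i hD
  have hV1 : 4 ≤ n + m → 8 * pairBound (n + m) (sectorDim n m i) + 16
      ≤ 8 ^ (n + m) * sectorDim n m i * constC2 n m i := by
    intro hk
    have := pairBound_le_of_four_le hk hD fun h4 => by
      have h3 := three_mul_choose_le hk (m + i).toNat
      rw [h4] at h3
      rw [sectorDim_eq_card, card_sectorSet hi.1, h4]
      exact_mod_cast (by omega : Nat.choose 4 (m + i).toNat ≤ 6)
    linarith
  refine ⟨fun hk hN => ?_, fun hN => ?_, fun hk h1 h2 => ?_⟩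
  · exact accurateD2_of_sampleBound i ρ hsymm hε.1 hδ.1 hD hC1nonneg hC2pos hL (hV1 hk) hN
  · refine accurateD2_of_sampleBound i ρ hsymm hε.1 hδ.1 hD hC1nonneg (by linarith) hL ?_ hN
    -- Multiplying by 4 gives `8V`, and the constant `4 · 8 = 32` more than covers the 16.
    have := two_mul_pairBound_le (n + m) hD
    linarith
  · have hD2 : 2 ≤ sectorDim n m i := by
      rw [sectorDim_eq_card]
      exact_mod_cast two_le_card_sectorSet h1 h2
    have hC2le := constC2_le_two hi.1 hD hk
    refine ⟨?_, hC2le, fun hN => ?_⟩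
    · rw [hC1]
      have hle : 4 * (1 - 1 / sectorDim n m i) = 4 * (sectorDim n m i - 1) / sectorDim n m i := by
        field_simp
      rw [hle]
      -- The nonnegativity of the bound is needed for `N = 0`, where the supremum over the empty
      -- family is 0.
      refine Real.iSup_le (fun k => ?_) (div_nonneg (by linarith) hD0.le)
      have := linearNorm_le i (ρ k) hD2
      gcongr
    · refine accurateD2_of_sampleBound i ρ hsymm hε.1 hδ.1 hD (by norm_num) (by norm_num)
        (fun k => ?_) ((hV1 hk).trans ?_) hN
      · have := linearNorm_le i (ρ k) hD2
        linarith
      · exact mul_le_mul_of_nonneg_left hC2le (by positivity)
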